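/- For $V:\mathbb{R}^3\to\mathbb{R}$ integrable, let $\widehat V(p)=\int_{\mathbb{R}^3}e^{-ip\cdot x}V(x)\,dx$. Assume that $V$ is radial (so that $\widehat V$ is real and radial), that $V\ge 0$, $\widehat V\ge 0$, that $V$ is not almost everywhere zero, and that $\widehat V\in C^1(\mathbb{R}^3)\cap L^1(\mathbb{R}^3)\cap L^\infty(\mathbb{R}^3)$ and $\nabla\widehat V\in L^2(\mathbb{R}^3)\cap L^\infty(\mathbb{R}^3)$. Let $\mathcal D$ be the set of triples $(\gamma,\alpha,\rho_0)$ with $\gamma,\alpha:\mathbb{R}^3\to\mathbb{R}$ measurable, $\gamma\ge 0$, $\int(1+p^2)\gamma(p)\,dp<\infty$, $\alpha(p)^2\le\gamma(p)(1+\gamma(p))$ and $\rho_0\in[0,\infty)$. Put $\rho_\gamma=(2\pi)^{-3}\int\gamma(p)\,dp$, $\beta(p)=\sqrt{(\tfrac12+\gamma(p))^2-\alpha(p)^2}$ and $$S(\gamma,\alpha)=(2\pi)^{-3}\int\Big[\big(\beta(p)+\tfrac12\big)\ln\big(\beta(p)+\tfrac12\big)-\big(\beta(p)-\tfrac12\big)\ln\big(\beta(p)-\tfrac12\big)\Big]dp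 ,$$ where $0\ln 0=0$. Let $T>0$ and $\rho\ge 0$. For $(\gamma,\alpha,\rho_0)\in\mathcal D$ with $\rho_0=\rho-\rho_\gamma$ consider $$\begin{aligned}\mathcal F^{\rm can}(\gamma,\alpha,\rho_0)={}&(2\pi)^{-3}\int p^2\gamma(p)\,dp-TS(\gamma,\alpha)+\tfrac12\widehat V(0)\rho^2+\rho_0(2\pi)^{-3}\int\widehat V(p)\big(\gamma(p)+\alpha(p)\big)dp\\&+\tfrac12(2\pi)^{-6}\iint\widehat V(p-q)\big(\alpha(p)\alpha(q)+\gamma(p)\gamma(q)\big)\,dp\,dq .\end{aligned}$$ Then all these integrals converge absolutely for every such triple, and the canonical minimization problem $$F^{\rm can}(T,\rho)=\inf\big\{\mathcal F^{\rm can}(\gamma,\alpha,\rho_0):(\gamma,\alpha,\rho_0)\in\mathcal D,\ \rho_0=\rho-\rho_\gamma\big\}$$ has a minimizer: there is a triple $(\gamma,\alpha,\rho_0)\in\mathcal D$ with $\rho_0=\rho-\rho_\gamma$ at which the infimum is attained. -/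

import Mathlib

open MeasureTheory

noncomputable section

namespace BogoliubovGas

/-- Three-dimensional Euclidean space (used both as position and as momentum space). -/
abbrev Space3 := EuclideanSpace ℝ (Fin 3)

/-- The integral `∫ exp(-i p·x) V(x) dx` defining the Fourier transform of `V` at `p`. -/
def fourierC (V : Space3 → ℝ) (p : Space3) : ℂ :=
  ∫ x : Space3, Complex.exp (-(Complex.I * (inner ℝ p x : ℝ))) * (V x : ℂ)

/-- `V` is radial. -/
def IsRadial (V : Space3 → ℝ) : Prop := ∀ x y : Space3, ‖x‖ = ‖y‖ → V x = V y

/-- The Fourier transform of a radial potential, as a real-valued function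
(see `fourierC_eq_vHat`: for radial `V` the integral is real). -/
def vHat (V : Space3 → ℝ) (p : Space3) : ℝ := (fourierC V p).re

/-- For a radial potential, the Fourier integral is the real number `vHat V p`. -/
theorem fourierC_eq_vHat {V : Space3 → ℝ} (hV : IsRadial V) (p : Space3) :
    fourierC V p = (vHat V p : ℂ) := by
  have h : (starRingEnd ℂ) (fourierC V p) = fourierC V p := by
    unfold fourierC
    rw [← integral_conj]
    conv_rhs => rw [← integral_neg_eq_self]
    refine integral_congr_ae (Filter.Eventually.of_forall fun x => ?_)
    have hx : V (-x) = V x := hV _ _ (norm_neg x)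
    simp [← Complex.exp_conj, hx]
  exact (Complex.conj_eq_iff_re.mp h).symm

/-- The standing assumptions on the two-body interaction potential `V`. -/
structure IsInteraction (V : Space3 → ℝ) : Prop where
  radial : IsRadial V
  integrable : Integrable V
  nonneg : ∀ x, 0 ≤ V x
  ne_zero : ¬ (V =ᵐ[volume] 0)
  hat_nonneg : ∀ p, 0 ≤ vHat V p
  hat_contDiff : ContDiff ℝ 1 (vHat V)
  hat_integrable : Integrable (vHat V)
  hat_bounded : ∃ C : ℝ, ∀ p, |vHat V p| ≤ C
  grad_memLp_two : MemLp (gradient (vHat V)) 2 volume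
  grad_bounded : ∃ C : ℝ, ∀ p, ‖gradient (vHat V) p‖ ≤ C

/-- A triple `(γ, α, ρ₀)`. -/
structure State where
  γ : Space3 → ℝ
  α : Space3 → ℝ
  ρ₀ : ℝ

/-- The domain `𝓓` of the functional. -/
def domain : Set State :=
  {x | Integrable (fun p => (1 + ‖p‖ ^ 2) * x.γ p) ∧ (∀ p, 0 ≤ x.γ p) ∧
    AEStronglyMeasurable x.α volume ∧ (∀ p, x.α p ^ 2 ≤ x.γ p * (1 + x.γ p)) ∧ 0 ≤ x.ρ₀}

/-- The factor `(2π)⁻³` that accompanies each momentum integral. -/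
def c3 : ℝ := ((2 * Real.pi) ^ 3)⁻¹

/-- `ρ_γ = (2π)⁻³ ∫ γ`. -/
def rhoGamma (γ : Space3 → ℝ) : ℝ := c3 * ∫ p, γ p

/-- `β = √((1/2 + γ)² - α²)`. -/
def beta (g a : ℝ) : ℝ := Real.sqrt ((1 / 2 + g) ^ 2 - a ^ 2)

/-- The entropy density
`s(β) = (β + 1/2) ln (β + 1/2) - (β - 1/2) ln (β - 1/2)`, with `0 ln 0 = 0`. -/
def entropyDensity (g a : ℝ) : ℝ :=
  (beta g a + 1 / 2) * Real.log (beta g a + 1 / 2) -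
    (beta g a - 1 / 2) * Real.log (beta g a - 1 / 2)

/-- The entropy `S(γ, α)`. -/
def entropy (γ α : Space3 → ℝ) : ℝ := c3 * ∫ p, entropyDensity (γ p) (α p)

/-- The canonical free energy functional at temperature `T`, with `ρ = ρ₀ + ρ_γ`. -/
def canonicalEnergy (V : Space3 → ℝ) (T : ℝ) (x : State) : ℝ :=
  c3 * (∫ p, ‖p‖ ^ 2 * x.γ p) - T * entropy x.γ x.α
    + 1 / 2 * vHat V 0 * (x.ρ₀ + rhoGamma x.γ) ^ 2
    + x.ρ₀ * (c3 * ∫ p, vHat V p * (x.γ p + x.α p))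
    + 1 / 2 * (c3 ^ 2 *
        ∫ z : Space3 × Space3, vHat V (z.1 - z.2) * (x.α z.1 * x.α z.2 + x.γ z.1 * x.γ z.2))

/-- All the integrals in the definition of the functional converge absolutely at `x`. -/
structure IsFiniteAt (V : Space3 → ℝ) (x : State) : Prop where
  density : Integrable x.γ
  kinetic : Integrable (fun p => ‖p‖ ^ 2 * x.γ p)
  entropy : Integrable (fun p => entropyDensity (x.γ p) (x.α p))
  linear : Integrable (fun p => vHat V p * (x.γ p + x.α p))
  quadratic : Integrable (fun z : Space3 × Space3 =>
    vHat V (z.1 - z.2) * (x.α z.1 * x.α z.2 + x.γ z.1 * x.γ z.2))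

/-- The admissible triples at fixed density `ρ`: those in `𝓓` with `ρ₀ = ρ - ρ_γ`. -/
def canonicalDomain (ρ : ℝ) : Set State := {x | x ∈ domain ∧ x.ρ₀ = ρ - rhoGamma x.γ}

end BogoliubovGas

end

/-! At fixed total density the direct term ½V̂(0)ρ² is constant. At fixed condensate density r the
rest (`reduced`) is midpoint convex in (γ, α): the entropy density is concave, and the two quadratic
forms are nonnegative because V̂ is the transform of some V ≥ 0. Convexity is lost once r = ρ - ρ_γ
is inserted, and γ is controlled only in L¹, so a minimizing sequence may concentrate. The kinetic
energy prevents escape to large momenta. Concentration at p = 0 is harmless: such mass acts like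
condensate and, once the sign of α is chosen well, can be moved into ρ₀ without raising the limiting
energy (`exists_reducedMin_cut_le`, `exists_adm_reduced_le_of_tendsto`). Concentration at any other
momentum has to be excluded.

Compactness (`exists_state_le_of_bounded`) holds for sequences with γ ≤ b, where b is bounded away
from the origin. Along a subsequence r_n → r. At this fixed r the almost optimal pairs form
decreasing midpoint convex classes, and elements of almost minimal norm in a weighted L² space are
Cauchy by the parallelogram law, hence converge almost everywhere along a subsequence
(`exists_ae_tendsto`). Fatou's lemma with the ideal Bose gas as lower bound, together with
positivity of the quadratic forms, gives lower semicontinuity.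

To obtain b, the energy is first minimized under γ ≤ k. Such minimizers are bounded on ‖p‖ ≥ s
uniformly in k (`exists_uniform_bound`). If γ were huge near some momentum, its mass could be moved
to a thin shell of slightly smaller radius (`IsTruncatedMin.swap_le`). The kinetic energy does not
grow, and because the potentials generated by a minimizer are radial and Lipschitz, the interaction
changes by O(δ) per particle for a shell at distance δ. The entropy gained per particle is of order
T divided by the mean occupation of the shell. Among N dyadic shells one carries at most 1/N of the
mass, so its mean occupation is O(1/(Nδ)) and the gain, of order Nδ, wins for large N.

Finally k → ∞: the truncated minimizers share the bound b, their energies decrease, and every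
admissible pair is approximated in energy by truncated ones. -/

noncomputable section
namespace BogoliubovGas

/-! ### The entropy density -/

/-- The entropy density as a function of `β`. -/
def eta (b : ℝ) : ℝ :=
  (b + 1 / 2) * Real.log (b + 1 / 2) - (b - 1 / 2) * Real.log (b - 1 / 2)

theorem entropyDensity_eq (g a : ℝ) : entropyDensity g a = eta (beta g a) := rfl

theorem continuous_eta : Continuous eta := by
  unfold eta
  have h := Real.continuous_mul_log
  exact (h.comp (continuous_id.add continuous_const)).sub
    (h.comp (continuous_id.sub continuous_const))

theorem continuous_entropyDensity : Continuous fun z : ℝ × ℝ => entropyDensity z.1 z.2 := by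
  simp only [entropyDensity_eq]
  refine continuous_eta.comp ?_
  unfold beta
  fun_prop

theorem hasDerivAt_eta {b : ℝ} (hb : 1 / 2 < b) :
    HasDerivAt eta (Real.log (b + 1 / 2) - Real.log (b - 1 / 2)) b := by
  have h1 := (Real.hasDerivAt_mul_log (x := b + 1 / 2) (by linarith)).comp b
    ((hasDerivAt_id b).add_const (1 / 2))
  have h2 := (Real.hasDerivAt_mul_log (x := b - 1 / 2) (by linarith)).comp b
    ((hasDerivAt_id b).sub_const (1 / 2))
  refine (h1.sub h2).congr_deriv ?_
  ring

/-- With y = 1/(2b) the quotient (b + 1/2)/(b - 1/2) is (1 + y)/(1 - y); the bound is the first term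
of the artanh series, whose terms are all nonnegative. -/
theorem one_div_le_log_sub_log {b : ℝ} (hb : 1 / 2 < b) :
    1 / b ≤ Real.log (b + 1 / 2) - Real.log (b - 1 / 2) := by
  have hb0 : 0 < b := by linarith
  have h := Real.sum_range_le_log_div (x := 1 / (2 * b)) (by positivity)
    (by rw [div_lt_one (by linarith)]; linarith) 1
  have e : (1 + 1 / (2 * b)) / (1 - 1 / (2 * b)) = (b + 1 / 2) / (b - 1 / 2) := by
    have : 2 * b - 1 ≠ 0 := by linarith
    have : b - 1 / 2 ≠ 0 := by linarith
    have : 1 - 1 / (2 * b) ≠ 0 := by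
      rw [sub_ne_zero, ne_eq, eq_div_iff (by positivity)]
      intro h; linarith
    field_simp
  rw [e, Real.log_div (by linarith) (by linarith)] at h
  simp at h
  have : 1 / b = 2 * (b⁻¹ * 2⁻¹) := by field_simp
  rw [this]
  simp only [one_div]
  linarith

/-- Entropy grows at least as fast as ln β. This converts a multiplicative gain in β into an
additive gain of entropy in `entropyDensity_shift`. -/
theorem monotoneOn_eta_sub_log : MonotoneOn (fun b => eta b - Real.log b) (Set.Ici (1 / 2)) := by
  refine monotoneOn_of_deriv_nonneg (convex_Ici _) ?_ ?_ ?_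
  · refine continuous_eta.continuousOn.sub (Real.continuousOn_log.mono ?_)
    intro x hx
    have : (1 : ℝ) / 2 ≤ x := hx
    simp only [Set.mem_compl_iff, Set.mem_singleton_iff]
    linarith
  · intro x hx
    rw [interior_Ici] at hx
    have hx : 1 / 2 < x := hx
    exact ((hasDerivAt_eta hx).sub
      (Real.hasDerivAt_log (by linarith))).differentiableAt.differentiableWithinAt
  · intro x hx
    rw [interior_Ici] at hx
    have hx : 1 / 2 < x := hx
    have hd := (hasDerivAt_eta hx).sub (Real.hasDerivAt_log (x := x) (by linarith))
    have e : deriv (fun b => eta b - Real.log b) x =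
      Real.log (x + 1 / 2) - Real.log (x - 1 / 2) - x⁻¹ := hd.deriv
    rw [e]
    have := one_div_le_log_sub_log hx
    simp only [one_div] at this ⊢
    linarith

theorem monotoneOn_eta : MonotoneOn eta (Set.Ici (1 / 2)) := by
  intro x hx y hy hxy
  have h := monotoneOn_eta_sub_log hx hy hxy
  have hx : 1 / 2 ≤ x := hx
  have := Real.log_le_log (by linarith) hxy
  simp only at h
  linarith

theorem concaveOn_eta : ConcaveOn ℝ (Set.Ici (1 / 2)) eta := by
  refine AntitoneOn.concaveOn_of_deriv (convex_Ici _) continuous_eta.continuousOn ?_ ?_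
  · intro x hx
    rw [interior_Ici] at hx
    exact (hasDerivAt_eta hx).differentiableAt.differentiableWithinAt
  · intro x hx y hy hxy
    rw [interior_Ici] at hx hy
    have hx : 1 / 2 < x := hx
    have hy : 1 / 2 < y := hy
    rw [(hasDerivAt_eta hx).deriv, (hasDerivAt_eta hy).deriv,
      ← Real.log_div (by linarith) (by linarith), ← Real.log_div (by linarith) (by linarith)]
    apply Real.log_le_log (div_pos (by linarith) (by linarith))
    rw [div_le_div_iff₀ (by linarith) (by linarith)]
    nlinarith

theorem eta_half : eta (1 / 2) = 0 := by
  unfold eta; norm_num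

section pointwise

variable {g a g' a' : ℝ}

theorem half_le_beta (h : a ^ 2 ≤ g * (1 + g)) : 1 / 2 ≤ beta g a := by
  unfold beta
  apply Real.le_sqrt_of_sq_le
  nlinarith

theorem beta_le (hg : 0 ≤ g) : beta g a ≤ g + 1 / 2 := by
  unfold beta
  rw [Real.sqrt_le_left (by linarith)]
  nlinarith [sq_nonneg a]

theorem entropyDensity_nonneg (h : a ^ 2 ≤ g * (1 + g)) :
    0 ≤ entropyDensity g a := by
  rw [entropyDensity_eq, ← eta_half]
  exact monotoneOn_eta Set.self_mem_Ici (half_le_beta h) (half_le_beta h)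

theorem entropyDensity_neg : entropyDensity g (-a) = entropyDensity g a := by
  simp [entropyDensity, beta]

theorem entropyDensity_zero : entropyDensity 0 0 = 0 := by
  have : beta 0 0 = 1 / 2 := by unfold beta; rw [Real.sqrt_eq_iff_mul_self_eq] <;> norm_num
  rw [entropyDensity_eq, this, eta_half]

theorem abs_le_add_half (hg : 0 ≤ g) (h : a ^ 2 ≤ g * (1 + g)) : |a| ≤ g + 1 / 2 := by
  apply abs_le_of_sq_le_sq _ (by linarith)
  nlinarith

theorem abs_le_add_sqrt (hg : 0 ≤ g) (h : a ^ 2 ≤ g * (1 + g)) : |a| ≤ g + Real.sqrt g := by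
  apply abs_le_of_sq_le_sq _ (by positivity)
  have := Real.sq_sqrt hg
  nlinarith [Real.sqrt_nonneg g, mul_nonneg hg (Real.sqrt_nonneg g)]

/-- The free Bose gas bound on the entropy density. -/
theorem entropyDensity_le (hg : 0 ≤ g) (h : a ^ 2 ≤ g * (1 + g)) {t : ℝ} (ht : 0 < t) :
    entropyDensity g a ≤ t * g - Real.log (1 - Real.exp (-t)) := by
  have h1 : entropyDensity g a ≤ eta (g + 1 / 2) := by
    rw [entropyDensity_eq]
    exact monotoneOn_eta (half_le_beta h) (show (1 : ℝ) / 2 ≤ g + 1 / 2 by linarith) (beta_le hg)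
  refine h1.trans ?_
  have he : Real.exp (-t) < 1 := by rw [Real.exp_lt_one_iff]; linarith
  have e1 : g + 1 / 2 + 1 / 2 = g + 1 := by ring
  have e2 : g + 1 / 2 - 1 / 2 = g := by ring
  unfold eta
  rw [e1, e2]
  -- Legendre duality by hand: ln x ≤ x - 1 is used once with weight 1 and once with weight g, and
  -- the right-hand sides of `k1` and `k2` add up to 0. Equality holds at the Bose occupation g =
  -- 1/(eᵗ - 1).
  have k2 : Real.log (g + 1) + Real.log (1 - Real.exp (-t)) ≤ (g + 1) * (1 - Real.exp (-t)) - 1 := by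
    rw [← Real.log_mul (by linarith) (by linarith)]
    exact Real.log_le_sub_one_of_pos (mul_pos (by linarith) (by linarith))
  have k1 : g * (Real.log (g + 1) - t - Real.log g) ≤ Real.exp (-t) * (g + 1) - g := by
    rcases hg.eq_or_lt with h0 | h0
    · rw [← h0]; simp; positivity
    have : Real.log (g + 1) - t - Real.log g = Real.log (Real.exp (-t) * (g + 1) / g) := by
      rw [Real.log_div (by positivity) (by positivity), Real.log_mul (by positivity) (by positivity),
        Real.log_exp]
      ring
    rw [this]
    have := Real.log_le_sub_one_of_pos (x := Real.exp (-t) * (g + 1) / g) (by positivity)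
    calc _ ≤ g * (Real.exp (-t) * (g + 1) / g - 1) := by gcongr
      _ = _ := by field_simp
  nlinarith

/-- The set of admissible pairs of values is midpoint convex. -/
theorem sq_le_midpoint (hg : 0 ≤ g) (h : a ^ 2 ≤ g * (1 + g)) (hg' : 0 ≤ g')
    (h' : a' ^ 2 ≤ g' * (1 + g')) :
    ((a + a') / 2) ^ 2 ≤ (g + g') / 2 * (1 + (g + g') / 2) := by
  have k : a * a' ≤ g * g' + (g + g') / 2 := by
    refine le_of_sq_le_sq ?_ (by positivity)
    nlinarith [mul_le_mul h h' (sq_nonneg a') (by positivity), sq_nonneg (g - g')]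
  nlinarith

/-- β is the Minkowski length of the timelike vector (1/2 + g, a), so this is the reverse triangle
inequality; `k` below is the reverse Cauchy–Schwarz inequality. -/
theorem beta_midpoint (hg : 0 ≤ g) (h : a ^ 2 ≤ g * (1 + g)) (hg' : 0 ≤ g')
    (h' : a' ^ 2 ≤ g' * (1 + g')) :
    (beta g a + beta g' a') / 2 ≤ beta ((g + g') / 2) ((a + a') / 2) := by
  have hb : beta g a ^ 2 = (1 / 2 + g) ^ 2 - a ^ 2 := Real.sq_sqrt (by nlinarith)
  have hb' : beta g' a' ^ 2 = (1 / 2 + g') ^ 2 - a' ^ 2 := Real.sq_sqrt (by nlinarith)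
  have h0 : 0 ≤ beta g a := Real.sqrt_nonneg _
  have h0' : 0 ≤ beta g' a' := Real.sqrt_nonneg _
  conv_rhs => unfold beta
  apply Real.le_sqrt_of_sq_le
  have ha := abs_le.mp (abs_le_add_half hg h)
  have ha' := abs_le.mp (abs_le_add_half hg' h')
  have k : beta g a * beta g' a' ≤ (1 / 2 + g) * (1 / 2 + g') - a * a' := by
    apply le_of_sq_le_sq
    · rw [mul_pow, hb, hb']
      nlinarith [sq_nonneg ((1 / 2 + g) * a' - (1 / 2 + g') * a)]
    · nlinarith [mul_nonneg (sub_nonneg.2 ha.1) (sub_nonneg.2 ha'.2),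
        mul_nonneg (sub_nonneg.2 ha.2) (sub_nonneg.2 ha'.1)]
  nlinarith

/-- A concave increasing function of the midpoint concave quantity β. -/
theorem entropyDensity_midpoint (hg : 0 ≤ g) (h : a ^ 2 ≤ g * (1 + g)) (hg' : 0 ≤ g')
    (h' : a' ^ 2 ≤ g' * (1 + g')) :
    (entropyDensity g a + entropyDensity g' a') / 2 ≤
      entropyDensity ((g + g') / 2) ((a + a') / 2) := by
  have hb := half_le_beta h
  have hb' := half_le_beta h'
  simp only [entropyDensity_eq]
  have h1 := concaveOn_eta.2 hb hb' (show (0 : ℝ) ≤ 1 / 2 by norm_num)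
    (show (0 : ℝ) ≤ 1 / 2 by norm_num) (by norm_num)
  have h2 := monotoneOn_eta (show (1 : ℝ) / 2 ≤ (beta g a + beta g' a') / 2 by linarith)
    (half_le_beta (sq_le_midpoint hg h hg' h')) (beta_midpoint hg h hg' h')
  simp only [smul_eq_mul] at h1
  have e : 1 / 2 * beta g a + 1 / 2 * beta g' a' = (beta g a + beta g' a') / 2 := by ring
  rw [e] at h1
  linarith

variable {t θ : ℝ}

theorem sq_le_shift (hg : 0 ≤ g) (h : a ^ 2 ≤ g * (1 + g)) (ht : 0 ≤ t) (hθ : |θ| ≤ 1) :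
    (a + θ * t) ^ 2 ≤ (g + t) * (1 + (g + t)) := by
  have ha := abs_le_add_half hg h
  have h1 : a * θ ≤ g + 1 / 2 := by
    calc a * θ ≤ |a * θ| := le_abs_self _
      _ = |a| * |θ| := abs_mul _ _
      _ ≤ (g + 1 / 2) * 1 := by gcongr
      _ = _ := by ring
  have h2 : θ ^ 2 ≤ 1 := by rw [sq_le_one_iff_abs_le_one]; exact hθ
  nlinarith [mul_le_mul_of_nonneg_right h1 ht, mul_le_mul_of_nonneg_right h2 (sq_nonneg t)]

/-- Adding `t` to `γ` and `θ t` to `α` increases the entropy density. -/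
theorem entropyDensity_shift (hg : 0 ≤ g) (h : a ^ 2 ≤ g * (1 + g)) (ht : 0 ≤ t) (hθ : |θ| ≤ 1) :
    entropyDensity g a + 1 / 2 * Real.log (1 + 2 * t / (1 + 2 * g)) ≤
      entropyDensity (g + t) (a + θ * t) := by
  have ha := abs_le_add_half hg h
  have hb2 : beta g a ^ 2 = (1 / 2 + g) ^ 2 - a ^ 2 := Real.sq_sqrt (by nlinarith)
  have hc2 : beta (g + t) (a + θ * t) ^ 2 = (1 / 2 + (g + t)) ^ 2 - (a + θ * t) ^ 2 :=
    Real.sq_sqrt (by nlinarith [sq_le_shift hg h ht hθ])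
  have hb := half_le_beta h
  have hc := half_le_beta (sq_le_shift hg h ht hθ)
  have h1 : a * θ ≤ |a| := by
    calc a * θ ≤ |a * θ| := le_abs_self _
      _ = |a| * |θ| := abs_mul _ _
      _ ≤ |a| * 1 := by gcongr
      _ = _ := by ring
  have h2 : θ ^ 2 ≤ 1 := by rw [sq_le_one_iff_abs_le_one]; exact hθ
  -- Factor β² = (1/2 + g - |a|)(1/2 + g + |a|), where the second factor is at most 1 + 2g. Adding
  -- (t, θt) raises β² by at least 2t(1/2 + g - |a|), hence by at least the fraction 2t/(1 + 2g).
  have h3 : beta g a ^ 2 * (1 + 2 * t / (1 + 2 * g)) ≤ beta (g + t) (a + θ * t) ^ 2 := by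
    have k : beta g a ^ 2 / (1 + 2 * g) ≤ 1 / 2 + g - |a| := by
      rw [div_le_iff₀ (by linarith), hb2, ← sq_abs a]
      nlinarith [abs_nonneg a]
    calc _ = beta g a ^ 2 + 2 * t * (beta g a ^ 2 / (1 + 2 * g)) := by ring
      _ ≤ beta g a ^ 2 + 2 * t * (1 / 2 + g - |a|) := by gcongr
      _ ≤ _ := by
        rw [hb2, hc2]
        nlinarith [mul_le_mul_of_nonneg_right h1 ht, mul_le_mul_of_nonneg_right h2 (sq_nonneg t)]
  have hq : 0 ≤ 2 * t / (1 + 2 * g) := by positivity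
  have hle : beta g a ≤ beta (g + t) (a + θ * t) := by
    apply le_of_sq_le_sq _ (by linarith)
    nlinarith [sq_nonneg (beta g a)]
  have hm := monotoneOn_eta_sub_log hb hc hle
  simp only at hm
  have hl := Real.log_le_log (by positivity) h3
  rw [Real.log_mul (by positivity) (by positivity), Real.log_pow, Real.log_pow] at hl
  push_cast at hl
  simp only [entropyDensity_eq]
  linarith

/-- The entropy density is sublinear in `γ`. -/
theorem exists_entropyDensity_le {ε : ℝ} (hε : 0 < ε) :
    ∃ M : ℝ, 0 < M ∧ ∀ g a : ℝ, M ≤ g → a ^ 2 ≤ g * (1 + g) → entropyDensity g a ≤ ε * g := by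
  set C := - Real.log (1 - Real.exp (-(ε / 2)))
  refine ⟨max 1 (2 * C / ε), by positivity, fun g a hg h => ?_⟩
  have h1 : 1 ≤ g := le_trans (le_max_left _ _) hg
  have h2 : 2 * C / ε ≤ g := le_trans (le_max_right _ _) hg
  have := entropyDensity_le (by linarith) h (half_pos hε)
  rw [div_le_iff₀ hε] at h2
  change _ ≤ ε / 2 * g - _ at this
  have : C = - Real.log (1 - Real.exp (-(ε / 2))) := rfl
  linarith

end pointwise

/-! ### The interaction kernel -/

/-- The properties of `vHat V` that enter the existence proof. -/
structure IsKernel (v : Space3 → ℝ) : Prop where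
  cont : Continuous v
  nonneg : ∀ p, 0 ≤ v p
  integrable : Integrable v
  bounded : ∃ C : ℝ, 0 ≤ C ∧ ∀ p, v p ≤ C
  radial : ∀ p q, ‖p‖ = ‖q‖ → v p = v q
  lipschitz : ∃ L : ℝ, 0 ≤ L ∧ ∀ p q, |v p - v q| ≤ L * ‖p - q‖
  l2_modulus : ∃ D : ℝ, 0 ≤ D ∧ ∀ h, ∫ p, (v (p + h) - v p) ^ 2 ≤ D * ‖h‖ ^ 2
  posType : ∀ f : Space3 → ℝ, Integrable f →
    0 ≤ ∫ z : Space3 × Space3, v (z.1 - z.2) * (f z.1 * f z.2)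

theorem vHat_eq_integral_cos {V : Space3 → ℝ} (hV : Integrable V) (p : Space3) :
    vHat V p = ∫ x, Real.cos (inner ℝ p x) * V x := by
  unfold vHat fourierC
  have hi : Integrable fun x : Space3 =>
      Complex.exp (-(Complex.I * (inner ℝ p x : ℝ))) * (V x : ℂ) := by
    refine (hV.ofReal (𝕜 := ℂ)).bdd_mul (c := 1) (by fun_prop) ?_
    filter_upwards with x
    have : -(Complex.I * ((inner ℝ p x : ℝ) : ℂ)) = ((-(inner ℝ p x) : ℝ) : ℂ) * Complex.I := by
      push_cast; ring
    rw [this, Complex.norm_exp_ofReal_mul_I]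
  have := integral_re hi
  simp only [RCLike.re_eq_complex_re] at this
  rw [← this]
  refine integral_congr_ae (Filter.Eventually.of_forall fun x => ?_)
  have : -(Complex.I * ((inner ℝ p x : ℝ) : ℂ)) = ((-(inner ℝ p x) : ℝ) : ℂ) * Complex.I := by
    push_cast; ring
  simp only [this, Complex.mul_re, Complex.exp_ofReal_mul_I_re, Complex.ofReal_re,
    Complex.ofReal_im, Real.cos_neg, mul_zero, sub_zero]

/-- The reflection in the hyperplane bisecting p and q carries p to q and preserves both V and
Lebesgue measure. -/
theorem vHat_radial {V : Space3 → ℝ} (hV : Integrable V) (hr : IsRadial V) {p q : Space3}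
    (h : ‖p‖ = ‖q‖) : vHat V p = vHat V q := by
  rw [vHat_eq_integral_cos hV, vHat_eq_integral_cos hV]
  set R := Submodule.reflection (Submodule.span ℝ {p - q})ᗮ
  have hR : R p = q := Submodule.reflection_sub h
  rw [← (R.measurePreserving).integral_comp R.toHomeomorph.measurableEmbedding
    (fun x => Real.cos (inner ℝ q x) * V x)]
  refine integral_congr_ae (Filter.Eventually.of_forall fun x => ?_)
  simp only
  rw [← hR, R.inner_map_map, hr (R x) x (R.norm_map x)]

/-- The easy half of Bochner's theorem: by Fubini the double integral equals ∫ V(x) |∫ e^{-ip·x}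
f(p) dp|² dx, written with cosines and sines. -/
theorem vHat_posType {V : Space3 → ℝ} (hV : Integrable V) (h0 : ∀ x, 0 ≤ V x)
    {f : Space3 → ℝ} (hf : Integrable f) :
    0 ≤ ∫ z : Space3 × Space3, vHat V (z.1 - z.2) * (f z.1 * f z.2) := by
  have hff : Integrable (fun z : Space3 × Space3 => f z.1 * f z.2) (volume.prod volume) :=
    hf.mul_prod hf
  have hI : Integrable (fun w : (Space3 × Space3) × Space3 =>
      Real.cos (inner ℝ (w.1.1 - w.1.2) w.2) * ((f w.1.1 * f w.1.2) * V w.2))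
      ((volume.prod volume).prod volume) := by
    refine (hff.mul_prod hV).bdd_mul (c := 1) ?_ ?_
    · exact Continuous.aestronglyMeasurable (by fun_prop)
    · filter_upwards with w
      exact Real.abs_cos_le_one _
  have e1 : (∫ z : Space3 × Space3, vHat V (z.1 - z.2) * (f z.1 * f z.2)) =
      ∫ z : Space3 × Space3, ∫ x, Real.cos (inner ℝ (z.1 - z.2) x) * ((f z.1 * f z.2) * V x) := by
    refine integral_congr_ae (Filter.Eventually.of_forall fun z => ?_)
    simp only
    rw [vHat_eq_integral_cos hV, ← integral_mul_const]
    refine integral_congr_ae (Filter.Eventually.of_forall fun x => ?_)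
    simp only
    ring
  rw [e1, Measure.volume_eq_prod, integral_integral_swap hI]
  refine integral_nonneg fun x => ?_
  have hc : Integrable fun p => Real.cos (inner ℝ p x) * f p :=
    hf.bdd_mul (c := 1) (by fun_prop) (Filter.Eventually.of_forall fun p => Real.abs_cos_le_one _)
  have hs : Integrable fun p => Real.sin (inner ℝ p x) * f p :=
    hf.bdd_mul (c := 1) (by fun_prop) (Filter.Eventually.of_forall fun p => Real.abs_sin_le_one _)
  have e2 : (∫ z : Space3 × Space3, Real.cos (inner ℝ (z.1 - z.2) x) * ((f z.1 * f z.2) * V x)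
      ∂(volume.prod volume)) =
      V x * ((∫ p, Real.cos (inner ℝ p x) * f p) * (∫ p, Real.cos (inner ℝ p x) * f p) +
        (∫ p, Real.sin (inner ℝ p x) * f p) * (∫ p, Real.sin (inner ℝ p x) * f p)) := by
    rw [← integral_prod_mul, ← integral_prod_mul, ← integral_add (hc.mul_prod hc) (hs.mul_prod hs),
      ← integral_const_mul]
    refine integral_congr_ae (Filter.Eventually.of_forall fun z => ?_)
    simp only [inner_sub_left, Real.cos_sub]
    ring
  rw [e2]
  exact mul_nonneg (h0 x) (add_nonneg (mul_self_nonneg _) (mul_self_nonneg _))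

theorem sq_intervalIntegral_le {g : ℝ → ℝ} (hg : Continuous g) :
    (∫ t in (0 : ℝ)..1, g t) ^ 2 ≤ ∫ t in (0 : ℝ)..1, g t ^ 2 := by
  set m := ∫ t in (0 : ℝ)..1, g t with hm
  have h : 0 ≤ ∫ t in (0 : ℝ)..1, (g t - m) ^ 2 :=
    intervalIntegral.integral_nonneg (by norm_num) fun t _ => sq_nonneg _
  have e : (∫ t in (0 : ℝ)..1, (g t - m) ^ 2) =
      (∫ t in (0 : ℝ)..1, g t ^ 2) - 2 * m * m + m ^ 2 := by
    have : (fun t => (g t - m) ^ 2) = fun t => g t ^ 2 - 2 * m * g t + m ^ 2 := by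
      ext t; ring
    rw [this, intervalIntegral.integral_add, intervalIntegral.integral_sub,
      intervalIntegral.integral_const_mul, ← hm]
    · simp
    all_goals exact Continuous.intervalIntegrable (by fun_prop) _ _
  rw [e] at h
  nlinarith

/-- Write the increment as the integral of the derivative along the segment, apply Jensen's
inequality in t, then Fubini and translation invariance. -/
theorem integral_sq_sub_translate_le {v : Space3 → ℝ} (hv : ContDiff ℝ 1 v)
    (hg : MemLp (gradient v) 2 volume) (h : Space3) :
    ∫ p, (v (p + h) - v p) ^ 2 ≤ (∫ p, ‖gradient v p‖ ^ 2) * ‖h‖ ^ 2 := by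
  have hgi : Integrable fun p => ‖gradient v p‖ ^ 2 := hg.integrable_norm_pow (by norm_num)
  have hfc : Continuous (fderiv ℝ v) := hv.continuous_fderiv (by norm_num)
  have hnorm : ∀ p, ‖fderiv ℝ v p‖ = ‖gradient v p‖ := fun p => by
    rw [← toDual_gradient, LinearIsometryEquiv.norm_map]
  have hgc : Continuous fun p => ‖gradient v p‖ ^ 2 := by
    simp only [← hnorm]; fun_prop
  have hpt : ∀ p, (v (p + h) - v p) ^ 2 ≤
      ∫ t in (0 : ℝ)..1, ‖gradient v (p + t • h)‖ ^ 2 * ‖h‖ ^ 2 := by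
    intro p
    have hd : ∀ t : ℝ, HasDerivAt (fun t : ℝ => v (p + t • h)) (fderiv ℝ v (p + t • h) h) t := by
      intro t
      have h1 : HasDerivAt (fun t : ℝ => p + t • h) h t := by
        simpa using ((hasDerivAt_id t).smul_const h).const_add p
      exact ((hv.differentiable (by norm_num)) (p + t • h)).hasFDerivAt.comp_hasDerivAt t h1
    have hcont : Continuous fun t : ℝ => fderiv ℝ v (p + t • h) h := by fun_prop
    have hF := intervalIntegral.integral_eq_sub_of_hasDerivAt (a := 0) (b := 1)
      (fun t _ => hd t) (hcont.intervalIntegrable _ _)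
    simp only [one_smul, zero_smul, add_zero] at hF
    rw [← hF]
    refine (sq_intervalIntegral_le hcont).trans ?_
    refine intervalIntegral.integral_mono_on (by norm_num)
      (Continuous.intervalIntegrable (by fun_prop) _ _)
      (Continuous.intervalIntegrable ?_ _ _) fun t _ => ?_
    · exact (hgc.comp (by fun_prop : Continuous fun t : ℝ => p + t • h)).mul continuous_const
    · rw [← sq_abs, ← mul_pow, ← hnorm]
      gcongr
      exact (fderiv ℝ v (p + t • h)).le_opNorm h
  have hint : Integrable (fun w : Space3 × ℝ => ‖gradient v (w.1 + w.2 • h)‖ ^ 2 * ‖h‖ ^ 2)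
      (volume.prod (volume.restrict (Set.Ioc (0 : ℝ) 1))) := by
    have hm : AEStronglyMeasurable (fun w : Space3 × ℝ => ‖gradient v (w.1 + w.2 • h)‖ ^ 2 * ‖h‖ ^ 2)
      (volume.prod (volume.restrict (Set.Ioc (0 : ℝ) 1))) :=
      ((hgc.comp (by fun_prop : Continuous fun w : Space3 × ℝ => w.1 + w.2 • h)).mul
        continuous_const).aestronglyMeasurable
    rw [integrable_prod_iff' hm]
    constructor
    · filter_upwards with t
      exact (hgi.comp_add_right (t • h)).mul_const _
    · have : (fun t : ℝ => ∫ p, ‖‖gradient v (p + t • h)‖ ^ 2 * ‖h‖ ^ 2‖) =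
          fun _ => (∫ p, ‖gradient v p‖ ^ 2) * ‖h‖ ^ 2 := by
        ext t
        have := integral_add_right_eq_self (μ := (volume : Measure Space3))
          (fun p => ‖gradient v p‖ ^ 2) (t • h)
        rw [← this, ← integral_mul_const]
        refine integral_congr_ae (Filter.Eventually.of_forall fun p => ?_)
        simp
      simp only [this]
      exact integrable_const _
  calc ∫ p, (v (p + h) - v p) ^ 2
      ≤ ∫ p, ∫ t in Set.Ioc (0 : ℝ) 1, ‖gradient v (p + t • h)‖ ^ 2 * ‖h‖ ^ 2 := by
        refine integral_mono_of_nonneg (Filter.Eventually.of_forall fun p => sq_nonneg _)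
          hint.integral_prod_left (Filter.Eventually.of_forall fun p => ?_)
        have := hpt p
        rwa [intervalIntegral.integral_of_le (by norm_num)] at this
    _ = ∫ t in Set.Ioc (0 : ℝ) 1, ∫ p, ‖gradient v (p + t • h)‖ ^ 2 * ‖h‖ ^ 2 :=
        integral_integral_swap hint
    _ = ∫ t in Set.Ioc (0 : ℝ) 1, (∫ p, ‖gradient v p‖ ^ 2) * ‖h‖ ^ 2 := by
        congr 1
        ext t
        rw [integral_mul_const, integral_add_right_eq_self (μ := (volume : Measure Space3))
          (fun p => ‖gradient v p‖ ^ 2) (t • h)]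
    _ = _ := by simp

theorem IsInteraction.isKernel {V : Space3 → ℝ} (hV : IsInteraction V) : IsKernel (vHat V) where
  cont := hV.hat_contDiff.continuous
  nonneg := hV.hat_nonneg
  integrable := hV.hat_integrable
  bounded := by
    obtain ⟨C, hC⟩ := hV.hat_bounded
    exact ⟨C, (abs_nonneg _).trans (hC 0), fun p => (le_abs_self _).trans (hC p)⟩
  radial := fun p q h => vHat_radial hV.integrable hV.radial h
  lipschitz := by
    obtain ⟨C, hC⟩ := hV.grad_bounded
    refine ⟨C, (norm_nonneg _).trans (hC 0), fun p q => ?_⟩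
    have := Convex.norm_image_sub_le_of_norm_fderiv_le (𝕜 := ℝ) (f := vHat V) (C := C)
      (s := Set.univ) (x := q) (y := p)
      (fun x _ => hV.hat_contDiff.differentiable (by norm_num) x) (fun x _ => by
        rw [← toDual_gradient, LinearIsometryEquiv.norm_map]; exact hC x) convex_univ
      (Set.mem_univ _) (Set.mem_univ _)
    exact this
  l2_modulus := ⟨_, integral_nonneg fun p => by positivity,
    integral_sq_sub_translate_le hV.hat_contDiff hV.grad_memLp_two⟩
  posType := fun _ hf => vHat_posType hV.integrable hV.nonneg hf

open Filter Topology

/-! ### The quadratic form of the kernel -/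

/-- `f` is bounded by `U + √U` with `U` integrable. -/
structure DomBy (f U : Space3 → ℝ) : Prop where
  meas : AEStronglyMeasurable f volume
  int : Integrable U
  nonneg : ∀ p, 0 ≤ U p
  le : ∀ p, |f p| ≤ U p + √(U p)

/-- The functions on which the quadratic form of the kernel is defined. -/
def Tame (f : Space3 → ℝ) : Prop := ∃ U, DomBy f U

/-- The bilinear form with kernel `v (p - q)`. -/
def quadForm (v f g : Space3 → ℝ) : ℝ :=
  ∫ z : Space3 × Space3, v (z.1 - z.2) * (f z.1 * g z.2)

/-- The convolution `v * f`. -/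
def conv (v f : Space3 → ℝ) (p : Space3) : ℝ := ∫ q, v (p - q) * f q

theorem sqrt_le_half_add {x : ℝ} (hx : 0 ≤ x) : √x ≤ (1 + x) / 2 := by
  have := Real.sq_sqrt hx
  nlinarith [sq_nonneg (√x - 1)]

section Tame

variable {f g U W : Space3 → ℝ}

theorem DomBy.le_half (h : DomBy f U) (p : Space3) : |f p| ≤ 2 * U p + 1 / 2 := by
  have := h.le p
  have := sqrt_le_half_add (h.nonneg p)
  have := h.nonneg p
  linarith

theorem DomBy.of_abs_le (h : DomBy f U) (hg : AEStronglyMeasurable g volume)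
    (hle : ∀ p, |g p| ≤ |f p|) : DomBy g U :=
  ⟨hg, h.int, h.nonneg, fun p => (hle p).trans (h.le p)⟩

theorem DomBy.indicator (h : DomBy f U) {S : Set Space3} (hS : MeasurableSet S) :
    DomBy (S.indicator f) U :=
  h.of_abs_le (h.meas.indicator hS) fun p => by
    by_cases hp : p ∈ S <;> simp [hp]

theorem Tame.indicator (h : Tame f) {S : Set Space3} (hS : MeasurableSet S) :
    Tame (S.indicator f) := by
  obtain ⟨U, hU⟩ := h
  exact ⟨U, hU.indicator hS⟩

theorem DomBy.add (h : DomBy f U) (h' : DomBy g W) :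
    DomBy (fun p => f p + g p) fun p => 2 * (U p + W p) where
  meas := h.meas.add h'.meas
  int := (h.int.add h'.int).const_mul 2
  nonneg := fun p => by have := h.nonneg p; have := h'.nonneg p; positivity
  le := fun p => by
    have h1 := h.nonneg p
    have h2 := h'.nonneg p
    have h3 : √(U p) + √(W p) ≤ √(2 * (U p + W p)) := by
      apply Real.le_sqrt_of_sq_le
      nlinarith [Real.sq_sqrt h1, Real.sq_sqrt h2, sq_nonneg (√(U p) - √(W p))]
    have := abs_add_le (f p) (g p)
    have := h.le p
    have := h'.le p
    linarith

theorem Tame.add (h : Tame f) (h' : Tame g) : Tame fun p => f p + g p := by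
  obtain ⟨U, hU⟩ := h
  obtain ⟨W, hW⟩ := h'
  exact ⟨_, hU.add hW⟩

theorem Tame.const_mul (h : Tame f) (c : ℝ) : Tame fun p => c * f p := by
  obtain ⟨U, hU⟩ := h
  refine ⟨fun p => (1 + c ^ 2) * U p, hU.meas.const_mul c, hU.int.const_mul _,
    fun p => mul_nonneg (by positivity) (hU.nonneg p), fun p => ?_⟩
  have h1 := hU.nonneg p
  have h2 : |c| * √(U p) ≤ √((1 + c ^ 2) * U p) := by
    apply Real.le_sqrt_of_sq_le
    rw [mul_pow, Real.sq_sqrt h1, sq_abs]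
    nlinarith
  have h3 : |c| ≤ 1 + c ^ 2 := by
    rw [← sq_abs]
    nlinarith [sq_nonneg (|c| - 1)]
  rw [abs_mul]
  calc |c| * |f p| ≤ |c| * (U p + √(U p)) := by gcongr; exact hU.le p
    _ = |c| * U p + |c| * √(U p) := by ring
    _ ≤ _ := by gcongr

theorem Tame.sub (h : Tame f) (h' : Tame g) : Tame fun p => f p - g p := by
  have := h.add (h'.const_mul (-1))
  simpa [sub_eq_add_neg] using this

theorem DomBy.of_integrable (hf : Integrable f) : DomBy f fun p => |f p| :=
  ⟨hf.aestronglyMeasurable, hf.abs, fun p => abs_nonneg _, fun p => by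
    have := Real.sqrt_nonneg |f p|
    linarith⟩

theorem Tame.of_integrable (hf : Integrable f) : Tame f := ⟨_, DomBy.of_integrable hf⟩

theorem DomBy.comp (h : DomBy f U) (R : Space3 ≃ₗᵢ[ℝ] Space3) :
    DomBy (fun p => f (R p)) fun p => U (R p) :=
  ⟨h.meas.comp_measurePreserving R.measurePreserving,
    (R.measurePreserving.integrable_comp_emb R.toHomeomorph.measurableEmbedding).2 h.int,
    fun _ => h.nonneg _, fun _ => h.le _⟩

theorem DomBy.integrableOn (h : DomBy f U) {S : Set Space3} (hS : MeasurableSet S)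
    (hfin : volume S < ⊤) : Integrable (S.indicator f) := by
  have h2 : Integrable (S.indicator fun p => 2 * U p + 1 / 2) := by
    rw [integrable_indicator_iff hS]
    exact ((h.int.const_mul 2).integrableOn).add (integrableOn_const hfin.ne)
  refine h2.mono' (h.meas.indicator hS) (Eventually.of_forall fun p => ?_)
  by_cases hp : p ∈ S
  · simpa [hp] using h.le_half p
  · simp [hp]

end Tame

namespace IsKernel

variable {v f g U W : Space3 → ℝ}

theorem even (hk : IsKernel v) (p : Space3) : v (-p) = v p := hk.radial _ _ (norm_neg p)

theorem sub_comm (hk : IsKernel v) (p q : Space3) : v (p - q) = v (q - p) := by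
  rw [← hk.even, neg_sub]

end IsKernel

namespace IsKernel

variable {v f g U W : Space3 → ℝ}

theorem integrable_snd (hk : IsKernel v) (hU : Integrable U) :
    Integrable fun z : Space3 × Space3 => v (z.1 - z.2) * U z.2 := by
  have := hU.convolution_integrand (ContinuousLinearMap.mul ℝ ℝ) hk.integrable
  refine this.congr (Eventually.of_forall fun z => ?_)
  simp [mul_comm]

theorem integrable_fst (hk : IsKernel v) (hU : Integrable U) :
    Integrable fun z : Space3 × Space3 => v (z.1 - z.2) * U z.1 := by
  have := (hk.integrable_snd hU).swap
  refine this.congr (Eventually.of_forall fun z => ?_)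
  simp [hk.sub_comm z.2 z.1]

theorem aestronglyMeasurable_prod (hk : IsKernel v) (hf : AEStronglyMeasurable f volume)
    (hg : AEStronglyMeasurable g volume) :
    AEStronglyMeasurable (fun z : Space3 × Space3 => v (z.1 - z.2) * (f z.1 * g z.2)) volume := by
  have := hk.cont
  refine (Continuous.aestronglyMeasurable (by fun_prop)).mul ?_
  rw [Measure.volume_eq_prod]
  exact hf.comp_fst.mul hg.comp_snd

/-- Where γ is small, α may be of size √γ, so it lies only in L¹ + L². The products U W are
controlled by sup v, while √U √W ≤ (U + W)/2 is controlled by the integrability of v; the mixed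
terms reduce to these two. -/
theorem integrable_prod (hk : IsKernel v) (hf : DomBy f U) (hg : DomBy g W) :
    Integrable fun z : Space3 × Space3 => v (z.1 - z.2) * (f z.1 * g z.2) := by
  obtain ⟨C, hC0, hC⟩ := hk.bounded
  have hUW : Integrable fun z : Space3 × Space3 => U z.1 * W z.2 := hf.int.mul_prod hg.int
  refine (((hUW.const_mul (2 * C)).add (hk.integrable_fst hf.int)).add
    (hk.integrable_snd hg.int)).mono' (hk.aestronglyMeasurable_prod hf.meas hg.meas)
    (Eventually.of_forall fun z => ?_)
  have h0 := hk.nonneg (z.1 - z.2)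
  have hU := hf.nonneg z.1
  have hW := hg.nonneg z.2
  have k : |f z.1| * |g z.2| ≤ 2 * (U z.1 * W z.2) + U z.1 + W z.2 := by
    have s1 := sqrt_le_half_add hU
    have s2 := sqrt_le_half_add hW
    have t1 := Real.sqrt_nonneg (U z.1)
    have t2 := Real.sqrt_nonneg (W z.2)
    have q1 := Real.sq_sqrt hU
    have q2 := Real.sq_sqrt hW
    calc |f z.1| * |g z.2| ≤ (U z.1 + √(U z.1)) * (W z.2 + √(W z.2)) := by
          gcongr
          · exact hf.le _
          · exact hg.le _
      _ ≤ _ := by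
        nlinarith [mul_le_mul_of_nonneg_left s2 hU, mul_le_mul_of_nonneg_right s1 hW,
          sq_nonneg (√(U z.1) - √(W z.2))]
  simp only [Pi.add_apply, Real.norm_eq_abs, abs_mul, abs_of_nonneg h0]
  calc v (z.1 - z.2) * (|f z.1| * |g z.2|)
      ≤ v (z.1 - z.2) * (2 * (U z.1 * W z.2) + U z.1 + W z.2) := by gcongr
    _ = 2 * v (z.1 - z.2) * (U z.1 * W z.2) + v (z.1 - z.2) * U z.1 + v (z.1 - z.2) * W z.2 := by
        ring
    _ ≤ _ := by gcongr; exact hC _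

theorem tame_integrable_prod (hk : IsKernel v) (hf : Tame f) (hg : Tame g) :
    Integrable fun z : Space3 × Space3 => v (z.1 - z.2) * (f z.1 * g z.2) := by
  obtain ⟨U, hU⟩ := hf
  obtain ⟨W, hW⟩ := hg
  exact hk.integrable_prod hU hW

theorem integrable_mul (hk : IsKernel v) (hf : DomBy f U) (p : Space3) :
    Integrable fun q => v (p - q) * f q := by
  obtain ⟨C, hC0, hC⟩ := hk.bounded
  have hv : Integrable fun q => v (p - q) := hk.integrable.comp_sub_left p
  refine ((hf.int.const_mul (2 * C)).add (hv.mul_const (1 / 2))).mono'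
    (hv.aestronglyMeasurable.mul hf.meas) (Eventually.of_forall fun q => ?_)
  have h0 := hk.nonneg (p - q)
  have hU := hf.nonneg q
  simp only [Pi.add_apply, Real.norm_eq_abs, abs_mul, abs_of_nonneg h0]
  calc v (p - q) * |f q| ≤ v (p - q) * (2 * U q + 1 / 2) := by gcongr; exact hf.le_half q
    _ = 2 * v (p - q) * U q + v (p - q) * (1 / 2) := by ring
    _ ≤ _ := by gcongr; exact hC _

theorem tame_integrable_mul (hk : IsKernel v) (hf : Tame f) (p : Space3) :
    Integrable fun q => v (p - q) * f q := by
  obtain ⟨U, hU⟩ := hf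
  exact hk.integrable_mul hU p

/-- `v * f` is bounded and Lipschitz, with constants depending only on `∫ U`. -/
theorem exists_conv_bound (hk : IsKernel v) (Λ : ℝ) : ∃ C : ℝ, 0 ≤ C ∧ ∀ f U : Space3 → ℝ,
    DomBy f U → ∫ p, U p ≤ Λ → (∀ p, |conv v f p| ≤ C) ∧
      ∀ p q, |conv v f p - conv v f q| ≤ C * ‖p - q‖ := by
  obtain ⟨B, hB0, hB⟩ := hk.bounded
  obtain ⟨L, hL0, hL⟩ := hk.lipschitz
  obtain ⟨D, hD0, hD⟩ := hk.l2_modulus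
  have hv0 : 0 ≤ ∫ p, v p := integral_nonneg hk.nonneg
  -- `C1` bounds the convolution in absolute value, via v|f| ≤ v(2U + 1/2). `C2` bounds its
  -- Lipschitz constant: L comes from the U part of f, while D comes with the √U part.
  set C1 := 2 * B * |Λ| + (∫ p, v p) * (1 / 2) with hC1
  set C2 := (L + 1 / 2) * |Λ| + D / 2 with hC2
  have hC10 : 0 ≤ C1 := by positivity
  have hC20 : 0 ≤ C2 := by positivity
  refine ⟨C1 + C2, by positivity, fun f U hf hΛ => ⟨fun p => ?_, fun p q => ?_⟩⟩
  · have hv : Integrable fun q => v (p - q) := hk.integrable.comp_sub_left p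
    have h1 : |conv v f p| ≤ ∫ q, (2 * B * U q + v (p - q) * (1 / 2)) := by
      have hi : Integrable fun q => 2 * B * U q + v (p - q) * (1 / 2) :=
        (hf.int.const_mul (2 * B)).add (hv.mul_const (1 / 2))
      rw [← Real.norm_eq_abs]
      refine norm_integral_le_of_norm_le hi (Eventually.of_forall fun q => ?_)
      have h0 := hk.nonneg (p - q)
      have hU := hf.nonneg q
      simp only [Real.norm_eq_abs, abs_mul, abs_of_nonneg h0]
      calc v (p - q) * |f q| ≤ v (p - q) * (2 * U q + 1 / 2) := by gcongr; exact hf.le_half q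
        _ = 2 * v (p - q) * U q + v (p - q) * (1 / 2) := by ring
        _ ≤ _ := by gcongr; exact hB _
    rw [integral_add (hf.int.const_mul (2 * B)) (hv.mul_const (1 / 2)), integral_const_mul,
      integral_mul_const, integral_sub_left_eq_self v volume p] at h1
    have : 2 * B * ∫ q, U q ≤ 2 * B * |Λ| := by gcongr; exact hΛ.trans (le_abs_self _)
    linarith
  · rcases eq_or_ne p q with rfl | hpq
    · simp
    have hh : 0 < ‖p - q‖ := norm_pos_iff.2 (sub_ne_zero.2 hpq)
    set h := ‖p - q‖ with hh_def
    have hi : Integrable fun x => (v (p - x) - v (q - x)) ^ 2 := by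
      have hvi : Integrable fun x => v (p - x) - v (q - x) :=
        (hk.integrable.comp_sub_left p).sub (hk.integrable.comp_sub_left q)
      have hc := hk.cont
      have : Integrable fun x => (v (p - x) - v (q - x)) * (v (p - x) - v (q - x)) := by
        refine hvi.bdd_mul (c := B + B) (Continuous.aestronglyMeasurable (by fun_prop))
          (Eventually.of_forall fun x => ?_)
        rw [Real.norm_eq_abs, abs_le]
        constructor <;>
        linarith [hk.nonneg (p - x), hk.nonneg (q - x), hB (p - x), hB (q - x)]
      simpa [sq] using this
    have hi2 : ∫ x, (v (p - x) - v (q - x)) ^ 2 ≤ D * h ^ 2 := by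
      have := integral_sub_left_eq_self (fun y => (v (y + (p - q)) - v y) ^ 2) volume q
      have e : (∫ x, (v (p - x) - v (q - x)) ^ 2) = ∫ y, (v (y + (p - q)) - v y) ^ 2 := by
        rw [← this]
        refine integral_congr_ae (Eventually.of_forall fun x => ?_)
        simp only
        congr 4
        abel
      rw [e]
      exact hD (p - q)
    have e : conv v f p - conv v f q = ∫ x, (v (p - x) - v (q - x)) * f x := by
      unfold conv
      rw [← integral_sub (hk.integrable_mul hf p) (hk.integrable_mul hf q)]
      refine integral_congr_ae (Eventually.of_forall fun x => ?_)
      simp only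
      ring
    rw [e]
    have hb1 : Integrable fun x => (L * h + h / 2) * U x := hf.int.const_mul _
    have hb2 : Integrable fun x => (v (p - x) - v (q - x)) ^ 2 / (2 * h) := hi.div_const _
    have h1 : |∫ x, (v (p - x) - v (q - x)) * f x| ≤
        ∫ x, ((L * h + h / 2) * U x + (v (p - x) - v (q - x)) ^ 2 / (2 * h)) := by
      have hi : Integrable fun x =>
        (L * h + h / 2) * U x + (v (p - x) - v (q - x)) ^ 2 / (2 * h) := hb1.add hb2
      rw [← Real.norm_eq_abs]
      refine norm_integral_le_of_norm_le hi (Eventually.of_forall fun x => ?_)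
      have hU := hf.nonneg x
      have hq := Real.sq_sqrt hU
      have hl : |v (p - x) - v (q - x)| ≤ L * h := by
        have := hL (p - x) (q - x)
        rwa [sub_sub_sub_cancel_right] at this
      set w := |v (p - x) - v (q - x)| with hw
      have hw2 : (v (p - x) - v (q - x)) ^ 2 = w ^ 2 := (sq_abs _).symm
      simp only [Real.norm_eq_abs, abs_mul]
      rw [← hw, hw2]
      -- Young's inequality with weight h. The integral of w² is at most D h², so after division by
      -- 2h both terms are of order h; the √U part thus needs only the L² modulus of continuity of
      -- v.
      have k : w * √(U x) ≤ w ^ 2 / (2 * h) + h / 2 * U x := by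
        have : w ^ 2 / (2 * h) + h / 2 * U x - w * √(U x) = (w - h * √(U x)) ^ 2 / (2 * h) := by
          field_simp
          nlinarith
        have : 0 ≤ (w - h * √(U x)) ^ 2 / (2 * h) := by positivity
        linarith
      calc w * |f x| ≤ w * (U x + √(U x)) := by gcongr; exact hf.le x
        _ = w * U x + w * √(U x) := by ring
        _ ≤ L * h * U x + (w ^ 2 / (2 * h) + h / 2 * U x) := by gcongr
        _ = _ := by ring
    rw [integral_add hb1 hb2, integral_const_mul, integral_div] at h1
    have h2 : (∫ x, (v (p - x) - v (q - x)) ^ 2) / (2 * h) ≤ D / 2 * h := by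
      rw [div_le_iff₀ (by positivity)]
      calc _ ≤ D * h ^ 2 := hi2
        _ = _ := by ring
    have h3 : (L * h + h / 2) * ∫ x, U x ≤ (L * h + h / 2) * |Λ| := by
      gcongr
      exact hΛ.trans (le_abs_self _)
    have h4 : 0 ≤ C1 * h := by positivity
    calc _ ≤ (L * h + h / 2) * |Λ| + D / 2 * h := by linarith
      _ = C2 * h := by ring
      _ ≤ _ := by linarith

theorem continuous_conv (hk : IsKernel v) (hf : Tame f) : Continuous (conv v f) := by
  obtain ⟨U, hU⟩ := hf
  obtain ⟨C, hC0, hC⟩ := hk.exists_conv_bound (∫ p, U p)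
  refine (LipschitzWith.of_dist_le_mul (K := ⟨C, hC0⟩) fun p q => ?_).continuous
  rw [Real.dist_eq, dist_eq_norm]
  exact (hC f U hU le_rfl).2 p q

theorem quadForm_comm (hk : IsKernel v) : quadForm v f g = quadForm v g f := by
  unfold quadForm
  rw [Measure.volume_eq_prod, ← integral_prod_swap]
  refine integral_congr_ae (Eventually.of_forall fun z => ?_)
  simp only [Prod.fst_swap, Prod.snd_swap]
  rw [hk.sub_comm, mul_comm (f z.2)]

theorem quadForm_eq (hk : IsKernel v) (hf : Tame f) (hg : Tame g) :
    quadForm v f g = ∫ p, f p * conv v g p := by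
  unfold quadForm
  rw [Measure.volume_eq_prod, integral_prod _ (hk.tame_integrable_prod hf hg)]
  refine integral_congr_ae (Eventually.of_forall fun p => ?_)
  simp only [conv]
  rw [← integral_const_mul]
  refine integral_congr_ae (Eventually.of_forall fun q => ?_)
  simp only
  ring

theorem integrable_mul_conv (hk : IsKernel v) (hf : Tame f) (hg : Tame g) :
    Integrable fun p => f p * conv v g p := by
  have := (hk.tame_integrable_prod hf hg).integral_prod_left
  refine this.congr (Eventually.of_forall fun p => ?_)
  simp only [conv]
  rw [← integral_const_mul]
  refine integral_congr_ae (Eventually.of_forall fun q => ?_)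
  simp only
  ring

theorem quadForm_add_left (hk : IsKernel v) {f' : Space3 → ℝ} (hf : Tame f) (hf' : Tame f')
    (hg : Tame g) :
    quadForm v (fun p => f p + f' p) g = quadForm v f g + quadForm v f' g := by
  unfold quadForm
  rw [← integral_add (hk.tame_integrable_prod hf hg) (hk.tame_integrable_prod hf' hg)]
  refine integral_congr_ae (Eventually.of_forall fun z => ?_)
  simp only
  ring

theorem quadForm_smul_left (c : ℝ) :
    quadForm v (fun p => c * f p) g = c * quadForm v f g := by
  unfold quadForm
  rw [← integral_const_mul]
  refine integral_congr_ae (Eventually.of_forall fun z => ?_)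
  simp only
  ring

theorem quadForm_add_self (hk : IsKernel v) (hf : Tame f) (hg : Tame g) :
    quadForm v (fun p => f p + g p) (fun p => f p + g p) =
      quadForm v f f + 2 * quadForm v f g + quadForm v g g := by
  have hfg := hf.add hg
  rw [hk.quadForm_add_left hf hg hfg, hk.quadForm_comm (f := f), hk.quadForm_comm (f := g),
    hk.quadForm_add_left hf hg hf, hk.quadForm_add_left hf hg hg, hk.quadForm_comm (f := g) (g := f)]
  ring

theorem quadForm_smul_self (hk : IsKernel v) (c : ℝ) :
    quadForm v (fun p => c * f p) (fun p => c * f p) = c ^ 2 * quadForm v f f := by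
  rw [quadForm_smul_left, hk.quadForm_comm, quadForm_smul_left]
  ring

theorem quadForm_sub_self (hk : IsKernel v) (hf : Tame f) (hg : Tame g) :
    quadForm v (fun p => f p - g p) (fun p => f p - g p) =
      quadForm v f f - 2 * quadForm v f g + quadForm v g g := by
  have h := hk.quadForm_add_self hf (hg.const_mul (-1))
  rw [hk.quadForm_smul_self, hk.quadForm_comm (f := f) (g := fun p => -1 * g p),
    quadForm_smul_left] at h
  rw [hk.quadForm_comm (f := f) (g := g)]
  have e : (fun p => f p - g p) = fun p => f p + -1 * g p := by ext p; ring
  rw [e, h]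
  ring

/-- Dominated convergence for the quadratic form. -/
theorem tendsto_quadForm (hk : IsKernel v) {fn gn : ℕ → Space3 → ℝ} {F G : Space3 → ℝ}
    (hFG : Integrable fun z : Space3 × Space3 => v (z.1 - z.2) * (F z.1 * G z.2))
    (hfm : ∀ n, AEStronglyMeasurable (fn n) volume) (hgm : ∀ n, AEStronglyMeasurable (gn n) volume)
    (hF : ∀ n p, |fn n p| ≤ F p) (hG : ∀ n p, |gn n p| ≤ G p)
    (hf : ∀ᵐ p, Tendsto (fun n => fn n p) atTop (𝓝 (f p)))
    (hg : ∀ᵐ p, Tendsto (fun n => gn n p) atTop (𝓝 (g p))) :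
    Tendsto (fun n => quadForm v (fn n) (gn n)) atTop (𝓝 (quadForm v f g)) := by
  refine tendsto_integral_of_dominated_convergence
    (fun z : Space3 × Space3 => v (z.1 - z.2) * (F z.1 * G z.2))
    (fun n => hk.aestronglyMeasurable_prod (hfm n) (hgm n)) hFG (fun n => ?_) ?_
  · refine Eventually.of_forall fun z => ?_
    have h0 := hk.nonneg (z.1 - z.2)
    simp only [Real.norm_eq_abs, abs_mul, abs_of_nonneg h0]
    gcongr
    · exact (abs_nonneg _).trans (hF 0 _)
    · exact hF _ _
    · exact hG _ _
  · have h1 : ∀ᵐ z : Space3 × Space3, Tendsto (fun n => fn n z.1) atTop (𝓝 (f z.1)) :=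
      Measure.quasiMeasurePreserving_fst.ae hf
    have h2 : ∀ᵐ z : Space3 × Space3, Tendsto (fun n => gn n z.2) atTop (𝓝 (g z.2)) :=
      Measure.quasiMeasurePreserving_snd.ae hg
    filter_upwards [h1, h2] with z hz1 hz2
    exact (hz1.mul hz2).const_mul _

end IsKernel

/-- Restrictions to sets that exhaust the space converge pointwise. -/
theorem tendsto_indicator_of_eventually_mem {S : ℕ → Set Space3} {p : Space3}
    (h : ∀ᶠ n in atTop, p ∈ S n) (f : Space3 → ℝ) :
    Tendsto (fun n => (S n).indicator f p) atTop (𝓝 (f p)) := by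
  refine tendsto_const_nhds.congr' ?_
  filter_upwards [h] with n hn
  simp [hn]

theorem abs_indicator_le_abs (S : Set Space3) (f : Space3 → ℝ) (p : Space3) :
    |S.indicator f p| ≤ |f p| := by
  by_cases hp : p ∈ S <;> simp [hp]

theorem eventually_mem_closedBall (p : Space3) :
    ∀ᶠ n : ℕ in atTop, p ∈ Metric.closedBall (0 : Space3) n := by
  obtain ⟨N, hN⟩ := exists_nat_ge ‖p‖
  filter_upwards [eventually_ge_atTop N] with n hn
  simp only [mem_closedBall_zero_iff]
  exact hN.trans (by exact_mod_cast hn)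

namespace IsKernel

variable {v f g U W : Space3 → ℝ}

theorem tendsto_quadForm_indicator (hk : IsKernel v) (hf : Tame f) (hg : Tame g)
    {S S' : ℕ → Set Space3} (hS : ∀ n, MeasurableSet (S n)) (hS' : ∀ n, MeasurableSet (S' n))
    (hS1 : ∀ᵐ p, ∀ᶠ n in atTop, p ∈ S n) (hS1' : ∀ᵐ p, ∀ᶠ n in atTop, p ∈ S' n) :
    Tendsto (fun n => quadForm v ((S n).indicator f) ((S' n).indicator g)) atTop
      (𝓝 (quadForm v f g)) := by
  obtain ⟨U, hU⟩ := hf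
  obtain ⟨W, hW⟩ := hg
  have hi := (hk.integrable_prod hU hW).abs
  refine hk.tendsto_quadForm (F := fun p => |f p|) (G := fun p => |g p|) ?_
    (fun n => hU.meas.indicator (hS n)) (fun n => hW.meas.indicator (hS' n))
    (fun n p => abs_indicator_le_abs _ _ _) (fun n p => abs_indicator_le_abs _ _ _) ?_ ?_
  · refine hi.congr (Eventually.of_forall fun z => ?_)
    simp [abs_mul, abs_of_nonneg (hk.nonneg (z.1 - z.2))]
  · filter_upwards [hS1] with p hp
    exact tendsto_indicator_of_eventually_mem hp f
  · filter_upwards [hS1'] with p hp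
    exact tendsto_indicator_of_eventually_mem hp g

/-- `posType` covers integrable functions only. A tame function is integrable on every ball, and the
restrictions converge in the form. -/
theorem quadForm_self_nonneg (hk : IsKernel v) (hf : Tame f) : 0 ≤ quadForm v f f := by
  have hS : ∀ n : ℕ, MeasurableSet (Metric.closedBall (0 : Space3) n) :=
    fun n => measurableSet_closedBall
  have h := hk.tendsto_quadForm_indicator hf hf hS hS
    (Eventually.of_forall eventually_mem_closedBall)
    (Eventually.of_forall eventually_mem_closedBall)
  refine ge_of_tendsto' h fun n => ?_
  obtain ⟨U, hU⟩ := hf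
  exact hk.posType _ (hU.integrableOn (hS n) measure_closedBall_lt_top)

/-- A tame function in the kernel of the quadratic form has vanishing convolution with `v`. -/
theorem conv_eq_zero (hk : IsKernel v) (hf : Tame f) (h : quadForm v f f = 0) : conv v f = 0 := by
  have h1 : ∀ g, Tame g → quadForm v g f = 0 := by
    intro g hg
    by_contra hne
    have hq : ∀ t : ℝ, 0 ≤ 2 * t * quadForm v g f + t ^ 2 * quadForm v g g := by
      intro t
      have := hk.quadForm_self_nonneg (hf.add (hg.const_mul t))
      rw [hk.quadForm_add_self hf (hg.const_mul t), h, hk.quadForm_smul_self,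
        hk.quadForm_comm (f := f), quadForm_smul_left] at this
      linarith
    set a := quadForm v g f
    set b := quadForm v g g
    have hb : 0 ≤ b := hk.quadForm_self_nonneg hg
    -- Nearly the minimizer of the quadratic 2ta + t²b; the 1 in the denominator covers b = 0.
    have := hq (-a / (b + 1))
    have ha : 0 < a ^ 2 := by positivity
    have e : 2 * (-a / (b + 1)) * a + (-a / (b + 1)) ^ 2 * b =
        - a ^ 2 * (b + 2) / (b + 1) ^ 2 := by field_simp; ring
    rw [e] at this
    have : - a ^ 2 * (b + 2) / (b + 1) ^ 2 < 0 := by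
      apply div_neg_of_neg_of_pos _ (by positivity)
      nlinarith
    linarith
  have hc := hk.continuous_conv hf
  -- Test with the convolution itself, cut off to a ball, so that the pairing is the integral of its
  -- square over that ball.
  have hn : ∀ n : ℕ, ∀ᵐ p, p ∈ Metric.closedBall (0 : Space3) n → conv v f p = 0 := by
    intro n
    set g := (Metric.closedBall (0 : Space3) n).indicator (conv v f)
    have hgi : Integrable g := by
      rw [integrable_indicator_iff measurableSet_closedBall]
      exact hc.continuousOn.integrableOn_compact (isCompact_closedBall _ _)
    have h2 := h1 g (.of_integrable hgi)
    rw [hk.quadForm_eq (.of_integrable hgi) hf, integral_eq_zero_iff_of_nonneg] at h2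
    · filter_upwards [h2] with p hp hpn
      simpa [g, hpn] using hp
    · intro p
      change 0 ≤ g p * conv v f p
      by_cases hp : p ∈ Metric.closedBall (0 : Space3) n
      · simpa only [g, hp, Set.indicator_of_mem] using mul_self_nonneg _
      · simp [g, hp]
    · exact hk.integrable_mul_conv (.of_integrable hgi) hf
  have hz : conv v f =ᵐ[volume] 0 := by
    filter_upwards [ae_all_iff.2 hn] with p hp
    obtain ⟨n, hn⟩ := (eventually_mem_closedBall p).exists
    exact hp n hn
  exact hc.ae_eq_iff_eq volume continuous_const |>.1 hz

theorem norm_map_sub (hk : IsKernel v) (R : Space3 ≃ₗᵢ[ℝ] Space3) (p q : Space3) :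
    v (R p - R q) = v (p - q) := hk.radial _ _ (by rw [← map_sub, R.norm_map])

theorem conv_comp (hk : IsKernel v) (R : Space3 ≃ₗᵢ[ℝ] Space3) (p : Space3) :
    conv v (fun q => f (R q)) p = conv v f (R p) := by
  unfold conv
  rw [← (R.measurePreserving).integral_comp R.toHomeomorph.measurableEmbedding
    (fun q => v (R p - q) * f q)]
  refine integral_congr_ae (Eventually.of_forall fun q => ?_)
  simp only [hk.norm_map_sub]

theorem quadForm_comp (hk : IsKernel v) (hf : Tame f) (hg : Tame g) (R : Space3 ≃ₗᵢ[ℝ] Space3) :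
    quadForm v (fun q => f (R q)) (fun q => g (R q)) = quadForm v f g := by
  obtain ⟨U, hU⟩ := hf
  obtain ⟨W, hW⟩ := hg
  rw [hk.quadForm_eq ⟨_, hU.comp R⟩ ⟨_, hW.comp R⟩, hk.quadForm_eq ⟨_, hU⟩ ⟨_, hW⟩,
    ← (R.measurePreserving).integral_comp R.toHomeomorph.measurableEmbedding
    (fun q => f q * conv v g q)]
  simp only [hk.conv_comp]

theorem quadForm_self_le (hk : IsKernel v) {C : ℝ} (hC : ∀ p, v p ≤ C) (hf : Integrable f) :
    quadForm v f f ≤ C * (∫ p, |f p|) ^ 2 := by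
  have h : (∫ z : Space3 × Space3, C * (|f z.1| * |f z.2|)) = C * (∫ p, |f p|) ^ 2 := by
    rw [integral_const_mul, Measure.volume_eq_prod,
      integral_prod_mul (fun p => |f p|) (fun p => |f p|), sq]
  rw [← h]
  refine integral_mono (hk.tame_integrable_prod (.of_integrable hf) (.of_integrable hf))
    ((hf.abs.mul_prod hf.abs).const_mul C) fun z => ?_
  calc v (z.1 - z.2) * (f z.1 * f z.2) ≤ v (z.1 - z.2) * (|f z.1| * |f z.2|) := by
        refine mul_le_mul_of_nonneg_left ?_ (hk.nonneg _)
        rw [← abs_mul]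
        exact le_abs_self _
    _ ≤ _ := by gcongr; exact hC _

end IsKernel

/-! ### Admissible pairs and the reduced functional -/

theorem integrable_exp_neg_sq_div {T : ℝ} (hT : 0 < T) :
    Integrable fun p : Space3 => Real.exp (-(‖p‖ ^ 2 / T)) := by
  have h := GaussianFourier.integrable_cexp_neg_mul_sq_norm_add (V := Space3) (b := ((1 / T : ℝ) : ℂ))
    (by simpa using hT) 0 0
  refine h.norm.congr (Eventually.of_forall fun p => ?_)
  simp only [Complex.norm_exp]
  congr 1
  have : (-((1 / T : ℝ) : ℂ) * (‖p‖ : ℂ) ^ 2 + 0 * ((inner ℝ (0 : Space3) p : ℝ) : ℂ)) =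
      ((-(‖p‖ ^ 2 / T) : ℝ) : ℂ) := by
    push_cast; ring
  rw [this, Complex.ofReal_re]

/-- The free energy density of the ideal Bose gas at chemical potential `-η`, up to the factor
`-T`. -/
def boseLog (T η : ℝ) (p : Space3) : ℝ := -Real.log (1 - Real.exp (-((‖p‖ ^ 2 + η) / T)))

theorem boseLog_arg_pos {T η : ℝ} (hT : 0 < T) (hη : 0 < η) (p : Space3) :
    0 < (‖p‖ ^ 2 + η) / T := by positivity

/-- A positive η keeps the argument of the logarithm away from 0, so that -ln(1 - x y₀) ≤ x y₀/(1 -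
y₀) with x Gaussian. -/
theorem integrable_boseLog {T η : ℝ} (hT : 0 < T) (hη : 0 < η) : Integrable (boseLog T η) := by
  set y0 := Real.exp (-(η / T)) with hy0
  have hy1 : y0 < 1 := by
    rw [hy0, Real.exp_lt_one_iff]
    have : 0 < η / T := by positivity
    linarith
  have hc : Continuous (boseLog T η) := by
    unfold boseLog
    refine Continuous.neg (Continuous.log (by fun_prop) fun p => ?_)
    have : Real.exp (-((‖p‖ ^ 2 + η) / T)) < 1 := by
      rw [Real.exp_lt_one_iff]
      linarith [boseLog_arg_pos hT hη p]
    linarith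
  refine ((integrable_exp_neg_sq_div hT).mul_const (y0 / (1 - y0))).mono' hc.aestronglyMeasurable
    (Eventually.of_forall fun p => ?_)
  have e : Real.exp (-((‖p‖ ^ 2 + η) / T)) = Real.exp (-(‖p‖ ^ 2 / T)) * y0 := by
    rw [hy0, ← Real.exp_add]; congr 1; ring
  have he1 : Real.exp (-(‖p‖ ^ 2 / T)) ≤ 1 := by
    rw [Real.exp_le_one_iff]
    have : 0 ≤ ‖p‖ ^ 2 / T := by positivity
    linarith
  unfold boseLog
  rw [e]
  set x := Real.exp (-(‖p‖ ^ 2 / T))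
  have hx : 0 < x := Real.exp_pos _
  have hy : 0 < y0 := Real.exp_pos _
  have hxy : x * y0 ≤ y0 := by nlinarith
  have h1 : 0 < 1 - x * y0 := by linarith
  rw [Real.norm_eq_abs, abs_neg, abs_of_nonpos (Real.log_nonpos (by linarith) (by nlinarith))]
  have h2 := Real.one_sub_inv_le_log_of_pos h1
  calc -Real.log (1 - x * y0) ≤ (1 - x * y0)⁻¹ - 1 := by linarith
    _ = x * y0 / (1 - x * y0) := by field_simp; ring
    _ ≤ x * y0 / (1 - y0) := by
        apply div_le_div_of_nonneg_left (by positivity) (by linarith) (by linarith)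
    _ = _ := by ring

/-- A pair `(γ, α)` satisfying the constraints of the domain. -/
structure Adm (γ α : Space3 → ℝ) : Prop where
  int : Integrable fun p => (1 + ‖p‖ ^ 2) * γ p
  nonneg : ∀ p, 0 ≤ γ p
  meas : AEStronglyMeasurable α volume
  sq_le : ∀ p, α p ^ 2 ≤ γ p * (1 + γ p)

namespace Adm

variable {γ α γ' α' : Space3 → ℝ}

theorem meas_γ (h : Adm γ α) : AEStronglyMeasurable γ volume := by
  have h1 : Continuous fun p : Space3 => (1 + ‖p‖ ^ 2)⁻¹ :=
    Continuous.inv₀ (by fun_prop) fun p => by positivity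
  refine (h1.aestronglyMeasurable.mul h.int.aestronglyMeasurable).congr
    (Eventually.of_forall fun p => ?_)
  have : 1 + ‖p‖ ^ 2 ≠ 0 := by positivity
  simp only [Pi.mul_apply]
  field_simp

theorem integrable (h : Adm γ α) : Integrable γ := by
  refine h.int.mono' h.meas_γ (Eventually.of_forall fun p => ?_)
  have := h.nonneg p
  rw [Real.norm_eq_abs, abs_of_nonneg this]
  nlinarith [sq_nonneg ‖p‖]

theorem kinetic (h : Adm γ α) : Integrable fun p => ‖p‖ ^ 2 * γ p := by
  refine (h.int.sub h.integrable).congr (Eventually.of_forall fun p => ?_)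
  simp only [Pi.sub_apply]
  ring

theorem domBy_γ (h : Adm γ α) : DomBy γ γ :=
  ⟨h.meas_γ, h.integrable, h.nonneg, fun p => by
    rw [abs_of_nonneg (h.nonneg p)]
    have := Real.sqrt_nonneg (γ p)
    linarith⟩

theorem domBy_α (h : Adm γ α) : DomBy α γ :=
  ⟨h.meas, h.integrable, h.nonneg, fun p => abs_le_add_sqrt (h.nonneg p) (h.sq_le p)⟩

theorem tame_γ (h : Adm γ α) : Tame γ := ⟨_, h.domBy_γ⟩

theorem tame_α (h : Adm γ α) : Tame α := ⟨_, h.domBy_α⟩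

theorem meas_entropy (h : Adm γ α) :
    AEStronglyMeasurable (fun p => entropyDensity (γ p) (α p)) volume :=
  continuous_entropyDensity.comp_aestronglyMeasurable
    (f := fun p => (γ p, α p)) (h.meas_γ.prodMk h.meas)

theorem entropy (h : Adm γ α) : Integrable fun p => entropyDensity (γ p) (α p) := by
  refine (h.int.add (integrable_boseLog one_pos one_pos)).mono' h.meas_entropy
    (Eventually.of_forall fun p => ?_)
  rw [Real.norm_eq_abs, abs_of_nonneg (entropyDensity_nonneg (h.sq_le p))]
  have := entropyDensity_le (h.nonneg p) (h.sq_le p) (boseLog_arg_pos one_pos one_pos p)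
  simp only [Pi.add_apply, boseLog]
  simp only [div_one] at this ⊢
  linarith

theorem midpoint (h : Adm γ α) (h' : Adm γ' α') :
    Adm (fun p => (γ p + γ' p) / 2) fun p => (α p + α' p) / 2 where
  int := by
    refine ((h.int.add h'.int).div_const 2).congr (Eventually.of_forall fun p => ?_)
    simp only [Pi.add_apply]
    ring
  nonneg := fun p => by have := h.nonneg p; have := h'.nonneg p; positivity
  meas := by
    have := (h.meas.add h'.meas).mul_const (2⁻¹ : ℝ)
    exact this
  sq_le := fun p => sq_le_midpoint (h.nonneg p) (h.sq_le p) (h'.nonneg p) (h'.sq_le p)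

theorem neg (h : Adm γ α) : Adm γ fun p => -α p :=
  ⟨h.int, h.nonneg, h.meas.neg, fun p => by rw [neg_sq]; exact h.sq_le p⟩

theorem indicator (h : Adm γ α) {S : Set Space3} (hS : MeasurableSet S) :
    Adm (S.indicator γ) (S.indicator α) where
  int := by
    refine (h.int.indicator hS).congr (Eventually.of_forall fun p => ?_)
    by_cases hp : p ∈ S <;> simp [hp]
  nonneg := fun p => Set.indicator_nonneg (fun p _ => h.nonneg p) p
  meas := h.meas.indicator hS
  sq_le := fun p => by
    by_cases hp : p ∈ S
    · simpa [hp] using h.sq_le p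
    · simp [hp]

theorem comp (h : Adm γ α) (R : Space3 ≃ₗᵢ[ℝ] Space3) :
    Adm (fun p => γ (R p)) fun p => α (R p) where
  int := by
    have := (R.measurePreserving.integrable_comp_emb R.toHomeomorph.measurableEmbedding).2 h.int
    refine this.congr (Eventually.of_forall fun p => ?_)
    simp
  nonneg := fun p => h.nonneg _
  meas := h.meas.comp_measurePreserving R.measurePreserving
  sq_le := fun p => h.sq_le _

end Adm

/-- The integrand of kinetic energy minus temperature times entropy. -/
def freeDensity (T : ℝ) (γ α : Space3 → ℝ) (p : Space3) : ℝ :=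
  ‖p‖ ^ 2 * γ p - T * entropyDensity (γ p) (α p)

/-- The functional at fixed condensate density `r`, without the direct interaction term. -/
def reduced (v : Space3 → ℝ) (T r : ℝ) (γ α : Space3 → ℝ) : ℝ :=
  c3 * (∫ p, freeDensity T γ α p) + c3 * r * (conv v γ 0 + conv v α 0)
    + c3 ^ 2 / 2 * (quadForm v α α + quadForm v γ γ)

theorem c3_pos : 0 < c3 := by unfold c3; positivity

section

variable {v γ α γ' α' : Space3 → ℝ} {T r : ℝ}

theorem Adm.integrable_freeDensity (h : Adm γ α) (T : ℝ) : Integrable (freeDensity T γ α) :=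
  h.kinetic.sub (h.entropy.const_mul T)

theorem IsKernel.conv_zero (hk : IsKernel v) (f : Space3 → ℝ) : conv v f 0 = ∫ p, v p * f p := by
  unfold conv
  simp only [zero_sub, hk.even]

theorem Adm.isFiniteAt {V : Space3 → ℝ} {x : State} (h : Adm x.γ x.α) (hk : IsKernel (vHat V)) :
    IsFiniteAt V x where
  density := h.integrable
  kinetic := h.kinetic
  entropy := h.entropy
  linear := by
    have := (hk.tame_integrable_mul h.tame_γ 0).add (hk.tame_integrable_mul h.tame_α 0)
    refine this.congr (Eventually.of_forall fun p => ?_)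
    simp only [zero_sub, hk.even, Pi.add_apply]
    ring
  quadratic := by
    have := (hk.tame_integrable_prod h.tame_α h.tame_α).add
      (hk.tame_integrable_prod h.tame_γ h.tame_γ)
    refine this.congr (Eventually.of_forall fun p => ?_)
    simp only [Pi.add_apply]
    ring

theorem canonicalEnergy_eq {V : Space3 → ℝ} {x : State} (h : Adm x.γ x.α)
    (hk : IsKernel (vHat V)) (T : ℝ) : canonicalEnergy V T x =
      reduced (vHat V) T x.ρ₀ x.γ x.α + 1 / 2 * vHat V 0 * (x.ρ₀ + rhoGamma x.γ) ^ 2 := by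
  have e1 : (∫ p, freeDensity T x.γ x.α p) =
      (∫ p, ‖p‖ ^ 2 * x.γ p) - T * ∫ p, entropyDensity (x.γ p) (x.α p) := by
    unfold freeDensity
    rw [integral_sub h.kinetic (h.entropy.const_mul T), integral_const_mul]
  have e2 : (∫ p, vHat V p * (x.γ p + x.α p)) = conv (vHat V) x.γ 0 + conv (vHat V) x.α 0 := by
    unfold conv
    rw [← integral_add (hk.tame_integrable_mul h.tame_γ 0) (hk.tame_integrable_mul h.tame_α 0)]
    refine integral_congr_ae (Eventually.of_forall fun p => ?_)
    simp only [zero_sub, hk.even]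
    ring
  have e3 : (∫ z : Space3 × Space3,
      vHat V (z.1 - z.2) * (x.α z.1 * x.α z.2 + x.γ z.1 * x.γ z.2)) =
      quadForm (vHat V) x.α x.α + quadForm (vHat V) x.γ x.γ := by
    unfold quadForm
    rw [← integral_add (hk.tame_integrable_prod h.tame_α h.tame_α)
      (hk.tame_integrable_prod h.tame_γ h.tame_γ)]
    refine integral_congr_ae (Eventually.of_forall fun p => ?_)
    simp only
    ring
  unfold canonicalEnergy reduced BogoliubovGas.entropy
  rw [e1, e2, e3]
  ring

theorem Adm.freeDensity_midpoint (h : Adm γ α) (h' : Adm γ' α') (hT : 0 ≤ T) (p : Space3) :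
    freeDensity T (fun p => (γ p + γ' p) / 2) (fun p => (α p + α' p) / 2) p ≤
      (freeDensity T γ α p + freeDensity T γ' α' p) / 2 := by
  have := mul_le_mul_of_nonneg_left (entropyDensity_midpoint (h.nonneg p) (h.sq_le p)
    (h'.nonneg p) (h'.sq_le p)) hT
  simp only [freeDensity]
  linarith

theorem conv_midpoint (hk : IsKernel v) {f g : Space3 → ℝ} (hf : Tame f) (hg : Tame g)
    (p : Space3) : conv v (fun q => (f q + g q) / 2) p = (conv v f p + conv v g p) / 2 := by
  unfold conv
  rw [← integral_add (hk.tame_integrable_mul hf p) (hk.tame_integrable_mul hg p), ← integral_div]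
  refine integral_congr_ae (Eventually.of_forall fun q => ?_)
  simp only
  ring

theorem quadForm_midpoint (hk : IsKernel v) {f g : Space3 → ℝ} (hf : Tame f) (hg : Tame g) :
    quadForm v (fun q => (f q + g q) / 2) (fun q => (f q + g q) / 2) =
      (quadForm v f f + quadForm v g g) / 2 -
        quadForm v (fun p => f p - g p) (fun p => f p - g p) / 4 := by
  have e : (fun q => (f q + g q) / 2) = fun q => 1 / 2 * (f q + g q) := by ext q; ring
  rw [e, hk.quadForm_smul_self, hk.quadForm_add_self hf hg, hk.quadForm_sub_self hf hg]
  ring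

/-- Midpoint convexity of the reduced functional, with a gap. -/
theorem reduced_midpoint (hk : IsKernel v) (hT : 0 ≤ T) (h : Adm γ α) (h' : Adm γ' α') :
    reduced v T r (fun p => (γ p + γ' p) / 2) (fun p => (α p + α' p) / 2) ≤
      (reduced v T r γ α + reduced v T r γ' α') / 2 -
        c3 ^ 2 / 8 * (quadForm v (fun p => γ p - γ' p) (fun p => γ p - γ' p) +
          quadForm v (fun p => α p - α' p) (fun p => α p - α' p)) := by
  have h1 : (∫ p, freeDensity T (fun p => (γ p + γ' p) / 2) (fun p => (α p + α' p) / 2) p) ≤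
      ((∫ p, freeDensity T γ α p) + ∫ p, freeDensity T γ' α' p) / 2 := by
    rw [← integral_add (h.integrable_freeDensity T) (h'.integrable_freeDensity T), ← integral_div]
    exact integral_mono ((h.midpoint h').integrable_freeDensity T)
      (((h.integrable_freeDensity T).add (h'.integrable_freeDensity T)).div_const 2)
      fun p => h.freeDensity_midpoint h' hT p
  unfold reduced
  rw [conv_midpoint hk h.tame_γ h'.tame_γ, conv_midpoint hk h.tame_α h'.tame_α,
    quadForm_midpoint hk h.tame_γ h'.tame_γ, quadForm_midpoint hk h.tame_α h'.tame_α]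
  have := mul_le_mul_of_nonneg_left h1 c3_pos.le
  linarith

theorem reduced_comp (hk : IsKernel v) (h : Adm γ α) (R : Space3 ≃ₗᵢ[ℝ] Space3) :
    reduced v T r (fun p => γ (R p)) (fun p => α (R p)) = reduced v T r γ α := by
  unfold reduced
  rw [hk.quadForm_comp h.tame_γ h.tame_γ, hk.quadForm_comp h.tame_α h.tame_α, hk.conv_comp,
    hk.conv_comp, map_zero, ← (R.measurePreserving).integral_comp
      R.toHomeomorph.measurableEmbedding (fun p => freeDensity T γ α p)]
  simp [freeDensity]

/-- For any η > 0 the shift ηγ gives a lower bound that is integrable and independent of the pair,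
as Fatou's lemma requires. -/
theorem freeDensity_ge (h : Adm γ α) (hT : 0 < T) {η : ℝ} (hη : 0 < η) (p : Space3) :
    -(T * boseLog T η p) ≤ freeDensity T γ α p + η * γ p := by
  have := mul_le_mul_of_nonneg_left
    (entropyDensity_le (h.nonneg p) (h.sq_le p) (boseLog_arg_pos hT hη p)) hT.le
  have e : T * ((‖p‖ ^ 2 + η) / T * γ p - Real.log (1 - Real.exp (-((‖p‖ ^ 2 + η) / T)))) =
    (‖p‖ ^ 2 + η) * γ p + T * boseLog T η p := by
    unfold boseLog
    field_simp
    ring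
  rw [e] at this
  unfold freeDensity
  linarith

/-- The Bose bound with t = (‖p‖² + 1)/(2T), that is at temperature 2T, spends only half of the
kinetic energy on the entropy. The other half controls the large momenta. -/
theorem integral_freeDensity_ge (h : Adm γ α) (hT : 0 < T) :
    (∫ p, ‖p‖ ^ 2 * γ p) / 2 - (∫ p, γ p) / 2 - T * ∫ p, boseLog (2 * T) 1 p ≤
      ∫ p, freeDensity T γ α p := by
  have hb := (integrable_boseLog (T := 2 * T) (by positivity) one_pos).const_mul T
  have hd : Integrable fun p => ‖p‖ ^ 2 * γ p / 2 - γ p / 2 :=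
    (h.kinetic.div_const 2).sub (h.integrable.div_const 2)
  rw [← integral_const_mul, ← integral_div, ← integral_div, ← integral_sub (h.kinetic.div_const 2)
    (h.integrable.div_const 2), ← integral_sub hd hb]
  refine integral_mono (hd.sub hb) (h.integrable_freeDensity T) fun p => ?_
  have := mul_le_mul_of_nonneg_left (entropyDensity_le (h.nonneg p) (h.sq_le p)
    (boseLog_arg_pos (T := 2 * T) (by positivity) one_pos p)) hT.le
  have e : T * ((‖p‖ ^ 2 + 1) / (2 * T) * γ p -
      Real.log (1 - Real.exp (-((‖p‖ ^ 2 + 1) / (2 * T))))) =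
    (‖p‖ ^ 2 + 1) / 2 * γ p + T * boseLog (2 * T) 1 p := by
    unfold boseLog
    field_simp
    ring
  rw [e] at this
  simp only [freeDensity]
  linarith

/-- The constraint gives |α| ≤ γ + 1/2, so γ + α ≥ -1/2 pointwise. -/
theorem conv_add_conv_ge (hk : IsKernel v) (h : Adm γ α) :
    -((∫ p, v p) / 2) ≤ conv v γ 0 + conv v α 0 := by
  have i1 : Integrable fun p => v p * γ p := by
    simpa [hk.even] using hk.tame_integrable_mul h.tame_γ 0
  have i2 : Integrable fun p => v p * α p := by
    simpa [hk.even] using hk.tame_integrable_mul h.tame_α 0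
  rw [hk.conv_zero, hk.conv_zero, ← integral_add i1 i2, ← integral_div, ← integral_neg]
  · refine integral_mono (hk.integrable.div_const 2).neg (i1.add i2) fun p => ?_
    · have h1 := hk.nonneg p
      have h2 := (abs_le.1 (abs_le_add_half (h.nonneg p) (h.sq_le p))).1
      simp only
      nlinarith

/-- The reduced functional controls the kinetic energy. -/
theorem kinetic_le_of_reduced_le (hk : IsKernel v) (hT : 0 < T) (hr : 0 ≤ r) (h : Adm γ α) :
    c3 / 2 * (∫ p, ‖p‖ ^ 2 * γ p) ≤ reduced v T r γ α + c3 / 2 * (∫ p, γ p) +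
      c3 * T * (∫ p, boseLog (2 * T) 1 p) + c3 * r * ((∫ p, v p) / 2) := by
  have h1 := mul_le_mul_of_nonneg_left (integral_freeDensity_ge h hT) c3_pos.le
  have h2 := mul_le_mul_of_nonneg_left (conv_add_conv_ge hk h) (mul_nonneg c3_pos.le hr)
  have h3 := hk.quadForm_self_nonneg h.tame_γ
  have h4 := hk.quadForm_self_nonneg h.tame_α
  have h5 : 0 ≤ c3 ^ 2 / 2 * (quadForm v α α + quadForm v γ γ) := by positivity
  unfold reduced
  linarith

end

/-! ### Extraction of almost everywhere convergent sequences by convexity -/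

/-- Almost minimal elements of a decreasing sequence of bounded midpoint convex sets converge. -/
theorem exists_tendsto_of_midpoint_convex {H : Type*} [NormedAddCommGroup H]
    [InnerProductSpace ℂ H] [CompleteSpace H] {K : ℕ → Set H} (hanti : Antitone K)
    (hne : ∀ n, (K n).Nonempty)
    (hmid : ∀ n, ∀ x ∈ K n, ∀ y ∈ K n, (2⁻¹ : ℂ) • (x + y) ∈ K n)
    {C : ℝ} (hC : ∀ x ∈ K 0, ‖x‖ ^ 2 ≤ C) :
    ∃ (z : ℕ → H) (l : H), (∀ n, z n ∈ K n) ∧ Tendsto z atTop (𝓝 l) := by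
  -- The least squared norm over `K n`. It increases with n and is bounded, so it converges.
  set I : ℕ → ℝ := fun n => sInf ((fun x => ‖x‖ ^ 2) '' K n) with hI
  have hbdd : ∀ n, BddBelow ((fun x : H => ‖x‖ ^ 2) '' K n) := fun n =>
    ⟨0, by rintro _ ⟨x, -, rfl⟩; positivity⟩
  have hle : ∀ n, ∀ x ∈ K n, I n ≤ ‖x‖ ^ 2 := fun n x hx => csInf_le (hbdd n) ⟨x, hx, rfl⟩
  have hmono : Monotone I := fun m n hmn =>
    csInf_le_csInf (hbdd m) ((hne n).image _) (Set.image_mono (hanti hmn))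
  have hIC : ∀ n, I n ≤ C := fun n => by
    obtain ⟨x, hx⟩ := hne n
    exact (hle n x hx).trans (hC x (hanti (Nat.zero_le n) hx))
  have hex : ∀ n : ℕ, ∃ x ∈ K n, ‖x‖ ^ 2 < I n + 1 / ((n : ℝ) + 1) := by
    intro n
    obtain ⟨_, ⟨x, hx, rfl⟩, hlt⟩ := exists_lt_of_csInf_lt ((hne n).image fun x => ‖x‖ ^ 2)
      (show sInf ((fun x => ‖x‖ ^ 2) '' K n) < I n + 1 / ((n : ℝ) + 1) by
        have : 0 < 1 / ((n : ℝ) + 1) := by positivity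
        linarith)
    exact ⟨x, hx, hlt⟩
  choose z hz hzlt using hex
  have hlim : Tendsto I atTop (𝓝 (⨆ n, I n)) :=
    tendsto_atTop_ciSup hmono ⟨C, by rintro _ ⟨n, rfl⟩; exact hIC n⟩
  set S := ⨆ n, I n
  have hIS : ∀ n, I n ≤ S := fun n => le_ciSup (f := I) ⟨C, by rintro _ ⟨n, rfl⟩; exact hIC n⟩ n
  have hcau : CauchySeq z := by
    refine cauchySeq_of_le_tendsto_0 (fun N => √(4 * (S - I N) + 4 * (1 / ((N : ℝ) + 1)))) ?_ ?_
    · intro n m N hn hm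
      rw [dist_eq_norm]
      apply Real.le_sqrt_of_sq_le
      -- The midpoint of two late terms still lies in `K N`, so its squared norm is at least `I N`;
      -- the parallelogram law then leaves at most 4(S - I N) + 4/(N + 1) for the squared distance.
      have hp := parallelogram_law_with_norm ℂ (z n) (z m)
      have h1 := hle N _ (hmid N _ (hanti hn (hz n)) _ (hanti hm (hz m)))
      rw [norm_smul, mul_pow] at h1
      norm_num at h1
      have h2 : ∀ k, N ≤ k → ‖z k‖ ^ 2 ≤ S + 1 / ((N : ℝ) + 1) := by
        intro k hk
        have : 1 / ((k : ℝ) + 1) ≤ 1 / ((N : ℝ) + 1) :=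
          one_div_le_one_div_of_le (by positivity) (by gcongr)
        linarith [hzlt k, hIS k]
      have := h2 n hn
      have := h2 m hm
      nlinarith
    · have h1 : Tendsto (fun N => 4 * (S - I N) + 4 * (1 / ((N : ℝ) + 1))) atTop
          (𝓝 (4 * (S - S) + 4 * 0)) :=
        ((hlim.const_sub S).const_mul 4).add (tendsto_one_div_add_atTop_nhds_zero_nat.const_mul 4)
      have h2 := (Real.continuous_sqrt.tendsto _).comp h1
      simpa [Function.comp_def] using h2
  obtain ⟨l, hl⟩ := cauchySeq_tendsto_of_complete hcau
  exact ⟨z, l, hz, hl⟩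

theorem norm_toLp_sq {f : Space3 → ℂ} (hf : MemLp f 2 volume) :
    ‖hf.toLp f‖ ^ 2 = ∫ p, ‖f p‖ ^ 2 := by
  have h := inner_self_eq_norm_sq (𝕜 := ℂ) (hf.toLp f)
  rw [← h, L2.inner_def]
  have : (∫ p, inner ℂ ((hf.toLp f) p) ((hf.toLp f) p)) = ((∫ p, ‖f p‖ ^ 2 : ℝ) : ℂ) := by
    rw [← integral_complex_ofReal]
    refine integral_congr_ae ?_
    filter_upwards [hf.coeFn_toLp] with p hp
    rw [hp]
    simp [inner_self_eq_norm_sq_to_K]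
  rw [this]
  simp

/-- The weighted complex combination of a pair. -/
def weighted (b γ α : Space3 → ℝ) (p : Space3) : ℂ :=
  ((√(1 + b p))⁻¹ : ℝ) * ((γ p : ℂ) + (α p : ℂ) * Complex.I)

theorem norm_weighted_sq (b γ α : Space3 → ℝ) (p : Space3) (hb : 0 ≤ b p) :
    ‖weighted b γ α p‖ ^ 2 = (γ p ^ 2 + α p ^ 2) / (1 + b p) := by
  unfold weighted
  rw [norm_mul, mul_pow, Complex.norm_real, Real.norm_eq_abs, sq_abs, inv_pow,
    Real.sq_sqrt (by positivity), Complex.sq_norm, Complex.normSq_add_mul_I]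
  ring

section

variable {b γ α : Space3 → ℝ}

/-- This is what the weight is for: γ² + α² ≤ γ(1 + 2γ) ≤ 2γ(1 + b), so bounded mass gives a bounded
weighted L² norm although γ need not be bounded in L². -/
theorem norm_weighted_sq_le (hb : ∀ p, 0 ≤ b p) (h : Adm γ α) (hγ : ∀ p, γ p ≤ b p)
    (p : Space3) : ‖weighted b γ α p‖ ^ 2 ≤ 2 * γ p := by
  have hbp := hb p
  rw [norm_weighted_sq _ _ _ _ (hb p), div_le_iff₀ (by positivity)]
  nlinarith [h.sq_le p, mul_le_mul_of_nonneg_left (hγ p) (h.nonneg p), h.nonneg p]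

theorem meas_weighted (hbm : Measurable b) (h : Adm γ α) :
    AEStronglyMeasurable (weighted b γ α) volume := by
  unfold weighted
  have h1 : Measurable fun p => (√(1 + b p))⁻¹ := by fun_prop
  exact (Complex.continuous_ofReal.comp_aestronglyMeasurable h1.aestronglyMeasurable).mul
    ((Complex.continuous_ofReal.comp_aestronglyMeasurable h.meas_γ).add
      ((Complex.continuous_ofReal.comp_aestronglyMeasurable h.meas).mul_const _))

theorem memLp_weighted (hbm : Measurable b) (hb : ∀ p, 0 ≤ b p) (h : Adm γ α)
    (hγ : ∀ p, γ p ≤ b p) : MemLp (weighted b γ α) 2 volume := by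
  rw [memLp_two_iff_integrable_sq_norm (meas_weighted hbm h)]
  refine (h.integrable.const_mul 2).mono' ((meas_weighted hbm h).norm.pow 2)
    (Eventually.of_forall fun p => ?_)
  rw [Real.norm_eq_abs, abs_of_nonneg (by positivity)]
  exact norm_weighted_sq_le hb h hγ p

end

/-- From decreasing midpoint convex classes of pairs one can choose a sequence that converges
almost everywhere. -/
theorem exists_ae_tendsto {b : Space3 → ℝ} (hbm : Measurable b) (hb : ∀ p, 0 ≤ b p) {Λ : ℝ}
    {P : ℕ → (Space3 → ℝ) → (Space3 → ℝ) → Prop}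
    (hanti : ∀ m n, m ≤ n → ∀ γ α, P n γ α → P m γ α)
    (hne : ∀ n, ∃ γ α, P n γ α)
    (hmid : ∀ n γ α γ' α', P n γ α → P n γ' α' →
      P n (fun p => (γ p + γ' p) / 2) fun p => (α p + α' p) / 2)
    (hadm : ∀ n γ α, P n γ α → Adm γ α) (hγ : ∀ n γ α, P n γ α → ∀ p, γ p ≤ b p)
    (hΛ : ∀ n γ α, P n γ α → ∫ p, γ p ≤ Λ) :
    ∃ (γn αn : ℕ → Space3 → ℝ) (γ α : Space3 → ℝ), (∀ n, P n (γn n) (αn n)) ∧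
      (∀ᵐ p, Tendsto (fun n => γn n p) atTop (𝓝 (γ p))) ∧
      (∀ᵐ p, Tendsto (fun n => αn n p) atTop (𝓝 (α p))) ∧
      AEStronglyMeasurable γ volume ∧ AEStronglyMeasurable α volume ∧
      (∀ p, 0 ≤ γ p) ∧ (∀ p, γ p ≤ b p) ∧ (∀ p, α p ^ 2 ≤ γ p * (1 + γ p)) := by
  set K : ℕ → Set (Lp ℂ 2 (volume : Measure Space3)) := fun n =>
    {z | ∃ γ α, P n γ α ∧ z =ᵐ[volume] weighted b γ α} with hK
  have hK1 : Antitone K := by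
    rintro m n hmn x ⟨γ, α, h, hx⟩
    exact ⟨γ, α, hanti m n hmn _ _ h, hx⟩
  have hK2 : ∀ n, (K n).Nonempty := by
    intro n
    obtain ⟨γ, α, h⟩ := hne n
    exact ⟨(memLp_weighted hbm hb (hadm _ _ _ h) (hγ _ _ _ h)).toLp, γ, α, h,
      MemLp.coeFn_toLp _⟩
  have hK3 : ∀ n, ∀ x ∈ K n, ∀ y ∈ K n, (2⁻¹ : ℂ) • (x + y) ∈ K n := by
    rintro n x ⟨γ, α, h, hx⟩ y ⟨γ', α', h', hy⟩
    refine ⟨_, _, hmid n _ _ _ _ h h', ?_⟩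
    filter_upwards [Lp.coeFn_smul (2⁻¹ : ℂ) (x + y), Lp.coeFn_add x y, hx, hy] with p h1 h2 h3 h4
    rw [h1, Pi.smul_apply, h2, Pi.add_apply, h3, h4]
    simp only [weighted, smul_eq_mul]
    push_cast
    ring
  have hK4 : ∀ x ∈ K 0, ‖x‖ ^ 2 ≤ 2 * Λ := by
    rintro x ⟨γ, α, h, hx⟩
    have hm := memLp_weighted hbm hb (hadm _ _ _ h) (hγ _ _ _ h)
    have e : x = hm.toLp _ := by
      apply Lp.ext
      exact hx.trans hm.coeFn_toLp.symm
    rw [e, norm_toLp_sq]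
    calc ∫ p, ‖weighted b γ α p‖ ^ 2 ≤ ∫ p, 2 * γ p := by
          refine integral_mono ?_ ((hadm _ _ _ h).integrable.const_mul 2)
            fun p => norm_weighted_sq_le hb (hadm _ _ _ h) (hγ _ _ _ h) p
          exact (memLp_two_iff_integrable_sq_norm hm.1).1 hm
      _ ≤ _ := by
        rw [integral_const_mul]
        gcongr
        exact hΛ _ _ _ h
  obtain ⟨z, l, hz, hl⟩ := exists_tendsto_of_midpoint_convex hK1 hK2 hK3 hK4
  -- L² convergence gives convergence in measure, hence almost everywhere along a subsequence. Since
  -- the classes decrease and n ≤ φ n, the subsequence still satisfies `P n` at index n.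
  obtain ⟨φ, hφ, hae⟩ := (tendstoInMeasure_of_tendsto_Lp hl).exists_seq_tendsto_ae
  choose γ0 α0 hP hzw using hz
  have hall := ae_all_iff.2 hzw
  set s : Space3 → ℝ := fun p => √(1 + b p)
  have hs : ∀ p, 0 < s p := fun p => Real.sqrt_pos.2 (by linarith [hb p])
  have hre : ∀ n p, γ0 n p = s p * (weighted b (γ0 n) (α0 n) p).re := by
    intro n p
    have := (hs p).ne'
    simp [weighted, s] at this ⊢
    field_simp
  have him : ∀ n p, α0 n p = s p * (weighted b (γ0 n) (α0 n) p).im := by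
    intro n p
    have := (hs p).ne'
    simp [weighted, s] at this ⊢
    field_simp
  have hconv : ∀ᵐ p, Tendsto (fun n => γ0 (φ n) p) atTop (𝓝 (s p * (l p).re)) ∧
      Tendsto (fun n => α0 (φ n) p) atTop (𝓝 (s p * (l p).im)) := by
    filter_upwards [hae, hall] with p hp hp2
    simp only [hp2] at hp
    constructor
    · simp only [hre]
      exact ((Complex.continuous_re.tendsto _).comp hp).const_mul _
    · simp only [him]
      exact ((Complex.continuous_im.tendsto _).comp hp).const_mul _
  -- The limit is taken where it exists and (0, 0) elsewhere, so that the constraints hold at every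
  -- p and not merely almost everywhere.
  have hchoice : ∀ p, ∃ ga : ℝ × ℝ, (0 ≤ ga.1 ∧ ga.1 ≤ b p ∧ ga.2 ^ 2 ≤ ga.1 * (1 + ga.1)) ∧
      ((Tendsto (fun n => γ0 (φ n) p) atTop (𝓝 (s p * (l p).re)) ∧
      Tendsto (fun n => α0 (φ n) p) atTop (𝓝 (s p * (l p).im))) →
      Tendsto (fun n => γ0 (φ n) p) atTop (𝓝 ga.1) ∧
      Tendsto (fun n => α0 (φ n) p) atTop (𝓝 ga.2)) := by
    intro p
    by_cases h : Tendsto (fun n => γ0 (φ n) p) atTop (𝓝 (s p * (l p).re)) ∧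
      Tendsto (fun n => α0 (φ n) p) atTop (𝓝 (s p * (l p).im))
    · refine ⟨(s p * (l p).re, s p * (l p).im), ⟨?_, ?_, ?_⟩, fun _ => h⟩
      · exact ge_of_tendsto' h.1 fun n => (hadm _ _ _ (hP (φ n))).nonneg p
      · exact le_of_tendsto' h.1 fun n => hγ _ _ _ (hP (φ n)) p
      · exact le_of_tendsto_of_tendsto' (h.2.pow 2) (h.1.mul (h.1.const_add 1))
          fun n => (hadm _ _ _ (hP (φ n))).sq_le p
    · exact ⟨(0, 0), ⟨le_rfl, hb p, by simp⟩, fun h' => absurd h' h⟩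
  choose ga hga1 hga2 using hchoice
  have ht1 : ∀ᵐ p, Tendsto (fun n => γ0 (φ n) p) atTop (𝓝 (ga p).1) := by
    filter_upwards [hconv] with p hp using (hga2 p hp).1
  have ht2 : ∀ᵐ p, Tendsto (fun n => α0 (φ n) p) atTop (𝓝 (ga p).2) := by
    filter_upwards [hconv] with p hp using (hga2 p hp).2
  refine ⟨fun n => γ0 (φ n), fun n => α0 (φ n), fun p => (ga p).1, fun p => (ga p).2,
    fun n => hanti _ _ (hφ.id_le n) _ _ (hP (φ n)), ht1, ht2, ?_, ?_, fun p => (hga1 p).1,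
    fun p => (hga1 p).2.1, fun p => (hga1 p).2.2⟩
  · exact aestronglyMeasurable_of_tendsto_ae atTop
      (fun n => (hadm _ _ _ (hP (φ n))).meas_γ) ht1
  · exact aestronglyMeasurable_of_tendsto_ae atTop
      (fun n => (hadm _ _ _ (hP (φ n))).meas) ht2

/-! ### Lower semicontinuity -/

/-- Fatou's lemma for real integrals with an integrable lower bound. -/
theorem eventually_integral_sub_le {X : Type*} [MeasurableSpace X] {μ : Measure X}
    {fn : ℕ → X → ℝ} {f g : X → ℝ} (hfn : ∀ n, Integrable (fn n) μ)
    (hf : Integrable f μ) (hg : Integrable g μ) (hle : ∀ n p, -g p ≤ fn n p)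
    (hlim : ∀ᵐ p ∂μ, Tendsto (fun n => fn n p) atTop (𝓝 (f p))) {ε : ℝ} (hε : 0 < ε) :
    ∀ᶠ n in atTop, (∫ p, f p ∂μ) - ε ≤ ∫ p, fn n p ∂μ := by
  have h0 : ∀ n p, 0 ≤ fn n p + g p := fun n p => by linarith [hle n p]
  have h0' : ∀ᵐ p ∂μ, 0 ≤ f p + g p := by
    filter_upwards [hlim] with p hp
    exact ge_of_tendsto' (hp.add_const (g p)) fun n => h0 n p
  have hfat : ∫⁻ p, liminf (fun n => ENNReal.ofReal (fn n p + g p)) atTop ∂μ ≤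
      liminf (fun n => ∫⁻ p, ENNReal.ofReal (fn n p + g p) ∂μ) atTop := lintegral_liminf_le'
    fun n => ((hfn n).add hg).aestronglyMeasurable.aemeasurable.ennreal_ofReal
  have e1 : ∫⁻ p, liminf (fun n => ENNReal.ofReal (fn n p + g p)) atTop ∂μ =
      ENNReal.ofReal (∫ p, (f p + g p) ∂μ) := by
    rw [ofReal_integral_eq_lintegral_ofReal (f := fun p => f p + g p) (hf.add hg) h0']
    refine lintegral_congr_ae ?_
    filter_upwards [hlim] with p hp
    exact ((ENNReal.continuous_ofReal.tendsto _).comp (hp.add_const (g p))).liminf_eq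
  have e2 : ∀ n, ∫⁻ p, ENNReal.ofReal (fn n p + g p) ∂μ =
      ENNReal.ofReal (∫ p, (fn n p + g p) ∂μ) := fun n =>
    (ofReal_integral_eq_lintegral_ofReal ((hfn n).add hg) (Eventually.of_forall (h0 n))).symm
  rw [e1] at hfat
  simp only [e2] at hfat
  -- If the limiting integral is at most ε, nonnegativity suffices. Otherwise subtracting ε gives a
  -- strict inequality in `ENNReal` below the liminf.
  rcases le_or_gt (∫ p, (f p + g p) ∂μ) ε with hsmall | hbig
  · refine Eventually.of_forall fun n => ?_
    have := integral_nonneg (μ := μ) (f := fun p => fn n p + g p) (h0 n)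
    rw [integral_add (hfn n) hg] at this
    rw [integral_add hf hg] at hsmall
    linarith
  · have hlt : ENNReal.ofReal ((∫ p, (f p + g p) ∂μ) - ε) <
        liminf (fun n => ENNReal.ofReal (∫ p, (fn n p + g p) ∂μ)) atTop :=
      lt_of_lt_of_le ((ENNReal.ofReal_lt_ofReal_iff (by linarith)).2 (by linarith)) hfat
    filter_upwards [eventually_lt_of_lt_liminf hlt] with n hn
    have := (ENNReal.ofReal_lt_ofReal_iff_of_nonneg (by linarith)).1 hn
    rw [integral_add (hfn n) hg, integral_add hf hg] at this
    linarith

/-- Fatou's lemma is applied after adding ηγ. Removing it again costs at most ηΛ ≤ ε/2, as the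
masses are bounded by Λ. -/
theorem eventually_freeEnergy_sub_le {γn αn : ℕ → Space3 → ℝ} {γ α : Space3 → ℝ} {T Λ : ℝ}
    (hT : 0 < T) (hn : ∀ n, Adm (γn n) (αn n)) (h : Adm γ α) (hΛ : ∀ n, ∫ p, γn n p ≤ Λ)
    (hγ : ∀ᵐ p, Tendsto (fun n => γn n p) atTop (𝓝 (γ p)))
    (hα : ∀ᵐ p, Tendsto (fun n => αn n p) atTop (𝓝 (α p))) {ε : ℝ} (hε : 0 < ε) :
    ∀ᶠ n in atTop, (∫ p, freeDensity T γ α p) - ε ≤ ∫ p, freeDensity T (γn n) (αn n) p := by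
  have hΛ0 : 0 ≤ Λ := (integral_nonneg (hn 0).nonneg).trans (hΛ 0)
  set η := ε / (2 * (Λ + 1)) with hη
  have hη0 : 0 < η := by positivity
  have hηΛ : η * Λ ≤ ε / 2 := by
    rw [hη, div_mul_eq_mul_div, div_le_div_iff₀ (by positivity) (by positivity)]
    nlinarith
  have key := eventually_integral_sub_le (μ := volume)
    (fn := fun n p => freeDensity T (γn n) (αn n) p + η * γn n p)
    (f := fun p => freeDensity T γ α p + η * γ p) (g := fun p => T * boseLog T η p)
    (fun n => ((hn n).integrable_freeDensity T).add ((hn n).integrable.const_mul η))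
    ((h.integrable_freeDensity T).add (h.integrable.const_mul η))
    ((integrable_boseLog hT hη0).const_mul T) (fun n p => freeDensity_ge (hn n) hT hη0 p)
    (by
      filter_upwards [hγ, hα] with p h1 h2
      refine Tendsto.add ?_ (h1.const_mul η)
      exact (h1.const_mul _).sub
        (((continuous_entropyDensity.tendsto (γ p, α p)).comp (h1.prodMk_nhds h2)).const_mul T))
    (half_pos hε)
  filter_upwards [key] with n hk
  rw [integral_add (h.integrable_freeDensity T) (h.integrable.const_mul η),
    integral_add ((hn n).integrable_freeDensity T) ((hn n).integrable.const_mul η),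
    integral_const_mul, integral_const_mul] at hk
  have h1 : 0 ≤ η * ∫ p, γ p := mul_nonneg hη0.le (integral_nonneg h.nonneg)
  have h2 : η * ∫ p, γn n p ≤ η * Λ := by gcongr; exact hΛ n
  linarith

/-- Write Q for the form and B for a large ball. Positivity of Q at fₙ - 1_B fₙ gives Q(fₙ, fₙ) ≥
2Q(1_B fₙ, fₙ) - Q(1_B fₙ, 1_B fₙ). The right side converges by dominated convergence, because one
variable is confined to B and v is integrable in the other. -/
theorem eventually_quadForm_sub_le {v : Space3 → ℝ} (hk : IsKernel v) {fn : ℕ → Space3 → ℝ}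
    {f : Space3 → ℝ} {M : ℝ} (hn : ∀ n, Tame (fn n)) (h : Tame f) (hM : ∀ n p, |fn n p| ≤ M)
    (hlim : ∀ᵐ p, Tendsto (fun n => fn n p) atTop (𝓝 (f p))) {ε : ℝ} (hε : 0 < ε) :
    ∀ᶠ n in atTop, quadForm v f f - ε ≤ quadForm v (fn n) (fn n) := by
  have hB : ∀ R : ℕ, MeasurableSet (Metric.closedBall (0 : Space3) R) :=
    fun R => measurableSet_closedBall
  have hM0 : 0 ≤ M := (abs_nonneg _).trans (hM 0 0)
  have hR : Tendsto (fun R : ℕ => 2 * quadForm v ((Metric.closedBall 0 R).indicator f) f -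
      quadForm v ((Metric.closedBall 0 R).indicator f) ((Metric.closedBall 0 R).indicator f))
      atTop (𝓝 (2 * quadForm v f f - quadForm v f f)) := by
    refine Tendsto.sub (Tendsto.const_mul 2 ?_) ?_
    · have := hk.tendsto_quadForm_indicator h h hB (S' := fun _ => Set.univ)
        (fun _ => MeasurableSet.univ) (Eventually.of_forall eventually_mem_closedBall)
        (Eventually.of_forall fun p => Eventually.of_forall fun n => Set.mem_univ p)
      simpa using this
    · exact hk.tendsto_quadForm_indicator h h hB hB
        (Eventually.of_forall eventually_mem_closedBall)
        (Eventually.of_forall eventually_mem_closedBall)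
  obtain ⟨R, hRε⟩ := (hR.eventually (lt_mem_nhds
    (show quadForm v f f - ε / 2 < 2 * quadForm v f f - quadForm v f f by linarith))).exists
  set B := Metric.closedBall (0 : Space3) R
  have hFi : Integrable (B.indicator fun _ : Space3 => M) := by
    rw [integrable_indicator_iff (hB R)]
    exact integrableOn_const measure_closedBall_lt_top.ne
  have hFle : ∀ n p, |B.indicator (fn n) p| ≤ B.indicator (fun _ => M) p := fun n p => by
    by_cases hp : p ∈ B
    · simpa [hp] using hM n p
    · simp [hp]
  have hBlim : ∀ᵐ p, Tendsto (fun n => B.indicator (fn n) p) atTop (𝓝 (B.indicator f p)) := by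
    filter_upwards [hlim] with p hp
    by_cases hpB : p ∈ B
    · simpa [hpB] using hp
    · simp [hpB]
  have hmeas : ∀ n, AEStronglyMeasurable (fn n) volume := fun n => by
    obtain ⟨U, hU⟩ := hn n
    exact hU.meas
  have t1 := hk.tendsto_quadForm (fn := fun n => B.indicator (fn n)) (gn := fn) (f := B.indicator f)
    (g := f) (F := B.indicator fun _ => M) (G := fun _ => M)
    (((hk.integrable_fst hFi).mul_const M).congr (Eventually.of_forall fun z => by
      simp only; ring)) (fun n => (hmeas n).indicator (hB R)) hmeas hFle hM hBlim hlim
  have t2 := hk.tendsto_quadForm (fn := fun n => B.indicator (fn n))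
    (gn := fun n => B.indicator (fn n)) (f := B.indicator f)
    (g := B.indicator f) (F := B.indicator fun _ => M) (G := fun _ => M)
    (((hk.integrable_fst hFi).mul_const M).congr (Eventually.of_forall fun z => by
      simp only; ring)) (fun n => (hmeas n).indicator (hB R)) (fun n => (hmeas n).indicator (hB R))
      hFle (fun n p => (abs_indicator_le_abs _ _ _).trans (hM n p)) hBlim hBlim
  have t := (t1.const_mul 2).sub t2
  filter_upwards [t.eventually (lt_mem_nhds (show quadForm v f f - ε <
    2 * quadForm v (B.indicator f) f - quadForm v (B.indicator f) (B.indicator f) by linarith))]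
    with n hnn
  have hp := hk.quadForm_self_nonneg ((hn n).sub ((hn n).indicator (hB R)))
  rw [hk.quadForm_sub_self (hn n) ((hn n).indicator (hB R)),
    hk.quadForm_comm (f := fn n) (g := B.indicator (fn n))] at hp
  linarith

theorem tendsto_conv_zero {v : Space3 → ℝ} (hk : IsKernel v) {fn : ℕ → Space3 → ℝ}
    {f : Space3 → ℝ} {M : ℝ} (hn : ∀ n, AEStronglyMeasurable (fn n) volume)
    (hM : ∀ n p, |fn n p| ≤ M)
    (hlim : ∀ᵐ p, Tendsto (fun n => fn n p) atTop (𝓝 (f p))) :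
    Tendsto (fun n => conv v (fn n) 0) atTop (𝓝 (conv v f 0)) := by
  simp only [hk.conv_zero]
  refine tendsto_integral_of_dominated_convergence (fun p => v p * M)
    (fun n => hk.cont.aestronglyMeasurable.mul (hn n)) (hk.integrable.mul_const M)
    (fun n => Eventually.of_forall fun p => ?_) ?_
  · rw [Real.norm_eq_abs, abs_mul, abs_of_nonneg (hk.nonneg p)]
    have := hk.nonneg p
    gcongr
    exact hM n p
  · filter_upwards [hlim] with p hp using hp.const_mul _

/-- Convergence of the mass of bounded functions with bounded second moments. -/
theorem tendsto_integral_of_moment {fn : ℕ → Space3 → ℝ} {f : Space3 → ℝ} {M C : ℝ}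
    (hn : ∀ n, Integrable (fn n)) (hn2 : ∀ n, Integrable fun p => ‖p‖ ^ 2 * fn n p)
    (hf : Integrable f) (h0 : ∀ n p, 0 ≤ fn n p) (hf0 : ∀ p, 0 ≤ f p)
    (hM : ∀ n p, fn n p ≤ M) (hC : ∀ n, ∫ p, ‖p‖ ^ 2 * fn n p ≤ C)
    (hlim : ∀ᵐ p, Tendsto (fun n => fn n p) atTop (𝓝 (f p))) :
    Tendsto (fun n => ∫ p, fn n p) atTop (𝓝 (∫ p, f p)) := by
  have hC0 : 0 ≤ C :=
    (integral_nonneg fun p => mul_nonneg (by positivity) (h0 0 p)).trans (hC 0)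
  rw [tendsto_order]
  constructor
  · intro a ha
    filter_upwards [eventually_integral_sub_le (μ := volume) (fn := fn) (f := f) (g := 0) hn hf
      (integrable_zero _ _ _) (fun n p => by simpa using h0 n p) hlim
      (half_pos (sub_pos.2 ha))] with n h
    linarith
  · intro a ha
    -- The mass outside the ball is at most C/R, because there ‖p‖² > R. This choice makes C/R less
    -- than half of the available gap, and the added 1 ensures R > 1.
    obtain ⟨R, hR⟩ := exists_nat_gt (2 * C / (a - ∫ p, f p) + 1)
    have hd : 0 < a - ∫ p, f p := sub_pos.2 ha
    have hR1 : 1 < (R : ℝ) := by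
      have : 0 ≤ 2 * C / (a - ∫ p, f p) := by positivity
      linarith
    set B := Metric.closedBall (0 : Space3) R
    have hB : MeasurableSet B := measurableSet_closedBall
    have hFi : Integrable (B.indicator fun _ : Space3 => M) := by
      rw [integrable_indicator_iff hB]
      exact integrableOn_const measure_closedBall_lt_top.ne
    have ht : Tendsto (fun n => ∫ p, B.indicator (fn n) p) atTop (𝓝 (∫ p, B.indicator f p)) := by
      refine tendsto_integral_of_dominated_convergence (B.indicator fun _ => M)
        (fun n => (hn n).aestronglyMeasurable.indicator hB) hFi
        (fun n => Eventually.of_forall fun p => ?_) ?_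
      · by_cases hp : p ∈ B
        · simpa [hp, abs_of_nonneg (h0 n p)] using hM n p
        · simp [hp]
      · filter_upwards [hlim] with p hp
        by_cases hpB : p ∈ B
        · simpa [hpB] using hp
        · simp [hpB]
    have hle : (∫ p, B.indicator f p) ≤ ∫ p, f p :=
      integral_mono (hf.indicator hB) hf fun p => Set.indicator_le_self' (fun p _ => hf0 p) p
    filter_upwards [ht.eventually (gt_mem_nhds
      (show (∫ p, B.indicator f p) < (∫ p, f p) + (a - ∫ p, f p) / 2 by linarith))] with n hnn
    have hb : (∫ p, fn n p) ≤ (∫ p, B.indicator (fn n) p) + C / R := by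
      have : (∫ p, fn n p) ≤ ∫ p, (B.indicator (fn n) p + ‖p‖ ^ 2 * fn n p / R) := by
        refine integral_mono (hn n) (((hn n).indicator hB).add ((hn2 n).div_const _)) fun p => ?_
        have := h0 n p
        by_cases hp : p ∈ B
        · simp only [hp, Set.indicator_of_mem]
          have : 0 ≤ ‖p‖ ^ 2 * fn n p / R := by positivity
          linarith
        · simp only [hp, not_false_eq_true, Set.indicator_of_notMem, zero_add]
          simp only [B, mem_closedBall_zero_iff, not_le] at hp
          rw [le_div_iff₀ (by linarith), mul_comm]
          gcongr
          nlinarith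
      rw [integral_add ((hn n).indicator hB) ((hn2 n).div_const _), integral_div] at this
      have h3 : (∫ p, ‖p‖ ^ 2 * fn n p) / R ≤ C / R := by
        gcongr
        exact hC n
      linarith
    have : C / R < (a - ∫ p, f p) / 2 := by
      rw [div_lt_iff₀ (by linarith)]
      have h4 : 2 * C / (a - ∫ p, f p) < R := by linarith
      rw [div_lt_iff₀ hd] at h4
      linarith
    linarith

/-- The smaller of the values of `reduced` at `(γ, α)` and `(γ, -α)`. -/
def reducedMin (v : Space3 → ℝ) (T r : ℝ) (γ α : Space3 → ℝ) : ℝ :=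
  c3 * (∫ p, freeDensity T γ α p) + c3 * r * (conv v γ 0 - |conv v α 0|)
    + c3 ^ 2 / 2 * (quadForm v α α + quadForm v γ γ)

/-- Flipping the sign of α changes only the term linear in α, so the better sign may be chosen. -/
theorem exists_reduced_eq_reducedMin {v : Space3 → ℝ} {T r : ℝ} {γ α : Space3 → ℝ}
    (h : Adm γ α) (hk : IsKernel v) :
    ∃ α', Adm γ α' ∧ reduced v T r γ α' = reducedMin v T r γ α := by
  rcases le_total (conv v α 0) 0 with h0 | h0
  · refine ⟨α, h, ?_⟩
    unfold reduced reducedMin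
    rw [abs_of_nonpos h0]
    ring
  · refine ⟨fun p => -α p, h.neg, ?_⟩
    have e1 : conv v (fun p => -α p) 0 = -conv v α 0 := by
      unfold conv
      rw [← integral_neg]
      simp
    have e2 : quadForm v (fun p => -α p) (fun p => -α p) = quadForm v α α := by
      have := hk.quadForm_smul_self (-1) (f := α)
      simpa using this
    have e3 : freeDensity T γ (fun p => -α p) = freeDensity T γ α := by
      ext p
      simp [freeDensity, entropyDensity_neg]
    unfold reduced reducedMin
    rw [abs_of_nonneg h0, e1, e2, e3]
    ring

/-- Lower semicontinuity of `reducedMin` along bounded sequences. -/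
theorem reducedMin_le_of_tendsto {v : Space3 → ℝ} (hk : IsKernel v) {T : ℝ} (hT : 0 < T)
    {γn αn : ℕ → Space3 → ℝ} {γ α : Space3 → ℝ} {Λ M : ℝ} {rn en : ℕ → ℝ} {r e : ℝ}
    (hn : ∀ n, Adm (γn n) (αn n)) (h : Adm γ α) (hΛ : ∀ n, ∫ p, γn n p ≤ Λ)
    (hM : ∀ n p, γn n p ≤ M)
    (hγ : ∀ᵐ p, Tendsto (fun n => γn n p) atTop (𝓝 (γ p)))
    (hα : ∀ᵐ p, Tendsto (fun n => αn n p) atTop (𝓝 (α p)))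
    (hr : Tendsto rn atTop (𝓝 r)) (he : Tendsto en atTop (𝓝 e))
    (hle : ∀ n, reducedMin v T (rn n) (γn n) (αn n) ≤ en n) :
    reducedMin v T r γ α ≤ e := by
  have hMγ : ∀ n p, |γn n p| ≤ M + 1 / 2 := fun n p => by
    rw [abs_of_nonneg ((hn n).nonneg p)]
    linarith [hM n p]
  have hMα : ∀ n p, |αn n p| ≤ M + 1 / 2 := fun n p =>
    (abs_le_add_half ((hn n).nonneg p) ((hn n).sq_le p)).trans (by linarith [hM n p])
  have hc := c3_pos
  have t1 := tendsto_conv_zero hk (fun n => (hn n).meas_γ) hMγ hγ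
  have t2 := (tendsto_conv_zero hk (fun n => (hn n).meas) hMα hα).abs
  have t3 : Tendsto (fun n => c3 * rn n * (conv v (γn n) 0 - |conv v (αn n) 0|)) atTop
      (𝓝 (c3 * r * (conv v γ 0 - |conv v α 0|))) := (hr.const_mul c3).mul (t1.sub t2)
  refine le_of_forall_pos_le_add fun ε hε => ?_
  -- Error budget in units of δ: c3 from the free energy, c3² from the two quadratic forms, and 1
  -- each from the linear term and from `en`.
  have hδ : 0 < ε / (c3 + c3 ^ 2 + 2) := by positivity
  set δ := ε / (c3 + c3 ^ 2 + 2) with hδe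
  have hδε : δ * (c3 + c3 ^ 2 + 2) = ε := by rw [hδe]; field_simp
  obtain ⟨n, h1, h2, h3, h4, h5⟩ := ((eventually_freeEnergy_sub_le hT hn h hΛ hγ hα hδ).and
    ((eventually_quadForm_sub_le hk (fun n => (hn n).tame_γ) h.tame_γ hMγ hγ hδ).and
    ((eventually_quadForm_sub_le hk (fun n => (hn n).tame_α) h.tame_α hMα hα hδ).and
    ((t3.eventually (lt_mem_nhds (sub_lt_self _ hδ))).and
    (he.eventually (gt_mem_nhds (lt_add_of_pos_right _ hδ))))))).exists
  have h6 := hle n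
  unfold reducedMin at h6 ⊢
  have k1 := mul_le_mul_of_nonneg_left h1 hc.le
  have k2 := mul_le_mul_of_nonneg_left (add_le_add h3 h2) (by positivity : 0 ≤ c3 ^ 2 / 2)
  linarith

/-! ### Moving particles near zero momentum into the condensate -/

theorem volume_real_ball_le {s : ℝ} (hs : 0 < s) (hs1 : s ≤ 1) :
    volume.real (Metric.ball (0 : Space3) s) ≤ s * volume.real (Metric.ball (0 : Space3) 1) := by
  rw [measureReal_def, measureReal_def, Measure.addHaar_ball_of_pos _ _ hs, ENNReal.toReal_mul,
    ENNReal.toReal_ofReal (by positivity)]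
  have : s ^ Module.finrank ℝ Space3 ≤ s := by
    simp only [finrank_euclideanSpace, Fintype.card_fin]
    nlinarith [mul_nonneg hs.le (by nlinarith : 0 ≤ 1 - s ^ 2)]
  gcongr

theorem integrable_indicator_ball_const (s c : ℝ) :
    Integrable ((Metric.ball (0 : Space3) s).indicator fun _ => c) := by
  rw [integrable_indicator_iff measurableSet_ball]
  exact integrableOn_const measure_ball_lt_top.ne

theorem integral_indicator_ball_const (s c : ℝ) :
    ∫ p, (Metric.ball (0 : Space3) s).indicator (fun _ => c) p =
      volume.real (Metric.ball (0 : Space3) s) * c := by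
  rw [integral_indicator measurableSet_ball, setIntegral_const, smul_eq_mul]

theorem abs_integral_mul_sub_le {D : Set Space3} {a φ : Space3 → ℝ} {C φ0 : ℝ} (ha : Integrable a)
    (haφ : Integrable fun p => a p * φ p) (hsupp : ∀ p, p ∉ D → a p = 0)
    (hφ : ∀ p ∈ D, |φ p - φ0| ≤ C) :
    |(∫ p, a p * φ p) - φ0 * ∫ p, a p| ≤ C * ∫ p, |a p| := by
  rw [← integral_const_mul, ← integral_sub haφ (ha.const_mul _), ← integral_const_mul,
    ← Real.norm_eq_abs]
  refine norm_integral_le_of_norm_le (ha.abs.const_mul C) (Eventually.of_forall fun p => ?_)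
  by_cases hp : p ∈ D
  · have e : a p * φ p - φ0 * a p = (φ p - φ0) * a p := by ring
    rw [Real.norm_eq_abs, e, abs_mul]
    gcongr
    exact hφ p hp
  · simp [hsupp p hp]

theorem freeDensity_indicator (S : Set Space3) (T : ℝ) (γ α : Space3 → ℝ) :
    freeDensity T (S.indicator γ) (S.indicator α) = S.indicator (freeDensity T γ α) := by
  ext p
  by_cases hp : p ∈ S <;> simp [freeDensity, hp, entropyDensity_zero]

/-- Mass m in a small ball around 0 interacts with the rest as condensate of density c3 m does. Its
cross terms are close to m X for γ and at least about -m|Y| for α, where X and Y are the outer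
potentials at 0. This is exactly the change in `reducedMin` when r grows by c3 m. Everything else is
an error that vanishes with s uniformly in the pair, or is absorbed in η. -/
theorem exists_reducedMin_cut_le {v : Space3 → ℝ} (hk : IsKernel v) {T : ℝ} (hT : 0 < T)
    (Λ : ℝ) {r₁ : ℝ} (hr₁ : 0 ≤ r₁) {ε : ℝ} (hε : 0 < ε) :
    ∃ δ : ℝ, 0 < δ ∧ ∀ s : ℝ, 0 < s → s ≤ δ → ∀ γ α : Space3 → ℝ, Adm γ α → ∫ p, γ p ≤ Λ →
      ∀ r : ℝ, 0 ≤ r → r ≤ r₁ →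
      reducedMin v T (r + c3 * ∫ p, (Metric.ball 0 s).indicator γ p)
        ((Metric.ball 0 s)ᶜ.indicator γ) ((Metric.ball 0 s)ᶜ.indicator α) ≤
        reduced v T r γ α + ε := by
  obtain ⟨C, hC0, hC⟩ := hk.exists_conv_bound Λ
  obtain ⟨Cv, hCv0, hCv⟩ := hk.bounded
  have hc := c3_pos
  -- The entropy in the ball is at most ηm plus G times the volume. First η makes the mass part at
  -- most ε/2; then G is fixed, and the volume part goes into `K`.
  set η := ε / (2 * (c3 * T * |Λ| + 1)) with hη
  have hη0 : 0 < η := by positivity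
  have hηε : c3 * T * η * |Λ| ≤ ε / 2 := by
    have : η * (2 * (c3 * T * |Λ| + 1)) = ε := by rw [hη]; field_simp
    nlinarith
  set G := -Real.log (1 - Real.exp (-η)) with hG
  have hG0 : 0 ≤ G := by
    have : Real.exp (-η) < 1 := by rw [Real.exp_lt_one_iff]; linarith
    have := Real.log_nonpos (x := 1 - Real.exp (-η)) (by linarith)
      (by linarith [Real.exp_pos (-η)])
    linarith
  set B₁ := volume.real (Metric.ball (0 : Space3) 1) with hB1
  have hB10 : 0 ≤ B₁ := measureReal_nonneg
  -- Collects all remaining errors, which are of order s: either the ball volume, at most s B₁, or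
  -- the oscillation C s of the outer potentials, multiplies them.
  set K := B₁ * (c3 * T * G + c3 * r₁ * (Cv / 2) + c3 ^ 2 * C) + c3 ^ 2 * C * (2 * |Λ|) with hK
  have hK0 : 0 ≤ K := by positivity
  refine ⟨min 1 (ε / (2 * (K + 1))), by positivity, fun s hs hsδ γ α h hΛ r hr hrr => ?_⟩
  have hs1 : s ≤ 1 := hsδ.trans (min_le_left _ _)
  have hsK : s * K ≤ ε / 2 := by
    have h1 : s ≤ ε / (2 * (K + 1)) := hsδ.trans (min_le_right _ _)
    rw [le_div_iff₀ (by positivity)] at h1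
    nlinarith
  set D := Metric.ball (0 : Space3) s with hD
  have hDm : MeasurableSet D := measurableSet_ball
  set B := volume.real D with hBdef
  have hB0 : 0 ≤ B := measureReal_nonneg
  have hB : B ≤ s * B₁ := volume_real_ball_le hs hs1
  have hΛ0 : 0 ≤ ∫ p, γ p := integral_nonneg h.nonneg
  have hΛ' : |Λ| = Λ := abs_of_nonneg (hΛ0.trans hΛ)
  have hin := h.indicator hDm
  have hout := h.indicator hDm.compl
  set g := D.indicator γ with hg
  set a := D.indicator α with ha
  set γ' := Dᶜ.indicator γ with hγ'
  set α' := Dᶜ.indicator α with hα'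
  have eγ : γ = fun p => γ' p + g p := (Set.indicator_compl_add_self D γ).symm
  have eα : α = fun p => α' p + a p := (Set.indicator_compl_add_self D α).symm
  have hgi : Integrable g := hin.integrable
  have hai : Integrable a := h.domBy_α.integrableOn hDm measure_ball_lt_top
  set m := ∫ p, g p with hm
  have hm0 : 0 ≤ m := integral_nonneg hin.nonneg
  have hmΛ : m ≤ |Λ| := by
    rw [hΛ']
    exact (integral_mono hgi h.integrable fun p =>
      Set.indicator_le_self' (fun p _ => h.nonneg p) p).trans hΛ
  have hoΛ : ∫ p, γ' p ≤ Λ := (integral_mono hout.integrable h.integrable fun p =>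
      Set.indicator_le_self' (fun p _ => h.nonneg p) p).trans hΛ
  have haabs : ∀ p, |a p| ≤ g p + D.indicator (fun _ => 1 / 2) p := fun p => by
    by_cases hp : p ∈ D
    · simpa [a, g, hp] using abs_le_add_half (h.nonneg p) (h.sq_le p)
    · simp [a, g, hp]
  have hA : ∫ p, |a p| ≤ m + B / 2 := by
    have := integral_mono hai.abs (hgi.add (integrable_indicator_ball_const s (1 / 2))) haabs
    rw [integral_add' hgi (integrable_indicator_ball_const s (1 / 2)),
      integral_indicator_ball_const] at this
    linarith
  have hA' : |∫ p, a p| ≤ m + B / 2 := (abs_integral_le_integral_abs).trans hA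
  obtain ⟨hCγ, hLγ⟩ := hC γ' γ' hout.domBy_γ hoΛ
  obtain ⟨hCα, hLα⟩ := hC α' γ' hout.domBy_α hoΛ
  set X := conv v γ' 0
  set Y := conv v α' 0
  have hF : (∫ p, freeDensity T γ' α' p) - T * (η * m + G * B) ≤ ∫ p, freeDensity T γ α p := by
    have hi : Integrable fun p => η * g p + D.indicator (fun _ => G) p :=
      (hgi.const_mul η).add (integrable_indicator_ball_const s G)
    have : ∫ p, (freeDensity T γ' α' p - T * (η * g p + D.indicator (fun _ => G) p)) ≤
        ∫ p, freeDensity T γ α p := by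
      refine integral_mono ((hout.integrable_freeDensity T).sub (hi.const_mul T))
        (h.integrable_freeDensity T) fun p => ?_
      simp only [γ', α', freeDensity_indicator]
      by_cases hp : p ∈ D
      · have hpc : p ∉ Dᶜ := by simpa using hp
        simp only [g, hp, hpc, not_false_eq_true, Set.indicator_of_mem, Set.indicator_of_notMem]
        have h1 := mul_le_mul_of_nonneg_left (entropyDensity_le (h.nonneg p) (h.sq_le p) hη0) hT.le
        have h2 : 0 ≤ ‖p‖ ^ 2 * γ p := mul_nonneg (by positivity) (h.nonneg p)
        simp only [freeDensity]
        linarith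
      · have hpc : p ∈ Dᶜ := hp
        simp [g, hp]
    rw [integral_sub (hout.integrable_freeDensity T) (hi.const_mul T), integral_const_mul,
      integral_add (hgi.const_mul η) (integrable_indicator_ball_const s G), integral_const_mul,
      integral_indicator_ball_const, mul_comm B G] at this
    exact this
  have hlinγ : conv v γ 0 = X + conv v g 0 := by
    have := conv_midpoint hk hout.tame_γ hin.tame_γ 0
    rw [hk.conv_zero] at this
    have e : (∫ p, v p * ((γ' p + g p) / 2)) = conv v γ 0 / 2 := by
      rw [hk.conv_zero, ← integral_div, eγ]
      refine integral_congr_ae (Eventually.of_forall fun p => ?_)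
      simp only
      ring
    rw [e] at this
    linarith
  have hlinα : conv v α 0 = Y + conv v a 0 := by
    have := conv_midpoint hk hout.tame_α hin.tame_α 0
    rw [hk.conv_zero] at this
    have e : (∫ p, v p * ((α' p + a p) / 2)) = conv v α 0 / 2 := by
      rw [hk.conv_zero, ← integral_div, eα]
      refine integral_congr_ae (Eventually.of_forall fun p => ?_)
      simp only
      ring
    rw [e] at this
    linarith
  have hlin : -(Cv / 2 * B) ≤ conv v g 0 + conv v a 0 := by
    have i1 : Integrable fun p => v p * g p := by
      simpa [hk.even] using hk.tame_integrable_mul hin.tame_γ 0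
    have i2 : Integrable fun p => v p * a p := by
      simpa [hk.even] using hk.tame_integrable_mul hin.tame_α 0
    rw [hk.conv_zero, hk.conv_zero, ← integral_add i1 i2]
    have := integral_mono (integrable_indicator_ball_const s (-(Cv / 2))) (i1.add i2) fun p => by
      have h0 := hk.nonneg p
      have h1 := hCv p
      have h2 := (abs_le.1 (abs_le_add_half (h.nonneg p) (h.sq_le p))).1
      change D.indicator (fun _ => -(Cv / 2)) p ≤ v p * g p + v p * a p
      by_cases hp : p ∈ D
      · simp only [g, a, hp, Set.indicator_of_mem]
        nlinarith
      · simp [g, a, hp]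
    rw [integral_indicator_ball_const] at this
    simp only [Pi.add_apply] at this
    linarith
  -- The self-interaction of the ball is nonnegative and is dropped. In the cross term the outer
  -- potential differs from its value X at 0 by at most C s.
  have hQγ : quadForm v γ' γ' + 2 * (m * X - C * s * m) ≤ quadForm v γ γ := by
    have e := hk.quadForm_add_self hout.tame_γ hin.tame_γ
    rw [← eγ, hk.quadForm_comm (f := γ') (g := g), hk.quadForm_eq hin.tame_γ hout.tame_γ] at e
    have h1 := hk.quadForm_self_nonneg hin.tame_γ
    have h2 := abs_integral_mul_sub_le (D := D) (C := C * s) (φ0 := X) hgi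
      (hk.integrable_mul_conv hin.tame_γ hout.tame_γ) (fun p hp => by simp [g, hp])
      (fun p hp => (hLγ p 0).trans (by
        rw [sub_zero]
        have : ‖p‖ < s := by simpa [D] using hp
        gcongr))
    have e2 : (∫ p, |g p|) = m := by
      refine integral_congr_ae (Eventually.of_forall fun p => ?_)
      exact abs_of_nonneg (hin.nonneg p)
    rw [e2] at h2
    have := (abs_le.1 h2).1
    linarith
  have hQα : quadForm v α' α' + 2 * (-(m + B / 2) * |Y| - C * s * (m + B / 2)) ≤
      quadForm v α α := by
    have e := hk.quadForm_add_self hout.tame_α hin.tame_α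
    rw [← eα, hk.quadForm_comm (f := α') (g := a), hk.quadForm_eq hin.tame_α hout.tame_α] at e
    have h1 := hk.quadForm_self_nonneg hin.tame_α
    have h2 := abs_integral_mul_sub_le (D := D) (C := C * s) (φ0 := Y) hai
      (hk.integrable_mul_conv hin.tame_α hout.tame_α) (fun p hp => by simp [a, hp])
      (fun p hp => (hLα p 0).trans (by
        rw [sub_zero]
        have : ‖p‖ < s := by simpa [D] using hp
        gcongr))
    have h3 := (abs_le.1 h2).1
    have h4 : -((m + B / 2) * |Y|) ≤ Y * ∫ p, a p := by
      have : |Y * ∫ p, a p| ≤ |Y| * (m + B / 2) := by rw [abs_mul]; gcongr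
      have := (abs_le.1 this).1
      linarith
    have h5 : C * s * ∫ p, |a p| ≤ C * s * (m + B / 2) := by gcongr
    linarith
  have hY : |Y| ≤ C := hCα 0
  have hYn := neg_abs_le Y
  have hF' := mul_le_mul_of_nonneg_left hF hc.le
  have hl' := mul_le_mul_of_nonneg_left hlin (mul_nonneg hc.le hr)
  -- Replacing Y by -|Y| in the old condensate term can only lower the energy.
  have hYr : 0 ≤ c3 * r * (Y + |Y|) := mul_nonneg (by positivity) (by linarith)
  have hQ' := mul_le_mul_of_nonneg_left (add_le_add hQα hQγ) (by positivity : 0 ≤ c3 ^ 2 / 2)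
  have b1 : c3 * T * η * m ≤ c3 * T * η * |Λ| := by gcongr
  have b2 : B * (c3 * T * G + c3 * r * (Cv / 2) + c3 ^ 2 * C) ≤
      s * B₁ * (c3 * T * G + c3 * r₁ * (Cv / 2) + c3 ^ 2 * C) := by gcongr
  have b3 : c3 ^ 2 * C * s * (2 * m) ≤ c3 ^ 2 * C * s * (2 * |Λ|) := by gcongr
  have b4 : c3 ^ 2 * (B / 2 * |Y|) ≤ c3 ^ 2 * (B / 2 * C) := by gcongr
  have b5 : c3 ^ 2 * (C * s * (B / 2)) ≤ c3 ^ 2 * (C * 1 * (B / 2)) := by gcongr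
  unfold reduced reducedMin
  rw [hlinγ, hlinα]
  rw [hK] at hsK
  linarith

/-! ### Limits of energy-bounded sequences of states -/

theorem integrable_of_tendsto_of_integral_le {X : Type*} [MeasurableSpace X] {μ : Measure X}
    {fn : ℕ → X → ℝ} {f : X → ℝ} {C : ℝ} (hfn : ∀ n, Integrable (fn n) μ)
    (hf : AEStronglyMeasurable f μ) (h0 : ∀ n p, 0 ≤ fn n p) (hC : ∀ n, ∫ p, fn n p ∂μ ≤ C)
    (hlim : ∀ᵐ p ∂μ, Tendsto (fun n => fn n p) atTop (𝓝 (f p))) :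
    Integrable f μ ∧ ∫ p, f p ∂μ ≤ C := by
  have hfat : ∫⁻ p, liminf (fun n => ENNReal.ofReal (fn n p)) atTop ∂μ ≤
      liminf (fun n => ∫⁻ p, ENNReal.ofReal (fn n p) ∂μ) atTop := lintegral_liminf_le'
    fun n => (hfn n).aestronglyMeasurable.aemeasurable.ennreal_ofReal
  have h0' : 0 ≤ᵐ[μ] f := by
    filter_upwards [hlim] with p hp
    exact ge_of_tendsto' hp fun n => h0 n p
  have e1 : ∫⁻ p, liminf (fun n => ENNReal.ofReal (fn n p)) atTop ∂μ =
      ∫⁻ p, ENNReal.ofReal (f p) ∂μ := by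
    refine lintegral_congr_ae ?_
    filter_upwards [hlim] with p hp
    exact ((ENNReal.continuous_ofReal.tendsto _).comp hp).liminf_eq
  have e2 : liminf (fun n => ∫⁻ p, ENNReal.ofReal (fn n p) ∂μ) atTop ≤ ENNReal.ofReal C := by
    refine liminf_le_of_le (by isBoundedDefault) fun b hb => ?_
    obtain ⟨n, hn⟩ := hb.exists
    refine hn.trans ?_
    rw [← ofReal_integral_eq_lintegral_ofReal (hfn n) (Eventually.of_forall (h0 n))]
    exact ENNReal.ofReal_le_ofReal (hC n)
  rw [e1] at hfat
  have hlt := hfat.trans e2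
  have hint : Integrable f μ := by
    refine ⟨hf, ?_⟩
    rw [hasFiniteIntegral_iff_ofReal h0']
    exact hlt.trans_lt ENNReal.ofReal_lt_top
  refine ⟨hint, ?_⟩
  rcases isEmpty_or_nonempty X with hX | ⟨⟨x⟩⟩
  · have := hC 0
    simpa [Measure.eq_zero_of_isEmpty μ] using this
  have hC0 : 0 ≤ C := (integral_nonneg (h0 0)).trans (hC 0)
  rw [← ofReal_integral_eq_lintegral_ofReal hint h0'] at hlt
  exact (ENNReal.ofReal_le_ofReal_iff hC0).1 hlt

section exhaustion

variable {v γ α f : Space3 → ℝ} {S : ℕ → Set Space3}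

theorem tendsto_integral_indicator (hf : Integrable f) (hS : ∀ n, MeasurableSet (S n))
    (hS1 : ∀ᵐ p, ∀ᶠ n in atTop, p ∈ S n) :
    Tendsto (fun n => ∫ p, (S n).indicator f p) atTop (𝓝 (∫ p, f p)) := by
  refine tendsto_integral_of_dominated_convergence (fun p => |f p|)
    (fun n => hf.aestronglyMeasurable.indicator (hS n)) hf.abs
    (fun n => Eventually.of_forall fun p => abs_indicator_le_abs _ _ _) ?_
  filter_upwards [hS1] with p hp
  exact tendsto_indicator_of_eventually_mem hp f

theorem tendsto_conv_indicator (hk : IsKernel v) (hf : Tame f) (hS : ∀ n, MeasurableSet (S n))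
    (hS1 : ∀ᵐ p, ∀ᶠ n in atTop, p ∈ S n) :
    Tendsto (fun n => conv v ((S n).indicator f) 0) atTop (𝓝 (conv v f 0)) := by
  have := tendsto_integral_indicator (hk.tame_integrable_mul hf 0) hS hS1
  refine this.congr fun n => ?_
  unfold conv
  refine integral_congr_ae (Eventually.of_forall fun p => ?_)
  by_cases hp : p ∈ S n <;> simp [hp]

theorem tendsto_freeEnergy_indicator (h : Adm γ α) (T : ℝ) (hS : ∀ n, MeasurableSet (S n))
    (hS1 : ∀ᵐ p, ∀ᶠ n in atTop, p ∈ S n) :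
    Tendsto (fun n => ∫ p, freeDensity T ((S n).indicator γ) ((S n).indicator α) p) atTop
      (𝓝 (∫ p, freeDensity T γ α p)) := by
  simp only [freeDensity_indicator]
  exact tendsto_integral_indicator (h.integrable_freeDensity T) hS hS1

theorem tendsto_reduced_indicator (hk : IsKernel v) (h : Adm γ α) (T : ℝ)
    (hS : ∀ n, MeasurableSet (S n)) (hS1 : ∀ᵐ p, ∀ᶠ n in atTop, p ∈ S n) {rn : ℕ → ℝ} {r : ℝ}
    (hr : Tendsto rn atTop (𝓝 r)) :
    Tendsto (fun n => reduced v T (rn n) ((S n).indicator γ) ((S n).indicator α)) atTop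
      (𝓝 (reduced v T r γ α)) :=
  (((tendsto_freeEnergy_indicator h T hS hS1).const_mul c3).add ((hr.const_mul c3).mul
    ((tendsto_conv_indicator hk h.tame_γ hS hS1).add
      (tendsto_conv_indicator hk h.tame_α hS hS1)))).add
    (((hk.tendsto_quadForm_indicator h.tame_α h.tame_α hS hS hS1 hS1).add
      (hk.tendsto_quadForm_indicator h.tame_γ h.tame_γ hS hS hS1 hS1)).const_mul (c3 ^ 2 / 2))

theorem tendsto_reducedMin_indicator (hk : IsKernel v) (h : Adm γ α) (T : ℝ)
    (hS : ∀ n, MeasurableSet (S n)) (hS1 : ∀ᵐ p, ∀ᶠ n in atTop, p ∈ S n) {rn : ℕ → ℝ} {r : ℝ}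
    (hr : Tendsto rn atTop (𝓝 r)) :
    Tendsto (fun n => reducedMin v T (rn n) ((S n).indicator γ) ((S n).indicator α)) atTop
      (𝓝 (reducedMin v T r γ α)) :=
  (((tendsto_freeEnergy_indicator h T hS hS1).const_mul c3).add ((hr.const_mul c3).mul
    ((tendsto_conv_indicator hk h.tame_γ hS hS1).sub
      (tendsto_conv_indicator hk h.tame_α hS hS1).abs))).add
    (((hk.tendsto_quadForm_indicator h.tame_α h.tame_α hS hS hS1 hS1).add
      (hk.tendsto_quadForm_indicator h.tame_γ h.tame_γ hS hS hS1 hS1)).const_mul (c3 ^ 2 / 2))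

end exhaustion

/-- The mass not bound in a limit of pairs that concentrate at most at zero momentum can be moved
into the condensate without increasing the energy. -/
theorem exists_adm_reduced_le_of_tendsto {v : Space3 → ℝ} (hk : IsKernel v) {T : ℝ} (hT : 0 < T)
    {b : Space3 → ℝ} (hbS : ∀ s : ℝ, 0 < s → ∃ M, ∀ p, s ≤ ‖p‖ → b p ≤ M)
    {γn αn : ℕ → Space3 → ℝ} {γ α : Space3 → ℝ} {Λ C r ρ e : ℝ} {en : ℕ → ℝ} (hr : 0 ≤ r)
    (hn : ∀ n, Adm (γn n) (αn n)) (hb : ∀ n p, γn n p ≤ b p) (hΛ : ∀ n, ∫ p, γn n p ≤ Λ)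
    (hC : ∀ n, ∫ p, ‖p‖ ^ 2 * γn n p ≤ C)
    (hm : AEStronglyMeasurable γ volume) (hm' : AEStronglyMeasurable α volume)
    (hγ0 : ∀ p, 0 ≤ γ p) (hsq : ∀ p, α p ^ 2 ≤ γ p * (1 + γ p))
    (hγ : ∀ᵐ p, Tendsto (fun n => γn n p) atTop (𝓝 (γ p)))
    (hα : ∀ᵐ p, Tendsto (fun n => αn n p) atTop (𝓝 (α p)))
    (hρ : Tendsto (fun n => r + c3 * ∫ p, γn n p) atTop (𝓝 ρ))
    (hen : Tendsto en atTop (𝓝 e)) (hle : ∀ n, reduced v T r (γn n) (αn n) ≤ en n) :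
    ∃ α', Adm γ α' ∧ c3 * ∫ p, γ p ≤ ρ ∧ reduced v T (ρ - c3 * ∫ p, γ p) γ α' ≤ e := by
  have hc := c3_pos
  have hadm : Adm γ α := by
    refine ⟨(integrable_of_tendsto_of_integral_le (C := Λ + C)
      (fn := fun n p => (1 + ‖p‖ ^ 2) * γn n p) (fun n => (hn n).int) ?_ ?_ ?_ ?_).1, hγ0, hm', hsq⟩
    · have : Continuous fun p : Space3 => 1 + ‖p‖ ^ 2 := by fun_prop
      exact this.aestronglyMeasurable.mul hm
    · exact fun n p => mul_nonneg (by positivity) ((hn n).nonneg p)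
    · intro n
      have : (fun p => (1 + ‖p‖ ^ 2) * γn n p) = fun p => γn n p + ‖p‖ ^ 2 * γn n p := by
        ext p; ring
      rw [this, integral_add (hn n).integrable (hn n).kinetic]
      exact add_le_add (hΛ n) (hC n)
    · filter_upwards [hγ] with p hp using hp.const_mul _
  -- By Fatou the limit may lose mass but cannot gain any; the deficit is assigned to the
  -- condensate.
  have hmass : c3 * ∫ p, γ p ≤ ρ := by
    refine le_of_forall_pos_le_add fun ε hε => ?_
    obtain ⟨n, h1, h2⟩ := ((eventually_integral_sub_le (μ := volume) (fn := γn) (f := γ) (g := 0)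
      (fun n => (hn n).integrable) hadm.integrable (integrable_zero _ _ _)
      (fun n p => by simpa using (hn n).nonneg p) hγ
      (show 0 < ε / (2 * c3) by positivity)).and
      (hρ.eventually (gt_mem_nhds (lt_add_of_pos_right ρ (half_pos hε))))).exists
    have h3 := mul_le_mul_of_nonneg_left h1 hc.le
    have h4 : c3 * (ε / (2 * c3)) = ε / 2 := by field_simp
    rw [mul_sub, h4] at h3
    linarith
  -- For fixed s the pairs cut off outside the ball are uniformly bounded, so their masses converge.
  -- The condensate enlarged by the mass in the ball therefore converges to ρ minus the limiting
  -- outer mass, and lower semicontinuity applies.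
  have hcut : ∀ ε : ℝ, 0 < ε → ∃ δ : ℝ, 0 < δ ∧ ∀ s : ℝ, 0 < s → s ≤ δ →
      reducedMin v T (ρ - c3 * ∫ p, (Metric.ball 0 s)ᶜ.indicator γ p)
        ((Metric.ball 0 s)ᶜ.indicator γ) ((Metric.ball 0 s)ᶜ.indicator α) ≤ e + ε := by
    intro ε hε
    obtain ⟨δ, hδ, hδs⟩ := exists_reducedMin_cut_le hk hT Λ hr hε
    refine ⟨δ, hδ, fun s hs hsδ => ?_⟩
    set D := Metric.ball (0 : Space3) s with hD
    have hDm : MeasurableSet D := measurableSet_ball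
    obtain ⟨M, hM⟩ := hbS s hs
    have hM' : ∀ n p, Dᶜ.indicator (γn n) p ≤ max M 0 := fun n p => by
      by_cases hp : p ∈ D
      · simp [hp]
      · have : s ≤ ‖p‖ := by simpa [D] using hp
        have h1 : p ∈ Dᶜ := hp
        simpa [hp] using Or.inl ((hb n p).trans (hM p this))
    have hlimγ : ∀ᵐ p, Tendsto (fun n => Dᶜ.indicator (γn n) p) atTop
        (𝓝 (Dᶜ.indicator γ p)) := by
      filter_upwards [hγ] with p hp
      by_cases hpD : p ∈ D
      · simp [hpD]
      · simpa [hpD] using hp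
    have hlimα : ∀ᵐ p, Tendsto (fun n => Dᶜ.indicator (αn n) p) atTop
        (𝓝 (Dᶜ.indicator α p)) := by
      filter_upwards [hα] with p hp
      by_cases hpD : p ∈ D
      · simp [hpD]
      · simpa [hpD] using hp
    have hind : ∀ n, Adm (Dᶜ.indicator (γn n)) (Dᶜ.indicator (αn n)) :=
      fun n => (hn n).indicator hDm.compl
    have hsplit : ∀ n, (∫ p, D.indicator (γn n) p) =
        (∫ p, γn n p) - ∫ p, Dᶜ.indicator (γn n) p := fun n => by
      have := integral_add ((hn n).integrable.indicator hDm.compl)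
        ((hn n).integrable.indicator hDm)
      have e : (fun p => Dᶜ.indicator (γn n) p + D.indicator (γn n) p) = γn n :=
        Set.indicator_compl_add_self D (γn n)
      rw [e] at this
      linarith
    have hmassD := tendsto_integral_of_moment (fun n => (hind n).integrable)
      (fun n => (hind n).kinetic) (hadm.indicator hDm.compl).integrable (fun n => (hind n).nonneg)
      (hadm.indicator hDm.compl).nonneg hM' (C := C) (fun n => by
        refine (integral_mono (hind n).kinetic (hn n).kinetic fun p => ?_).trans (hC n)
        have := (hn n).nonneg p
        have : Dᶜ.indicator (γn n) p ≤ γn n p :=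
          Set.indicator_le_self' (fun p _ => (hn n).nonneg p) p
        simp only
        gcongr) hlimγ
    refine reducedMin_le_of_tendsto hk hT hind (hadm.indicator hDm.compl) (Λ := Λ) (M := max M 0)
      (rn := fun n => r + c3 * ∫ p, D.indicator (γn n) p) (en := fun n => en n + ε)
      (fun n => (integral_mono (hind n).integrable (hn n).integrable fun p =>
        Set.indicator_le_self' (fun p _ => (hn n).nonneg p) p).trans (hΛ n))
      hM' hlimγ hlimα ?_ (hen.add_const ε) fun n => ?_
    · have := hρ.sub (hmassD.const_mul c3)
      refine this.congr fun n => ?_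
      rw [hsplit]
      ring
    · exact (hδs s hs hsδ _ _ (hn n) (hΛ n) r hr le_rfl).trans (by linarith [hle n])
  -- Let s → 0: the complements of the balls exhaust the space up to the null set {0}.
  have hfinal : reducedMin v T (ρ - c3 * ∫ p, γ p) γ α ≤ e := by
    refine le_of_forall_pos_le_add fun ε hε => ?_
    obtain ⟨δ, hδ, hδs⟩ := hcut ε hε
    have hS : ∀ j : ℕ, MeasurableSet (Metric.ball (0 : Space3) (δ * (1 / ((j : ℝ) + 1))))ᶜ :=
      fun j => measurableSet_ball.compl
    have hS1 : ∀ᵐ p : Space3, ∀ᶠ j : ℕ in atTop,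
        p ∈ (Metric.ball (0 : Space3) (δ * (1 / ((j : ℝ) + 1))))ᶜ := by
      have h0 : ∀ᵐ p : Space3, p ≠ 0 := by simp [ae_iff]
      filter_upwards [h0] with p hp
      have ht : Tendsto (fun j : ℕ => δ * (1 / ((j : ℝ) + 1))) atTop (𝓝 (δ * 0)) :=
        tendsto_one_div_add_atTop_nhds_zero_nat.const_mul δ
      rw [mul_zero] at ht
      filter_upwards [ht.eventually (gt_mem_nhds (norm_pos_iff.2 hp))] with j hj
      simp only [Set.mem_compl_iff, mem_ball_zero_iff, not_lt]
      exact hj.le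
    have ht := tendsto_reducedMin_indicator hk hadm T hS hS1
      (((tendsto_integral_indicator hadm.integrable hS hS1).const_mul c3).const_sub ρ)
    refine le_of_tendsto' ht fun j => hδs _ (by positivity) ?_
    have : 1 / ((j : ℝ) + 1) ≤ 1 := by
      rw [div_le_one (by positivity)]
      linarith [(Nat.cast_nonneg j : (0 : ℝ) ≤ j)]
    nlinarith
  obtain ⟨α', h1, h2⟩ := exists_reduced_eq_reducedMin (T := T) (r := ρ - c3 * ∫ p, γ p) hadm hk
  exact ⟨α', h1, hmass, h2.trans_le hfinal⟩

/-- Sequences of states with a common bound away from zero momentum have energy limits that are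
attained. -/
theorem exists_state_le_of_bounded {v : Space3 → ℝ} (hk : IsKernel v) {T ρ : ℝ} (hT : 0 < T)
    {b : Space3 → ℝ} (hbm : Measurable b) (hb0 : ∀ p, 0 ≤ b p)
    (hbS : ∀ s : ℝ, 0 < s → ∃ M, ∀ p, s ≤ ‖p‖ → b p ≤ M)
    {γn αn : ℕ → Space3 → ℝ} {rn en : ℕ → ℝ} {e : ℝ}
    (hn : ∀ n, Adm (γn n) (αn n)) (hb : ∀ n p, γn n p ≤ b p) (hr : ∀ n, 0 ≤ rn n)
    (hρ : ∀ n, rn n + c3 * ∫ p, γn n p = ρ) (hle : ∀ n, reduced v T (rn n) (γn n) (αn n) ≤ en n)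
    (hen : Tendsto en atTop (𝓝 e)) :
    ∃ γ α, Adm γ α ∧ (∀ p, γ p ≤ b p) ∧ c3 * ∫ p, γ p ≤ ρ ∧
      reduced v T (ρ - c3 * ∫ p, γ p) γ α ≤ e := by
  have hc := c3_pos
  have hmn : ∀ n, 0 ≤ c3 * ∫ p, γn n p := fun n =>
    mul_nonneg hc.le (integral_nonneg (hn n).nonneg)
  -- The condensate density is frozen first, because the functional is convex only at fixed r.
  obtain ⟨r, hrI, φ, hφ, hrlim⟩ := isCompact_Icc.tendsto_subseq (x := rn) (s := Set.Icc 0 ρ)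
    fun n => ⟨hr n, by linarith [hρ n, hmn n]⟩
  set Λ := (ρ + 1) / c3 with hΛ
  have hΛle : ∀ x : ℝ, c3 * x ≤ ρ + 1 → x ≤ Λ := fun x hx => by
    rw [hΛ, le_div_iff₀ hc]; linarith
  obtain ⟨C, hC0, hC⟩ := hk.exists_conv_bound Λ
  -- The mass constraint is relaxed by 1/(j + 1), since after freezing r it holds only
  -- approximately. It is affine in γ, so the class stays midpoint convex. The total density then
  -- stays below ρ + 1, whence the choice of `Λ`.
  set P : ℕ → (Space3 → ℝ) → (Space3 → ℝ) → Prop := fun j γ α =>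
    Adm γ α ∧ (∀ p, γ p ≤ b p) ∧ |r + c3 * (∫ p, γ p) - ρ| ≤ 1 / ((j : ℝ) + 1) ∧
      reduced v T r γ α ≤ e + 1 / ((j : ℝ) + 1) with hP
  have hone : ∀ j : ℕ, 1 / ((j : ℝ) + 1) ≤ 1 := fun j => by
    rw [div_le_one (by positivity)]
    linarith [(Nat.cast_nonneg j : (0 : ℝ) ≤ j)]
  have hPΛ : ∀ j γ α, P j γ α → ∫ p, γ p ≤ Λ := fun j γ α h => by
    have h1 := (abs_le.1 h.2.2.1).2
    exact hΛle _ (by linarith [hone j, hrI.1])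
  have hanti : ∀ m n, m ≤ n → ∀ γ α, P n γ α → P m γ α := by
    rintro m n hmn γ α ⟨h1, h2, h3, h4⟩
    have : 1 / ((n : ℝ) + 1) ≤ 1 / ((m : ℝ) + 1) :=
      one_div_le_one_div_of_le (by positivity) (by gcongr)
    exact ⟨h1, h2, h3.trans this, h4.trans (by linarith)⟩
  have hne : ∀ n, ∃ γ α, P n γ α := by
    intro j
    have hj : 0 < 1 / ((j : ℝ) + 1) := by positivity
    have t1 : Tendsto (fun n => |r - rn (φ n)|) atTop (𝓝 0) := by
      have := (hrlim.const_sub r).abs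
      simpa using this
    have t2 : Tendsto (fun n => en (φ n) + c3 * |r - rn (φ n)| * (C + C)) atTop (𝓝 e) := by
      have := (hen.comp hφ.tendsto_atTop).add ((t1.const_mul c3).mul_const (C + C))
      simpa using this
    obtain ⟨n, h1, h2⟩ := ((t1.eventually (gt_mem_nhds hj)).and
      (t2.eventually (gt_mem_nhds (lt_add_of_pos_right e hj)))).exists
    have hΛn : ∫ p, γn (φ n) p ≤ Λ := hΛle _ (by linarith [hρ (φ n), hr (φ n)])
    refine ⟨γn (φ n), αn (φ n), hn _, hb _, ?_, ?_⟩
    · have : r + c3 * (∫ p, γn (φ n) p) - ρ = r - rn (φ n) := by linarith [hρ (φ n)]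
      rw [this]
      exact h1.le
    -- The functional is affine in r, with slope bounded through the uniform bound C on both
    -- potentials.
    · have e1 : reduced v T r (γn (φ n)) (αn (φ n)) = reduced v T (rn (φ n)) (γn (φ n)) (αn (φ n)) +
          c3 * ((r - rn (φ n)) * (conv v (γn (φ n)) 0 + conv v (αn (φ n)) 0)) := by
        unfold reduced
        ring
      have e2 : (r - rn (φ n)) * (conv v (γn (φ n)) 0 + conv v (αn (φ n)) 0) ≤
          |r - rn (φ n)| * (C + C) := by
        refine (le_abs_self _).trans ?_
        rw [abs_mul]
        gcongr
        exact (abs_add_le _ _).trans (add_le_add ((hC _ _ (hn _).domBy_γ hΛn).1 0)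
          ((hC _ _ (hn _).domBy_α hΛn).1 0))
      have e3 := mul_le_mul_of_nonneg_left e2 hc.le
      rw [e1]
      linarith [hle (φ n)]
  have hmid : ∀ n γ α γ' α', P n γ α → P n γ' α' →
      P n (fun p => (γ p + γ' p) / 2) fun p => (α p + α' p) / 2 := by
    rintro j γ α γ' α' ⟨h1, h2, h3, h4⟩ ⟨h1', h2', h3', h4'⟩
    refine ⟨h1.midpoint h1', fun p => by linarith [h2 p, h2' p], ?_, ?_⟩
    · rw [integral_div, integral_add h1.integrable h1'.integrable]
      rw [abs_le] at h3 h3' ⊢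
      constructor <;> linarith [h3.1, h3.2, h3'.1, h3'.2]
    · have h := reduced_midpoint hk hT.le h1 h1' (r := r)
      have q1 := hk.quadForm_self_nonneg (h1.tame_γ.sub h1'.tame_γ)
      have q2 := hk.quadForm_self_nonneg (h1.tame_α.sub h1'.tame_α)
      have q3 := mul_nonneg (by positivity : 0 ≤ c3 ^ 2 / 8) (add_nonneg q1 q2)
      linarith
  obtain ⟨γj, αj, γ, α, hPj, hγ, hα, hm, hm', hγ0, hγb, hsq⟩ := exists_ae_tendsto
    hbm hb0 hanti hne hmid (fun j γ α h => h.1) (fun j γ α h => h.2.1) hPΛ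
  have hjlim : Tendsto (fun j : ℕ => 1 / ((j : ℝ) + 1)) atTop (𝓝 0) :=
    tendsto_one_div_add_atTop_nhds_zero_nat
  obtain ⟨α', h1, h2, h3⟩ := exists_adm_reduced_le_of_tendsto hk hT hbS (γn := γj) (αn := αj)
    (γ := γ) (α := α) (Λ := Λ)
    (C := (e + 1 + c3 / 2 * Λ + c3 * T * (∫ p, boseLog (2 * T) 1 p) +
      c3 * r * ((∫ p, v p) / 2)) / (c3 / 2)) (ρ := ρ) (e := e)
    (en := fun j => e + 1 / ((j : ℝ) + 1)) hrI.1
    (fun j => (hPj j).1) (fun j => (hPj j).2.1) (fun j => hPΛ j _ _ (hPj j)) (fun j => by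
      rw [le_div_iff₀ (by positivity)]
      have k1 := kinetic_le_of_reduced_le hk hT hrI.1 (hPj j).1
      have k2 := (hPj j).2.2.2
      have k3 : c3 / 2 * ∫ p, γj j p ≤ c3 / 2 * Λ := by gcongr; exact hPΛ j _ _ (hPj j)
      linarith [hone j])
    hm hm' hγ0 hsq hγ hα
    (by
      rw [tendsto_iff_norm_sub_tendsto_zero]
      exact squeeze_zero (fun j => norm_nonneg _) (fun j => (hPj j).2.2.1) hjlim)
    (by simpa using hjlim.const_add e) (fun j => (hPj j).2.2.2)
  exact ⟨γ, α', h1, hγb, h2, h3⟩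

/-! ### Minimizers under a pointwise bound -/

/-- The energy of a pair at total density `ρ`, up to the direct interaction term. -/
def energyAt (v : Space3 → ℝ) (T ρ : ℝ) (γ α : Space3 → ℝ) : ℝ :=
  reduced v T (ρ - c3 * ∫ p, γ p) γ α

/-- `(γ, α)` minimizes the energy at density `ρ` among the pairs with `γ ≤ k`. -/
structure IsTruncatedMin (v : Space3 → ℝ) (T ρ k : ℝ) (γ α : Space3 → ℝ) : Prop where
  adm : Adm γ α
  mass : c3 * ∫ p, γ p ≤ ρ
  le : ∀ p, γ p ≤ k
  min : ∀ γ' α', Adm γ' α' → c3 * ∫ p, γ' p ≤ ρ → (∀ p, γ' p ≤ k) →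
    energyAt v T ρ γ α ≤ energyAt v T ρ γ' α'

theorem adm_zero : Adm (fun _ => 0) fun _ => 0 :=
  ⟨by simp, fun _ => le_rfl, aestronglyMeasurable_const, fun _ => by simp⟩

theorem energyAt_ge {v : Space3 → ℝ} (hk : IsKernel v) {T ρ : ℝ} (hT : 0 < T)
    {γ α : Space3 → ℝ} (h : Adm γ α) (hm : c3 * ∫ p, γ p ≤ ρ) :
    -(ρ / 2 + c3 * T * (∫ p, boseLog (2 * T) 1 p) + c3 * ρ * ((∫ p, v p) / 2)) ≤
      energyAt v T ρ γ α := by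
  have hc := c3_pos
  have h0 : 0 ≤ c3 * ∫ p, γ p := mul_nonneg hc.le (integral_nonneg h.nonneg)
  have h1 := kinetic_le_of_reduced_le hk hT (sub_nonneg.2 hm) h
  have h2 : 0 ≤ ∫ p, ‖p‖ ^ 2 * γ p :=
    integral_nonneg fun p => mul_nonneg (by positivity) (h.nonneg p)
  have h3 : 0 ≤ c3 / 2 * ∫ p, ‖p‖ ^ 2 * γ p := by positivity
  have h4 : 0 ≤ (∫ p, v p) / 2 := div_nonneg (integral_nonneg hk.nonneg) (by norm_num)
  have h5 : c3 * (ρ - c3 * ∫ p, γ p) * ((∫ p, v p) / 2) ≤ c3 * ρ * ((∫ p, v p) / 2) := by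
    gcongr
    linarith
  unfold energyAt
  linarith

/-- A minimizing sequence has the constant k as common bound, and the limit produced by
`exists_state_le_of_bounded` obeys the same bound, so it stays in the class. -/
theorem exists_isTruncatedMin {v : Space3 → ℝ} (hk : IsKernel v) {T ρ k : ℝ} (hT : 0 < T)
    (hρ : 0 ≤ ρ) (hk0 : 0 ≤ k) : ∃ γ α, IsTruncatedMin v T ρ k γ α := by
  set A : Set ℝ := {x | ∃ γ α, Adm γ α ∧ c3 * ∫ p, γ p ≤ ρ ∧ (∀ p, γ p ≤ k) ∧
    energyAt v T ρ γ α = x} with hA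
  have hne : A.Nonempty := ⟨_, _, _, adm_zero, by simpa using hρ, fun _ => hk0, rfl⟩
  have hbdd : BddBelow A := ⟨_, by
    rintro x ⟨γ, α, h, hm, -, rfl⟩
    exact energyAt_ge hk hT h hm⟩
  obtain ⟨u, -, hu, huA⟩ := exists_seq_tendsto_sInf hne hbdd
  choose γn αn h1 h2 h3 h4 using huA
  obtain ⟨γ, α, g1, g2, g3, g4⟩ := exists_state_le_of_bounded hk hT (b := fun _ => k)
    measurable_const (fun _ => hk0) (fun _ _ => ⟨k, fun _ _ => le_rfl⟩) h1 h3
    (fun n => sub_nonneg.2 (h2 n)) (fun n => sub_add_cancel _ _) (fun n => (h4 n).le) hu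
  exact ⟨γ, α, g1, g3, g2, fun γ' α' h h' h'' =>
    g4.trans (csInf_le hbdd ⟨γ', α', h, h', h'', rfl⟩)⟩

/-! ### Radial potentials of a minimizer and scalar bounds for moving particles. -/

theorem exists_reflection {p q : Space3} (h : ‖p‖ = ‖q‖) : ∃ R : Space3 ≃ₗᵢ[ℝ] Space3, R p = q :=
  ⟨Submodule.reflection (Submodule.span ℝ {p - q})ᗮ, Submodule.reflection_sub h⟩

theorem IsKernel.conv_add {v f g : Space3 → ℝ} (hk : IsKernel v) (hf : Tame f) (hg : Tame g)
    (p : Space3) : conv v (fun q => f q + g q) p = conv v f p + conv v g p := by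
  unfold conv
  rw [← integral_add (hk.tame_integrable_mul hf p) (hk.tame_integrable_mul hg p)]
  refine integral_congr_ae (Eventually.of_forall fun q => ?_)
  simp only
  ring

theorem IsKernel.conv_sub {v f g : Space3 → ℝ} (hk : IsKernel v) (hf : Tame f) (hg : Tame g)
    (p : Space3) : conv v (fun q => f q - g q) p = conv v f p - conv v g p := by
  unfold conv
  rw [← integral_sub (hk.tame_integrable_mul hf p) (hk.tame_integrable_mul hg p)]
  refine integral_congr_ae (Eventually.of_forall fun q => ?_)
  simp only
  ring

namespace IsTruncatedMin

variable {v γ α : Space3 → ℝ} {T ρ k : ℝ}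

/-- The potentials generated by a minimizer are radial, by convexity. -/
theorem conv_radial (hk : IsKernel v) (hT : 0 < T) (h : IsTruncatedMin v T ρ k γ α) {p q : Space3}
    (hpq : ‖p‖ = ‖q‖) : conv v γ p = conv v γ q ∧ conv v α p = conv v α q := by
  obtain ⟨R, hR⟩ := exists_reflection hpq
  have hadm' := h.adm.comp R
  have hint : ∫ p, γ (R p) = ∫ p, γ p :=
    (R.measurePreserving).integral_comp R.toHomeomorph.measurableEmbedding γ
  have hmid : (∫ p, (γ p + γ (R p)) / 2) = ∫ p, γ p := by
    rw [integral_div, integral_add h.adm.integrable hadm'.integrable, hint]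
    ring
  -- The average of the minimizer with its reflected copy is an admissible competitor of equal mass.
  -- The gap in midpoint convexity then forces the quadratic forms of the differences to vanish,
  -- hence also their convolutions with v.
  have hmin := h.min _ _ (h.adm.midpoint hadm') (by rw [hmid]; exact h.mass)
    (fun p => by linarith [h.le p, h.le (R p)])
  unfold energyAt at hmin
  rw [hmid] at hmin
  have hc := reduced_midpoint hk hT.le (r := ρ - c3 * ∫ p, γ p) h.adm hadm'
  rw [reduced_comp hk h.adm R] at hc
  have t1 := h.adm.tame_γ.sub hadm'.tame_γ
  have t2 := h.adm.tame_α.sub hadm'.tame_α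
  have q1 := hk.quadForm_self_nonneg t1
  have q2 := hk.quadForm_self_nonneg t2
  have hc3 : 0 < c3 ^ 2 / 8 := by have := c3_pos; positivity
  have hsum : quadForm v (fun p => γ p - γ (R p)) (fun p => γ p - γ (R p)) +
      quadForm v (fun p => α p - α (R p)) (fun p => α p - α (R p)) ≤ 0 := by
    by_contra hcon
    push Not at hcon
    have := mul_pos hc3 hcon
    linarith
  have z1 := congrFun (hk.conv_eq_zero t1 (by linarith)) p
  have z2 := congrFun (hk.conv_eq_zero t2 (by linarith)) p
  rw [hk.conv_sub h.adm.tame_γ hadm'.tame_γ, hk.conv_comp, hR] at z1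
  rw [hk.conv_sub h.adm.tame_α hadm'.tame_α, hk.conv_comp, hR] at z2
  simp only [Pi.zero_apply] at z1 z2
  exact ⟨by linarith, by linarith⟩

end IsTruncatedMin

/-- Rescaling p along its ray to norm ‖q‖ moves it by |‖p‖ - ‖q‖|. Particles can thus be spread over
a whole shell at a cost depending on radii alone. -/
theorem abs_sub_le_of_radial {φ : Space3 → ℝ} {L : ℝ} (hr : ∀ p q, ‖p‖ = ‖q‖ → φ p = φ q)
    (hL : ∀ p q, |φ p - φ q| ≤ L * ‖p - q‖) (p q : Space3) :
    |φ p - φ q| ≤ L * |‖p‖ - ‖q‖| := by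
  rcases eq_or_ne p 0 with rfl | hp
  · refine (hL _ _).trans_eq ?_
    simp
  have hp0 : 0 < ‖p‖ := norm_pos_iff.2 hp
  have h1 : ‖(‖q‖ / ‖p‖) • p‖ = ‖q‖ := by
    rw [norm_smul, Real.norm_eq_abs, abs_of_nonneg (by positivity)]
    field_simp
  rw [← hr _ _ h1]
  refine (hL _ _).trans_eq ?_
  have : p - (‖q‖ / ‖p‖) • p = ((‖p‖ - ‖q‖) / ‖p‖) • p := by
    rw [sub_div, div_self hp0.ne', sub_smul, one_smul]
  rw [this, norm_smul, Real.norm_eq_abs, abs_div, abs_of_pos hp0]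
  field_simp

/-- Used with x the integral of α over the emptied set and m its mass: moved particles carry a
pairing θm with |θ| ≤ 1, and θ is x/m clipped to [-1, 1]. -/
theorem exists_clip {x m y : ℝ} (hm : 0 < m) (hx : |x| ≤ m + y) :
    ∃ θ : ℝ, |θ| ≤ 1 ∧ |θ * m - x| ≤ max y 0 := by
  refine ⟨max (-1) (min 1 (x / m)), ?_, ?_⟩
  · rw [abs_le]
    exact ⟨le_max_left _ _, max_le (by norm_num) (min_le_left _ _)⟩
  · have hxm : x / m * m = x := by field_simp
    have hx' := abs_le.1 hx
    have hy := le_max_left y 0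
    have hy0 := le_max_right y 0
    rcases le_total 1 (x / m) with h1 | h1
    · rw [min_eq_left h1, max_eq_right (by norm_num)]
      have : m ≤ x := by rwa [le_div_iff₀ hm, one_mul] at h1
      rw [abs_le]
      constructor <;> linarith
    · rw [min_eq_right h1]
      rcases le_total (-1) (x / m) with h2 | h2
      · rw [max_eq_right h2, hxm, sub_self, abs_zero]
        exact hy0
      · rw [max_eq_left h2]
        have : x ≤ -m := by
          rw [div_le_iff₀ hm] at h2
          linarith
        rw [abs_le]
        constructor <;> linarith

theorem half_le_log_one_add {y : ℝ} (h0 : 0 ≤ y) (h1 : y ≤ 1) : y / 2 ≤ Real.log (1 + y) := by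
  have := Real.one_sub_inv_le_log_of_pos (x := 1 + y) (by linarith)
  refine le_trans ?_ this
  rw [show 1 - (1 + y)⁻¹ = y / (1 + y) by field_simp; ring]
  exact div_le_div_of_nonneg_left h0 (by linarith) (by linarith)

/-- A lower bound on the entropy gained by adding `t` particles. -/
theorem entropy_gain {g a t θ : ℝ} (hg : 0 ≤ g) (h : a ^ 2 ≤ g * (1 + g)) (ht : 0 ≤ t)
    (ht1 : t ≤ 1 / 2) (hθ : |θ| ≤ 1) (κ : ℝ) :
    entropyDensity g a + t / 2 * (2 * κ - κ ^ 2 * (1 + 2 * g)) ≤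
      entropyDensity (g + t) (a + θ * t) := by
  have h1 := entropyDensity_shift hg h ht hθ
  have h2 : 0 ≤ 2 * t / (1 + 2 * g) := by positivity
  have h3 : 2 * t / (1 + 2 * g) ≤ 1 := by
    rw [div_le_one (by linarith)]
    linarith
  have h4 := half_le_log_one_add h2 h3
  -- Tangent bound for the convex function x ↦ 1/x at 1/κ. It is affine in g, so after integration
  -- only the mean of γ over the receiving set enters.
  have h5 : 2 * κ - κ ^ 2 * (1 + 2 * g) ≤ 1 / (1 + 2 * g) := by
    rw [le_div_iff₀ (by linarith)]
    nlinarith [sq_nonneg (1 - κ * (1 + 2 * g))]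
  have h6 := mul_le_mul_of_nonneg_left h5 (by positivity : 0 ≤ t / 2)
  have e : t / 2 * (1 / (1 + 2 * g)) = 1 / 2 * (2 * t / (1 + 2 * g) / 2) := by ring
  rw [e] at h6
  linarith

/-! ### Moving particles from a high density region to a low density region -/

/-- Changing a pair by an integrable perturbation of vanishing total mass. -/
theorem reduced_add_le {v γ α dγ dα : Space3 → ℝ} (hk : IsKernel v) {T r C W : ℝ}
    (hC : ∀ p, v p ≤ C) (h : Adm γ α)
    (hγ : Integrable dγ) (hα : Integrable dα)
    (hW : (∫ p, freeDensity T (fun p => γ p + dγ p) (fun p => α p + dα p) p) ≤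
      (∫ p, freeDensity T γ α p) + W) :
    reduced v T r (fun p => γ p + dγ p) (fun p => α p + dα p) ≤ reduced v T r γ α +
      c3 * (W + (∫ p, dγ p * (r * v p + c3 * conv v γ p)) +
        (∫ p, dα p * (r * v p + c3 * conv v α p)) +
        c3 / 2 * (C * (∫ p, |dα p|) ^ 2 + C * (∫ p, |dγ p|) ^ 2)) := by
  have tγ := Tame.of_integrable hγ
  have tα := Tame.of_integrable hα
  have key : ∀ f d : Space3 → ℝ, Tame f → Integrable d →
      (∫ p, d p * (r * v p + c3 * conv v f p)) = r * conv v d 0 + c3 * quadForm v f d := by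
    intro f d hf hd
    have td := Tame.of_integrable hd
    have i1 : Integrable fun p => v p * d p := by
      simpa [hk.even] using hk.tame_integrable_mul td 0
    rw [hk.quadForm_comm, hk.quadForm_eq td hf, hk.conv_zero, ← integral_const_mul,
      ← integral_const_mul, ← integral_add (i1.const_mul r)
        ((hk.integrable_mul_conv td hf).const_mul c3)]
    refine integral_congr_ae (Eventually.of_forall fun p => ?_)
    simp only
    ring
  rw [key γ dγ h.tame_γ hγ, key α dα h.tame_α hα]
  unfold reduced
  rw [hk.conv_add h.tame_γ tγ, hk.conv_add h.tame_α tα, hk.quadForm_add_self h.tame_γ tγ,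
    hk.quadForm_add_self h.tame_α tα]
  have hc := c3_pos
  have q1 := hk.quadForm_self_le hC hγ
  have q2 := hk.quadForm_self_le hC hα
  have q3 := mul_le_mul_of_nonneg_left (add_le_add q2 q1) (by positivity : 0 ≤ c3 ^ 2 / 2)
  have hW' := mul_le_mul_of_nonneg_left hW hc.le
  linarith

theorem abs_integral_mul_le_of_osc {D : Set Space3} {d φ : Space3 → ℝ} {C φ0 B : ℝ}
    (hd : Integrable d) (hdφ : Integrable fun p => d p * φ p) (hsupp : ∀ p, p ∉ D → d p = 0)
    (hφ : ∀ p ∈ D, |φ p - φ0| ≤ C) (hB : |φ0| ≤ B) :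
    |∫ p, d p * φ p| ≤ C * (∫ p, |d p|) + B * |∫ p, d p| := by
  have h1 := abs_integral_mul_sub_le hd hdφ hsupp hφ
  have h2 : |φ0 * ∫ p, d p| ≤ B * |∫ p, d p| := by
    rw [abs_mul]
    gcongr
  calc |∫ p, d p * φ p| = |((∫ p, d p * φ p) - φ0 * ∫ p, d p) + φ0 * ∫ p, d p| := by ring_nf
    _ ≤ _ := (abs_add_le _ _).trans (add_le_add h1 h2)

/-- At a truncated minimizer, moving the mass in `G` uniformly to `S` cannot lower the energy. -/
theorem IsTruncatedMin.swap_le {v γ α : Space3 → ℝ} {T ρ k : ℝ} (hk : IsKernel v) (hT : 0 < T)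
    (h : IsTruncatedMin v T ρ k γ α) {C L B : ℝ} (hC : ∀ p, v p ≤ C) (hL0 : 0 ≤ L)
    (hLγ : ∀ p q, |((ρ - c3 * ∫ p, γ p) * v p + c3 * conv v γ p) -
      ((ρ - c3 * ∫ p, γ p) * v q + c3 * conv v γ q)| ≤ L * |‖p‖ - ‖q‖|)
    (hLα : ∀ p q, |((ρ - c3 * ∫ p, γ p) * v p + c3 * conv v α p) -
      ((ρ - c3 * ∫ p, γ p) * v q + c3 * conv v α q)| ≤ L * |‖p‖ - ‖q‖|)
    (hB : ∀ p, |(ρ - c3 * ∫ p, γ p) * v p + c3 * conv v α p| ≤ B)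
    {G S : Set Space3} (hG : MeasurableSet G) (hS : MeasurableSet S)
    (hGfin : volume G < ⊤) (hSfin : volume S < ⊤) (hGpos : 0 < volume.real G)
    (hSpos : 0 < volume.real S) {t₁ d : ℝ}
    (ht₁ : 0 ≤ t₁) (hGt : ∀ p ∈ G, t₁ ≤ ‖p‖) (hSt : ∀ p ∈ S, ‖p‖ < t₁)
    {p₀ : Space3} (hd : ∀ p ∈ G ∪ S, |‖p‖ - ‖p₀‖| ≤ d) {M ε : ℝ} (hM : 1 ≤ M)
    (hγM : ∀ p ∈ G, M ≤ γ p)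
    (hε : ∀ g a : ℝ, M ≤ g → a ^ 2 ≤ g * (1 + g) → entropyDensity g a ≤ ε * g)
    (hτ : (∫ p, G.indicator γ p) / volume.real S ≤ 1 / 2)
    (hSk : ∀ p ∈ S, γ p ≤ k - 1 / 2) (κ : ℝ) :
    T / 2 * (2 * κ - κ ^ 2 * (1 + 2 * (∫ p, S.indicator γ p) / volume.real S)) ≤
      T * ε + 5 * (L * d) + B / (2 * M) + 7 * c3 * C * ∫ p, G.indicator γ p := by
  have hc := c3_pos
  have hdisj : ∀ p ∈ G, p ∉ S := fun p hp hp' => absurd (hGt p hp) (not_le.2 (hSt p hp'))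
  have hGi := h.adm.integrable.indicator hG
  have hSi := h.adm.integrable.indicator hS
  set m := ∫ p, G.indicator γ p with hm
  set V := volume.real S with hV
  set Γ := ∫ p, S.indicator γ p with hΓ
  have hconst : ∀ c : ℝ, Integrable (S.indicator fun _ => c) := fun c => by
    rw [integrable_indicator_iff hS]
    exact integrableOn_const hSfin.ne
  have hconst_int : ∀ c : ℝ, ∫ p, S.indicator (fun _ => c) p = V * c := fun c => by
    rw [integral_indicator hS, setIntegral_const, smul_eq_mul]
  have hGconst : Integrable (G.indicator fun _ => (1 : ℝ)) := by
    rw [integrable_indicator_iff hG]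
    exact integrableOn_const hGfin.ne
  have hGconst_int : ∫ p, G.indicator (fun _ => (1 : ℝ)) p = volume.real G := by
    rw [integral_indicator hG, setIntegral_const, smul_eq_mul, mul_one]
  have hGm : M * volume.real G ≤ m := by
    rw [← hGconst_int, ← integral_const_mul]
    refine integral_mono (hGconst.const_mul M) hGi fun p => ?_
    by_cases hp : p ∈ G
    · simpa [hp] using hγM p hp
    · simp [hp]
  have hm0 : 0 < m := lt_of_lt_of_le (by positivity) hGm
  have hGle : volume.real G ≤ m / M := by rw [le_div_iff₀ (by linarith)]; linarith
  have hGm1 : volume.real G ≤ m := hGle.trans (div_le_self hm0.le hM)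
  set τ := m / V with hτe
  have hτ0 : 0 ≤ τ := by positivity
  have hτV : V * τ = m := by rw [hτe]; field_simp
  have hGα : Integrable (G.indicator α) := h.adm.domBy_α.integrableOn hG hGfin
  have hGabs : ∫ p, |G.indicator α p| ≤ m + volume.real G / 2 := by
    have : ∫ p, |G.indicator α p| ≤ ∫ p, (G.indicator γ p + G.indicator (fun _ => 1) p * (1 / 2)) := by
      refine integral_mono hGα.abs (hGi.add (hGconst.mul_const _)) fun p => ?_
      by_cases hp : p ∈ G
      · simpa [hp] using abs_le_add_half (h.adm.nonneg p) (h.adm.sq_le p)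
      · simp [hp]
    rw [integral_add hGi (hGconst.mul_const _), integral_mul_const, hGconst_int] at this
    linarith
  -- The total of α is preserved up to half the volume of G, which is at most m/(2M) because γ ≥ M
  -- on G.
  obtain ⟨θ, hθ, hθm⟩ := exists_clip hm0 (abs_integral_le_integral_abs.trans hGabs)
  rw [max_eq_left (by positivity)] at hθm
  set dγ : Space3 → ℝ := fun p => S.indicator (fun _ => τ) p - G.indicator γ p with hdγ
  set dα : Space3 → ℝ := fun p => S.indicator (fun _ => θ * τ) p - G.indicator α p with hdα
  have idγ : Integrable dγ := (hconst τ).sub hGi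
  have idα : Integrable dα := (hconst _).sub hGα
  have hdγ0 : ∫ p, dγ p = 0 := by
    rw [integral_sub (hconst τ) hGi, hconst_int, hτV, sub_self]
  have hdα0 : |∫ p, dα p| ≤ m / (2 * M) := by
    rw [integral_sub (hconst _) hGα, hconst_int]
    have : V * (θ * τ) = θ * m := by rw [← hτV]; ring
    rw [this]
    refine hθm.trans ?_
    calc volume.real G / 2 ≤ m / M / 2 := by gcongr
      _ = _ := by field_simp
  have hdγ1 : ∫ p, |dγ p| ≤ 2 * m := by
    have : ∫ p, |dγ p| ≤ ∫ p, (S.indicator (fun _ => τ) p + G.indicator γ p) := by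
      refine integral_mono idγ.abs ((hconst τ).add hGi) fun p => ?_
      refine (abs_sub _ _).trans ?_
      rw [abs_of_nonneg (Set.indicator_nonneg (fun _ _ => hτ0) p),
        abs_of_nonneg (Set.indicator_nonneg (fun q _ => h.adm.nonneg q) p)]
    rw [integral_add (hconst τ) hGi, hconst_int, hτV] at this
    linarith
  have hdα1 : ∫ p, |dα p| ≤ 3 * m := by
    have : ∫ p, |dα p| ≤ ∫ p, (S.indicator (fun _ => τ) p + |G.indicator α p|) := by
      refine integral_mono idα.abs ((hconst τ).add hGα.abs) fun p => ?_
      refine (abs_sub _ _).trans ?_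
      gcongr
      by_cases hp : p ∈ S
      · simp only [hp, Set.indicator_of_mem, abs_mul, abs_of_nonneg hτ0]
        exact mul_le_of_le_one_left hτ0 hθ
      · simp [hp]
    rw [integral_add (hconst τ) hGα.abs, hconst_int, hτV] at this
    linarith
  have hsupp : ∀ p, p ∉ G ∪ S → dγ p = 0 ∧ dα p = 0 := fun p hp => by
    simp only [Set.mem_union, not_or] at hp
    simp [dγ, dα, hp.1, hp.2]
  have hGγ : ∀ p ∈ G, γ p + dγ p = 0 ∧ α p + dα p = 0 := fun p hp => by
    simp [dγ, dα, hp, hdisj p hp]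
  have hSγ : ∀ p ∈ S, γ p + dγ p = γ p + τ ∧ α p + dα p = α p + θ * τ := fun p hp => by
    have : p ∉ G := fun h' => hdisj p h' hp
    simp [dγ, dα, hp, this]
  have hrest : ∀ p, p ∉ G → p ∉ S → γ p + dγ p = γ p ∧ α p + dα p = α p := fun p hp hp' => by
    simp [dγ, dα, hp, hp']
  have hadm : Adm (fun p => γ p + dγ p) fun p => α p + dα p := by
    have hvals : ∀ p, 0 ≤ γ p + dγ p ∧
        (α p + dα p) ^ 2 ≤ (γ p + dγ p) * (1 + (γ p + dγ p)) := fun p => by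
      by_cases hp : p ∈ G
      · rw [(hGγ p hp).1, (hGγ p hp).2]
        simp
      · by_cases hp' : p ∈ S
        · rw [(hSγ p hp').1, (hSγ p hp').2]
          exact ⟨add_nonneg (h.adm.nonneg p) hτ0,
            sq_le_shift (h.adm.nonneg p) (h.adm.sq_le p) hτ0 hθ⟩
        · rw [(hrest p hp hp').1, (hrest p hp hp').2]
          exact ⟨h.adm.nonneg p, h.adm.sq_le p⟩
    refine ⟨?_, fun p => (hvals p).1, h.adm.meas.add idα.aestronglyMeasurable, fun p => (hvals p).2⟩
    have hG' : Integrable fun p => G.indicator (fun p => (1 + ‖p‖ ^ 2) * γ p) p :=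
      h.adm.int.indicator hG
    have hS' : Integrable fun p => (1 + ‖p‖ ^ 2) * S.indicator (fun _ => τ) p := by
      refine ((hconst τ).const_mul (1 + t₁ ^ 2)).mono' ?_ (Eventually.of_forall fun p => ?_)
      · have : Continuous fun p : Space3 => 1 + ‖p‖ ^ 2 := by fun_prop
        exact this.aestronglyMeasurable.mul (hconst τ).aestronglyMeasurable
      · rw [Real.norm_eq_abs, abs_of_nonneg (mul_nonneg (by positivity)
          (Set.indicator_nonneg (fun _ _ => hτ0) p))]
        by_cases hp : p ∈ S
        · simp only [hp, Set.indicator_of_mem]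
          gcongr
          exact (hSt p hp).le
        · simp [hp]
    refine ((h.adm.int.add hS').sub hG').congr (Eventually.of_forall fun p => ?_)
    by_cases hp : p ∈ G <;> simp [dγ, hp] <;> ring
  have hmass : ∫ p, (γ p + dγ p) = ∫ p, γ p := by
    rw [integral_add h.adm.integrable idγ, hdγ0, add_zero]
  have hle : ∀ p, γ p + dγ p ≤ k := fun p => by
    by_cases hp : p ∈ G
    · rw [(hGγ p hp).1]
      exact (h.adm.nonneg p).trans (h.le p)
    · by_cases hp' : p ∈ S
      · rw [(hSγ p hp').1]
        linarith [hSk p hp']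
      · rw [(hrest p hp hp').1]
        exact h.le p
  have hmin := h.min _ _ hadm (by rw [hmass]; exact h.mass) hle
  unfold energyAt at hmin
  rw [hmass] at hmin
  set Z := m / 2 * (2 * κ - κ ^ 2 * (1 + 2 * Γ / V)) with hZ
  -- Mass leaves radii at least t₁ and arrives at radii below t₁, so the kinetic change is at most
  -- t₁² times the integral of `dγ`, which is 0. Emptying G loses at most εm of entropy, and filling
  -- S gains at least Z.
  have hW : (∫ p, freeDensity T (fun p => γ p + dγ p) (fun p => α p + dα p) p) ≤
      (∫ p, freeDensity T γ α p) + (T * ε * m - T * Z) := by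
    have i1 : Integrable fun p => S.indicator (fun _ => T * (τ / 2 * (2 * κ - κ ^ 2))) p :=
      hconst _
    have i2 : Integrable fun p => T * (τ * κ ^ 2) * S.indicator γ p := hSi.const_mul _
    have i3 : Integrable fun p => T * ε * G.indicator γ p := hGi.const_mul _
    have i4 : Integrable fun p => t₁ ^ 2 * dγ p := idγ.const_mul _
    have i0 := h.adm.integrable_freeDensity T
    have hpt : ∫ p, freeDensity T (fun p => γ p + dγ p) (fun p => α p + dα p) p ≤
        ∫ p, ((((freeDensity T γ α p + t₁ ^ 2 * dγ p) + T * ε * G.indicator γ p) +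
          T * (τ * κ ^ 2) * S.indicator γ p) -
          S.indicator (fun _ => T * (τ / 2 * (2 * κ - κ ^ 2))) p) := by
      refine integral_mono (hadm.integrable_freeDensity T)
        ((((i0.add i4).add i3).add i2).sub i1) fun p => ?_
      simp only [freeDensity]
      by_cases hp : p ∈ G
      · rw [(hGγ p hp).1, (hGγ p hp).2, entropyDensity_zero]
        have e1 : dγ p = -γ p := by linarith [(hGγ p hp).1]
        have h1 := mul_le_mul_of_nonneg_left (hε _ _ (hγM p hp) (h.adm.sq_le p)) hT.le
        have h2 : t₁ ^ 2 * γ p ≤ ‖p‖ ^ 2 * γ p := by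
          have := h.adm.nonneg p
          have := hGt p hp
          gcongr
        rw [e1]
        simp only [hp, hdisj p hp, not_false_eq_true, Set.indicator_of_mem,
          Set.indicator_of_notMem]
        linarith
      · by_cases hp' : p ∈ S
        · rw [(hSγ p hp').1, (hSγ p hp').2]
          have e1 : dγ p = τ := by linarith [(hSγ p hp').1]
          have h1 := mul_le_mul_of_nonneg_left (entropy_gain (h.adm.nonneg p) (h.adm.sq_le p) hτ0
            hτ hθ κ) hT.le
          have h2 : ‖p‖ ^ 2 * τ ≤ t₁ ^ 2 * τ := by
            have := hSt p hp'
            gcongr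
          rw [e1]
          simp only [hp, hp', not_false_eq_true, Set.indicator_of_mem, Set.indicator_of_notMem]
          linarith
        · rw [(hrest p hp hp').1, (hrest p hp hp').2]
          have e1 : dγ p = 0 := by linarith [(hrest p hp hp').1]
          simp [e1, hp, hp']
    refine hpt.trans_eq ?_
    have j1 : Integrable fun p => freeDensity T γ α p + t₁ ^ 2 * dγ p := i0.add i4
    have j2 : Integrable fun p => freeDensity T γ α p + t₁ ^ 2 * dγ p +
      T * ε * G.indicator γ p := j1.add i3
    have j3 : Integrable fun p => freeDensity T γ α p + t₁ ^ 2 * dγ p +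
      T * ε * G.indicator γ p + T * (τ * κ ^ 2) * S.indicator γ p := j2.add i2
    rw [integral_sub j3 i1, integral_add j2 i2, integral_add j1 i3, integral_add i0 i4, integral_const_mul, integral_const_mul,
      integral_const_mul, hdγ0, hconst_int, ← hm, ← hΓ]
    have e2 : τ * Γ = m * (Γ / V) := by rw [hτe]; ring
    have e3 : V * (T * (τ / 2 * (2 * κ - κ ^ 2))) = T * (m / 2 * (2 * κ - κ ^ 2)) := by
      rw [← hτV]; ring
    rw [e3, hZ]
    have e4 : T * (τ * κ ^ 2) * Γ = T * κ ^ 2 * (m * (Γ / V)) := by rw [← e2]; ring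
    rw [e4]
    ring
  have hred := reduced_add_le hk (r := ρ - c3 * ∫ p, γ p) hC h.adm idγ idα hW
  have hC0 : 0 ≤ C := (hk.nonneg 0).trans (hC 0)
  have hB0 : 0 ≤ B := (abs_nonneg _).trans (hB 0)
  have hint : ∀ f D : Space3 → ℝ, Tame f → Integrable D → Integrable fun p =>
      D p * ((ρ - c3 * ∫ p, γ p) * v p + c3 * conv v f p) := by
    intro f D hf hD
    have td := Tame.of_integrable hD
    have i1 : Integrable fun p => v p * D p := by
      simpa [hk.even] using hk.tame_integrable_mul td 0
    refine ((i1.const_mul (ρ - c3 * ∫ p, γ p)).add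
      ((hk.integrable_mul_conv td hf).const_mul c3)).congr (Eventually.of_forall fun p => ?_)
    simp only [Pi.add_apply]
    ring
  have b1 := abs_integral_mul_le_of_osc (D := G ∪ S) (C := L * d) idγ
    (hint γ dγ h.adm.tame_γ idγ) (fun p hp => (hsupp p hp).1)
    (fun p hp => (hLγ p p₀).trans (by gcongr; exact hd p hp)) le_rfl
  have b2 := abs_integral_mul_le_of_osc (D := G ∪ S) (C := L * d) idα
    (hint α dα h.adm.tame_α idα) (fun p hp => (hsupp p hp).2)
    (fun p hp => (hLα p p₀).trans (by gcongr; exact hd p hp)) (hB p₀)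
  rw [hdγ0, abs_zero, mul_zero, add_zero] at b1
  have hd0 : 0 ≤ d := by
    obtain ⟨p, hp⟩ : G.Nonempty := by
      by_contra hne
      rw [Set.not_nonempty_iff_eq_empty] at hne
      simp [hne] at hGpos
    exact (abs_nonneg _).trans (hd p (Or.inl hp))
  have b3 : L * d * (∫ p, |dγ p|) ≤ L * d * (2 * m) := by gcongr
  have b4 : L * d * (∫ p, |dα p|) ≤ L * d * (3 * m) := by gcongr
  have b5 : B * |∫ p, dα p| ≤ B * (m / (2 * M)) := by gcongr
  have n1 : 0 ≤ ∫ p, |dα p| := integral_nonneg fun p => abs_nonneg _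
  have n2 : 0 ≤ ∫ p, |dγ p| := integral_nonneg fun p => abs_nonneg _
  have b6 : C * (∫ p, |dα p|) ^ 2 ≤ C * (3 * m) ^ 2 := by gcongr
  have b7 : C * (∫ p, |dγ p|) ^ 2 ≤ C * (2 * m) ^ 2 := by gcongr
  have b8 := mul_le_mul_of_nonneg_left (add_le_add b6 b7) (half_pos hc).le
  have b9 : 0 ≤ c3 * C * m ^ 2 := by positivity
  have hnn : 0 ≤ T * ε * m - T * Z + (∫ p, dγ p * ((ρ - c3 * ∫ p, γ p) * v p + c3 * conv v γ p)) +
        (∫ p, dα p * ((ρ - c3 * ∫ p, γ p) * v p + c3 * conv v α p)) +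
        c3 / 2 * (C * (∫ p, |dα p|) ^ 2 + C * (∫ p, |dγ p|) ^ 2) := by
    have : 0 ≤ c3 * (T * ε * m - T * Z +
        (∫ p, dγ p * ((ρ - c3 * ∫ p, γ p) * v p + c3 * conv v γ p)) +
        (∫ p, dα p * ((ρ - c3 * ∫ p, γ p) * v p + c3 * conv v α p)) +
        c3 / 2 * (C * (∫ p, |dα p|) ^ 2 + C * (∫ p, |dγ p|) ^ 2)) := by linarith
    exact nonneg_of_mul_nonneg_right this hc
  have c1 := le_abs_self (∫ p, dγ p * ((ρ - c3 * ∫ p, γ p) * v p + c3 * conv v γ p))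
  have c2 := le_abs_self (∫ p, dα p * ((ρ - c3 * ∫ p, γ p) * v p + c3 * conv v α p))
  -- The factor 5 is 2 + 3, from the L¹ bounds 2m and 3m on `dγ` and `dα`. The factor 7 rounds up
  -- (2² + 3²)/2. All terms carry a factor m, which is then cancelled.
  have fin : T * Z ≤ (T * ε + 5 * (L * d) + B / (2 * M) + 7 * c3 * C * m) * m := by
    have e : B * (m / (2 * M)) = B / (2 * M) * m := by ring
    rw [e] at b5
    linarith
  have e : T * Z = T / 2 * (2 * κ - κ ^ 2 * (1 + 2 * Γ / V)) * m := by rw [hZ]; ring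
  rw [e] at fin
  exact le_of_mul_le_mul_right fin hm0

/-! ### Minimizers are bounded away from zero momentum -/

theorem volume_real_ball {r : ℝ} (hr : 0 < r) (c : Space3) :
    volume.real (Metric.ball c r) = r ^ 3 * volume.real (Metric.ball (0 : Space3) 1) := by
  rw [measureReal_def, measureReal_def, Measure.addHaar_ball_of_pos _ _ hr, ENNReal.toReal_mul,
    ENNReal.toReal_ofReal (by positivity)]
  simp

theorem volume_real_shell_ge {r₁ r₂ : ℝ} (h1 : 0 < r₁) (h2 : r₁ ≤ r₂) :
    r₁ ^ 2 * (r₂ - r₁) * volume.real (Metric.ball (0 : Space3) 1) ≤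
      volume.real (Metric.ball (0 : Space3) r₂ \ Metric.ball 0 r₁) := by
  rw [measureReal_sdiff (Metric.ball_subset_ball h2) measurableSet_ball measure_ball_lt_top.ne,
    volume_real_ball h1, volume_real_ball (h1.trans_le h2), ← sub_mul]
  gcongr
  nlinarith [mul_nonneg (mul_nonneg (h1.trans_le h2).le (sub_nonneg.2 h2)) (add_nonneg h1.le
    (h1.trans_le h2).le)]

/-- Among `N` disjoint sets, one carries at most the fraction `1 / N` of the mass. -/
theorem exists_integral_indicator_le {γ : Space3 → ℝ} (hi : Integrable γ) (h0 : ∀ p, 0 ≤ γ p)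
    {Λ : ℝ} (hΛ : ∫ p, γ p ≤ Λ) {N : ℕ} (hN : 0 < N) {S : ℕ → Set Space3}
    (hS : ∀ j, MeasurableSet (S j)) (hd : ∀ i j, i < j → Disjoint (S i) (S j)) :
    ∃ j < N, ∫ p, (S j).indicator γ p ≤ Λ / N := by
  have hpd : (↑(Finset.range N) : Set ℕ).PairwiseDisjoint S := by
    intro i _ j _ hij
    rcases lt_or_gt_of_ne hij with h | h
    · exact hd i j h
    · exact (hd j i h).symm
  have hsum : ∑ j ∈ Finset.range N, ∫ p, (S j).indicator γ p ≤ ∑ _j ∈ Finset.range N, Λ / N := by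
    rw [← integral_finsetSum _ fun j _ => hi.indicator (hS j)]
    have e : (fun p => ∑ j ∈ Finset.range N, (S j).indicator γ p) =
        (⋃ j ∈ Finset.range N, S j).indicator γ := by
      ext p
      rw [Finset.indicator_biUnion_apply _ _ hpd]
    rw [e, Finset.sum_const, Finset.card_range, nsmul_eq_mul]
    have : (N : ℝ) * (Λ / N) = Λ := by field_simp
    rw [this]
    exact (integral_mono (hi.indicator (Finset.measurableSet_biUnion _ fun j _ => hS j)) hi
      fun p => Set.indicator_le_self' (fun p _ => h0 p) p).trans hΛ
  obtain ⟨j, hj, hle⟩ := Finset.exists_le_of_sum_le (Finset.nonempty_range_iff.2 hN.ne') hsum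
  exact ⟨j, Finset.mem_range.1 hj, hle⟩

/-- The constants depend on r only through r ≤ ρ, so they serve all truncated minimizers at once. -/
theorem potential_bounds {v f : Space3 → ℝ} (hk : IsKernel v) {Lv Cv C r ρ : ℝ}
    (hLv : ∀ p q, |v p - v q| ≤ Lv * ‖p - q‖) (hCv : ∀ p, v p ≤ Cv)
    (hr : 0 ≤ r) (hrρ : r ≤ ρ) (hb : ∀ p, |conv v f p| ≤ C)
    (hl : ∀ p q, |conv v f p - conv v f q| ≤ C * ‖p - q‖)
    (hrad : ∀ p q, ‖p‖ = ‖q‖ → conv v f p = conv v f q) :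
    (∀ p q, |(r * v p + c3 * conv v f p) - (r * v q + c3 * conv v f q)| ≤
      (ρ * Lv + c3 * C) * |‖p‖ - ‖q‖|) ∧
    ∀ p, |r * v p + c3 * conv v f p| ≤ ρ * Cv + c3 * C := by
  have hc := c3_pos
  constructor
  · refine abs_sub_le_of_radial (fun p q hpq => by rw [hk.radial p q hpq, hrad p q hpq])
      fun p q => ?_
    have e : (r * v p + c3 * conv v f p) - (r * v q + c3 * conv v f q) =
        r * (v p - v q) + c3 * (conv v f p - conv v f q) := by ring
    rw [e]
    refine (abs_add_le _ _).trans ?_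
    rw [abs_mul, abs_mul, abs_of_nonneg hr, abs_of_pos hc, add_mul]
    gcongr ?_ + ?_
    · rw [mul_assoc]
      exact mul_le_mul hrρ (hLv p q) (abs_nonneg _) (hr.trans hrρ)
    · rw [mul_assoc]
      exact mul_le_mul_of_nonneg_left (hl p q) hc.le
  · intro p
    refine (abs_add_le _ _).trans ?_
    rw [abs_mul, abs_mul, abs_of_nonneg hr, abs_of_pos hc, abs_of_nonneg (hk.nonneg p)]
    gcongr ?_ + ?_
    · exact mul_le_mul hrρ (hCv p) (hk.nonneg p) (hr.trans hrρ)
    · exact mul_le_mul_of_nonneg_left (hb p) hc.le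

theorem exists_measurable_subset_real_eq {E : Set Space3} (hE : NullMeasurableSet E volume) :
    ∃ S ⊆ E, MeasurableSet S ∧ volume.real S = volume.real E := by
  obtain ⟨S, hSE, hS, hae⟩ := hE.exists_measurable_subset_ae_eq
  exact ⟨S, hSE, hS, measureReal_congr hae⟩

set_option maxHeartbeats 1000000 in
/-- Truncated minimizers are bounded on `s ≤ ‖p‖`, uniformly in the truncation. -/
theorem exists_uniform_bound {v : Space3 → ℝ} (hk : IsKernel v) {T ρ s : ℝ} (hT : 0 < T)
    (hρ : 0 ≤ ρ) (hs : 0 < s) : ∃ M : ℝ, ∀ (k : ℝ) (γ α : Space3 → ℝ),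
      IsTruncatedMin v T ρ k γ α → ∀ᵐ p, s ≤ ‖p‖ → γ p ≤ M := by
  have hc := c3_pos
  set Λ := ρ / c3 with hΛ
  have hΛ0 : 0 ≤ Λ := by positivity
  obtain ⟨C, hC0, hC⟩ := hk.exists_conv_bound Λ
  obtain ⟨Cv, hCv0, hCv⟩ := hk.bounded
  obtain ⟨Lv, hLv0, hLv⟩ := hk.lipschitz
  set L := ρ * Lv + c3 * C with hL
  have hL0 : 0 ≤ L := by positivity
  set B := ρ * Cv + c3 * C with hB
  have hB0 : 0 ≤ B := by positivity
  set ω := volume.real (Metric.ball (0 : Space3) 1) with hω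
  have hω0 : 0 < ω := ENNReal.toReal_pos (Metric.measure_ball_pos _ _ one_pos).ne'
    measure_ball_lt_top.ne
  -- Shell j has inner radius at least s/4 and thickness δ_j/2, hence volume at least c₁ δ_j.
  set c₁ := ω * s ^ 2 / 32 with hc1
  have hc10 : 0 < c₁ := by positivity
  -- With κ = K δ_j the entropy gain is at least T K δ_j/2 = (10L + 3)δ_j. The potentials cost at
  -- most 10 L δ_j, and the three other errors together at most (5/2)δ_N, which is the
  -- contradiction.
  set K := (20 * L + 6) / T with hK
  have hK0 : 0 < K := by positivity
  have hTK : T * K = 20 * L + 6 := by rw [hK]; field_simp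
  set δ₀ := min (s / 4) (1 / (2 * K)) with hδ0
  have hδ00 : 0 < δ₀ := by positivity
  have hδs : δ₀ ≤ s / 4 := min_le_left _ _
  have hKδ : K * δ₀ ≤ 1 / 2 := by
    have : δ₀ ≤ 1 / (2 * K) := min_le_right _ _
    rw [le_div_iff₀ (by positivity)] at this
    linarith
  -- A shell with mass at most Λ/N and usable volume at least c₁ δ_j/2 contributes at most 4KΛ/(N
  -- c₁) ≤ 1/2 to κ times its occupation term. The factor δ_j cancels, so one N serves all shells.
  obtain ⟨N, hN⟩ := exists_nat_gt (8 * K * Λ / c₁)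
  have hN0' : (0 : ℝ) < N := lt_of_le_of_lt (by positivity) hN
  have hN0 : 0 < N := by exact_mod_cast hN0'
  rw [div_lt_iff₀ hc10] at hN
  -- Dyadic scales: consecutive distances at least halve, so the shells of radii from t₁ - δ_j to t₁
  -- - δ_j/2 are disjoint.
  set δ : ℕ → ℝ := fun j => δ₀ / 2 ^ j with hδ
  have hδpos : ∀ j, 0 < δ j := fun j => by positivity
  have hδle : ∀ i j, i ≤ j → δ j ≤ δ i := fun i j hij => by
    simp only [hδ]
    gcongr
    norm_num
  have hδhalf : ∀ i j, i < j → δ j ≤ δ i / 2 := fun i j hij => by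
    refine (hδle (i + 1) j hij).trans_eq ?_
    simp only [hδ, pow_succ]
    field_simp
  have hδδ0 : ∀ j, δ j ≤ δ₀ := fun j => by
    have := hδle 0 j (Nat.zero_le j)
    simpa [hδ] using this
  have hδN := hδpos N
  obtain ⟨M₁, hM1, hM1e⟩ := exists_entropyDensity_le (ε := δ N / T) (by positivity)
  -- Large enough that the entropy lost per moved particle, times T, is at most δ_N, and that the
  -- defect B/(2M) in the total of α is at most δ_N/2.
  set M := max (max 1 M₁) (B / δ N) with hM
  have hMone : 1 ≤ M := (le_max_left _ _).trans (le_max_left _ _)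
  have hMM1 : M₁ ≤ M := (le_max_right _ _).trans (le_max_left _ _)
  have hMB : B / (2 * M) ≤ δ N / 2 := by
    have : B / δ N ≤ M := le_max_right _ _
    rw [div_le_iff₀ hδN] at this
    rw [div_le_div_iff₀ (by positivity) (by positivity)]
    linarith
  -- For k above k₁ + 1/2, Markov's inequality leaves at least half of each shell volume with γ ≤ k
  -- - 1/2. For smaller k the truncation itself is the bound.
  set k₁ := 2 * Λ / (c₁ * δ N) + 1 with hk1
  have hk10 : 0 < k₁ := by positivity
  refine ⟨max M (k₁ + 1 / 2), fun k γ α h => ?_⟩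
  rcases le_or_gt k (k₁ + 1 / 2) with hkk | hkk
  · exact Eventually.of_forall fun p _ => (h.le p).trans (hkk.trans (le_max_right _ _))
  have hγΛ : ∫ p, γ p ≤ Λ := by
    rw [hΛ, le_div_iff₀ hc]
    linarith [h.mass]
  have hm0 : 0 ≤ c3 * ∫ p, γ p := mul_nonneg hc.le (integral_nonneg h.adm.nonneg)
  obtain ⟨b1, b2⟩ := hC γ γ h.adm.domBy_γ hγΛ
  obtain ⟨b3, b4⟩ := hC α γ h.adm.domBy_α hγΛ
  obtain ⟨hLγ, -⟩ := potential_bounds hk hLv hCv (sub_nonneg.2 h.mass)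
    (sub_le_self ρ hm0) b1 b2 fun p q hpq => (h.conv_radial hk hT hpq).1
  obtain ⟨hLα, hBα⟩ := potential_bounds hk hLv hCv (sub_nonneg.2 h.mass)
    (sub_le_self ρ hm0) b3 b4 fun p q hpq => (h.conv_radial hk hT hpq).2
  have hγm : AEMeasurable γ volume := h.adm.meas_γ.aemeasurable
  suffices hae : ∀ᵐ p, ¬(s ≤ ‖p‖ ∧ M < γ p) by
    filter_upwards [hae] with p hp hsp
    rw [not_and, not_lt] at hp
    exact (hp hsp).trans (le_max_left _ _)
  rw [ae_iff]
  simp only [not_not]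
  by_contra hpos
  set E := {p : Space3 | s ≤ ‖p‖ ∧ M < γ p} with hE
  have hEn : NullMeasurableSet E volume :=
    (measurableSet_le measurable_const measurable_norm).nullMeasurableSet.inter
      (nullMeasurableSet_lt aemeasurable_const hγm)
  obtain ⟨G₀, hG0E, hG0, hG0ae⟩ := hEn.exists_measurable_subset_ae_eq
  have hG0pos : volume G₀ ≠ 0 := by rwa [measure_congr hG0ae]
  have hkpos : 0 < k := by linarith
  -- The moved mass is made small enough that the added occupation is at most 1/2 and the quadratic
  -- interaction error at most δ_N. Both μ₀ and r serve the contradiction only: r may depend on k,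
  -- since the final bound does not involve it.
  set μ₀ := min (c₁ * δ N / 4) (δ N / (7 * c3 * Cv + 1)) with hμ0
  have hμ00 : 0 < μ₀ := by positivity
  set r := min (min 1 (δ N / 2)) (μ₀ / (k * ω)) with hr
  have hr0 : 0 < r := by positivity
  have hr1 : r ≤ 1 := (min_le_left _ _).trans (min_le_left _ _)
  have hrδ : r ≤ δ N / 2 := (min_le_left _ _).trans (min_le_right _ _)
  have hrμ : r * (k * ω) ≤ μ₀ := by
    have : r ≤ μ₀ / (k * ω) := min_le_right _ _
    rwa [le_div_iff₀ (by positivity)] at this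
  -- A set that is null near each of its points is null, so some small ball meets G₀ in positive
  -- measure. Localizing there makes all removed particles have nearly the same radius.
  obtain ⟨c, hcG, hcpos⟩ : ∃ c ∈ G₀, volume (G₀ ∩ Metric.ball c r) ≠ 0 := by
    by_contra hcon
    push Not at hcon
    exact hG0pos (measure_null_of_locally_null _ fun x hx =>
      ⟨_, inter_mem_nhdsWithin _ (Metric.ball_mem_nhds x hr0), hcon x hx⟩)
  set G := G₀ ∩ Metric.ball c r with hG
  have hGm : MeasurableSet G := hG0.inter measurableSet_ball
  have hGfin : volume G < ⊤ :=
    (measure_mono Set.inter_subset_right).trans_lt (measure_ball_lt_top (x := c) (r := r))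
  have hGpos : 0 < volume.real G := ENNReal.toReal_pos hcpos hGfin.ne
  have hGE : ∀ p ∈ G, s ≤ ‖p‖ ∧ M < γ p := fun p hp => hG0E hp.1
  have hcs : s ≤ ‖c‖ := (hG0E hcG).1
  have hGc : ∀ p ∈ G, |‖p‖ - ‖c‖| < r := fun p hp =>
    lt_of_le_of_lt (abs_norm_sub_norm_le p c) (by simpa [dist_eq_norm] using hp.2)
  set t₁ := ‖c‖ - r with ht1
  have hrN : r ≤ δ N := by linarith
  have ht1s : s / 2 ≤ t₁ := by linarith [hδδ0 N]
  set S : ℕ → Set Space3 := fun j =>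
    Metric.ball (0 : Space3) (t₁ - δ j / 2) \ Metric.ball 0 (t₁ - δ j) with hS
  have hSm : ∀ j, MeasurableSet (S j) := fun j => measurableSet_ball.diff measurableSet_ball
  have hSmem : ∀ j, ∀ p ∈ S j, t₁ - δ j ≤ ‖p‖ ∧ ‖p‖ < t₁ - δ j / 2 := fun j p hp => by
    have h2 : p ∉ Metric.ball (0 : Space3) (t₁ - δ j) := hp.2
    rw [mem_ball_zero_iff, not_lt] at h2
    exact ⟨h2, mem_ball_zero_iff.1 hp.1⟩
  have hSd : ∀ i j, i < j → Disjoint (S i) (S j) := fun i j hij => by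
    rw [Set.disjoint_left]
    intro p hp hp'
    linarith [(hSmem i p hp).2, (hSmem j p hp').1, hδhalf i j hij]
  obtain ⟨j, hjN, hjΓ⟩ := exists_integral_indicator_le h.adm.integrable h.adm.nonneg hγΛ hN0 hSm hSd
  have hδj := hδpos j
  have hδNj : δ N ≤ δ j := hδle j N hjN.le
  have hSvol : c₁ * δ j ≤ volume.real (S j) := by
    refine le_trans ?_ (volume_real_shell_ge (by linarith [hδδ0 j] : 0 < t₁ - δ j) (by linarith))
    have h1 : s / 4 ≤ t₁ - δ j := by linarith [hδδ0 j]
    have h2 : (s / 4) ^ 2 ≤ (t₁ - δ j) ^ 2 := by gcongr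
    have h3 : t₁ - δ j / 2 - (t₁ - δ j) = δ j / 2 := by ring
    rw [h3, hc1]
    calc ω * s ^ 2 / 32 * δ j = (s / 4) ^ 2 * (δ j / 2) * ω := by ring
      _ ≤ _ := by gcongr
  have hSfin : volume (S j) < ⊤ :=
    (measure_mono Set.sdiff_subset).trans_lt (measure_ball_lt_top (x := (0 : Space3)))
  -- The part of the shell with room for an extra occupation of up to 1/2 below the truncation k.
  obtain ⟨S', hS'sub, hS'm, hS'vol⟩ := exists_measurable_subset_real_eq
    (E := S j ∩ {p | γ p ≤ k - 1 / 2})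
    ((hSm j).nullMeasurableSet.inter (nullMeasurableSet_le hγm aemeasurable_const))
  have hS'fin : volume S' < ⊤ :=
    (measure_mono (hS'sub.trans Set.inter_subset_left)).trans_lt hSfin
  have hV : c₁ * δ j / 2 ≤ volume.real S' := by
    have h1 : volume.real (S j) ≤ volume.real (S j ∩ {p | γ p ≤ k - 1 / 2}) +
        volume.real {p | k - 1 / 2 ≤ γ p} := by
      have hfin : volume {p | k - 1 / 2 ≤ γ p} < ⊤ :=
        h.adm.integrable.measure_ge_lt_top (by linarith)
      refine (measureReal_mono (s₂ := (S j ∩ {p | γ p ≤ k - 1 / 2}) ∪ {p | k - 1 / 2 ≤ γ p})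
        (fun p hp => ?_) ?_).trans (measureReal_union_le _ _)
      · rcases le_total (γ p) (k - 1 / 2) with h' | h'
        · exact Or.inl ⟨hp, h'⟩
        · exact Or.inr h'
      · exact (measure_union_lt_top ((measure_mono Set.inter_subset_left).trans_lt hSfin) hfin).ne
    have h2 := mul_meas_ge_le_integral_of_nonneg (μ := volume)
      (Eventually.of_forall h.adm.nonneg) h.adm.integrable (k - 1 / 2)
    have h3 : volume.real {p | k - 1 / 2 ≤ γ p} ≤ c₁ * δ j / 2 := by
      have h4 : 2 * Λ / (c₁ * δ N) ≤ k - 1 / 2 := by linarith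
      rw [div_le_iff₀ (by positivity)] at h4
      have h5 : c₁ * δ N ≤ c₁ * δ j := by gcongr
      have h6 : (0 : ℝ) ≤ volume.real {p | k - 1 / 2 ≤ γ p} := measureReal_nonneg
      have h7 : 0 < k - 1 / 2 := by linarith
      have h8 : (k - 1 / 2) * (volume.real {p | k - 1 / 2 ≤ γ p} * 2) ≤
          (k - 1 / 2) * (c₁ * δ j) := by
        calc _ ≤ 2 * Λ := by linarith [h2.trans hγΛ]
          _ ≤ (k - 1 / 2) * (c₁ * δ N) := h4
          _ ≤ _ := by gcongr
      have := le_of_mul_le_mul_left h8 h7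
      linarith
    rw [hS'vol]
    linarith
  have hVpos : 0 < volume.real S' := lt_of_lt_of_le (by positivity) hV
  have hΓ' : ∫ p, S'.indicator γ p ≤ Λ / N := by
    refine (integral_mono (h.adm.integrable.indicator hS'm) (h.adm.integrable.indicator (hSm j))
      fun p => ?_).trans hjΓ
    exact Set.indicator_le_indicator_of_subset (hS'sub.trans Set.inter_subset_left)
      h.adm.nonneg p
  have hmG : ∫ p, G.indicator γ p ≤ μ₀ := by
    have h1 : ∫ p, G.indicator γ p ≤ k * volume.real G := by
      rw [integral_indicator hGm, mul_comm, ← smul_eq_mul, ← setIntegral_const]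
      exact setIntegral_mono h.adm.integrable.integrableOn (integrableOn_const hGfin.ne) h.le
    have h2 : volume.real G ≤ r * ω := by
      refine (measureReal_mono Set.inter_subset_right measure_ball_lt_top.ne).trans ?_
      rw [volume_real_ball hr0]
      gcongr
      exact pow_le_of_le_one hr0.le hr1 (by norm_num)
    calc _ ≤ k * volume.real G := h1
      _ ≤ k * (r * ω) := by gcongr
      _ ≤ _ := by linarith
  have hswap := h.swap_le hk hT hCv hL0 hLγ hLα hBα hGm hS'm hGfin hS'fin hGpos hVpos
    (t₁ := t₁) (d := 2 * δ j) (by linarith)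
    (fun p hp => by linarith [(abs_lt.1 (hGc p hp)).1])
    (fun p hp => by linarith [(hSmem j p (hS'sub hp).1).2]) (p₀ := c)
    (by
      rintro p (hp | hp)
      · exact (hGc p hp).le.trans (by linarith)
      · have := hSmem j p (hS'sub hp).1
        rw [abs_le]
        constructor <;> linarith [this.1, this.2])
    hMone (fun p hp => (hGE p hp).2.le)
    (fun g a hg ha => hM1e g a (hMM1.trans hg) ha)
    (by
      rw [div_le_iff₀ hVpos]
      have : μ₀ ≤ c₁ * δ N / 4 := min_le_left _ _
      have : c₁ * δ N ≤ c₁ * δ j := by gcongr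
      linarith)
    (fun p hp => (hS'sub hp).2) (K * δ j)
  have e1 : T * (δ N / T) = δ N := by field_simp
  rw [e1] at hswap
  have e2 : 7 * c3 * Cv * ∫ p, G.indicator γ p ≤ δ N := by
    have h1 : μ₀ ≤ δ N / (7 * c3 * Cv + 1) := min_le_right _ _
    rw [le_div_iff₀ (by positivity)] at h1
    have h2 : 7 * c3 * Cv * ∫ p, G.indicator γ p ≤ 7 * c3 * Cv * μ₀ := by gcongr
    linarith
  have e3 : (K * δ j) ^ 2 * (1 + 2 * (∫ p, S'.indicator γ p) / volume.real S') ≤ K * δ j := by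
    have h1 : 2 * (∫ p, S'.indicator γ p) / volume.real S' ≤ 2 * (Λ / N) / (c₁ * δ j / 2) := by
      gcongr
    have h2 : K * δ j * (2 * (Λ / N) / (c₁ * δ j / 2)) ≤ 1 / 2 := by
      have : K * δ j * (2 * (Λ / N) / (c₁ * δ j / 2)) = 4 * K * Λ / (N * c₁) := by
        field_simp
        ring
      rw [this, div_le_iff₀ (by positivity)]
      linarith
    have h3 : K * δ j ≤ 1 / 2 := le_trans (by gcongr; exact hδδ0 j) hKδ
    have h4 : K * δ j * (1 + 2 * (∫ p, S'.indicator γ p) / volume.real S') ≤ 1 := by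
      have := mul_le_mul_of_nonneg_left h1 (by positivity : 0 ≤ K * δ j)
      linarith
    calc _ = K * δ j * (K * δ j * (1 + 2 * (∫ p, S'.indicator γ p) / volume.real S')) := by ring
      _ ≤ K * δ j * 1 := by gcongr
      _ = _ := by ring
  have e4 := mul_le_mul_of_nonneg_left e3 (by positivity : 0 ≤ T / 2)
  have e5 : T / 2 * (K * δ j) = (10 * L + 3) * δ j := by
    calc _ = T * K * δ j / 2 := by ring
      _ = _ := by rw [hTK]; ring
  linarith

/-! ### Existence of a minimizer -/

/-- Truncation: the energy of a pair is approximated by pairs with bounded `γ`. -/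
theorem exists_truncated_energy_lt {v γ α : Space3 → ℝ} (hk : IsKernel v) {T ρ e : ℝ}
    (h : Adm γ α) (hm : c3 * ∫ p, γ p ≤ ρ) (he : energyAt v T ρ γ α < e) :
    ∃ N : ℕ, ∀ n : ℕ, N ≤ n → ∃ γ' α', Adm γ' α' ∧ c3 * ∫ p, γ' p ≤ ρ ∧
      (∀ p, γ' p ≤ n) ∧ energyAt v T ρ γ' α' < e := by
  set g := h.meas_γ.mk γ
  have hgm : Measurable g := h.meas_γ.stronglyMeasurable_mk.measurable
  obtain ⟨Z, hZsub, hZ, hZ0⟩ := exists_measurable_superset_of_null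
    (show volume {p | ¬γ p = g p} = 0 from h.meas_γ.ae_eq_mk)
  -- The null set where γ differs from its measurable representative is removed, so that γ ≤ n holds
  -- everywhere on `S n`.
  set S : ℕ → Set Space3 := fun n => {p | g p ≤ n} \ Z
  have hS : ∀ n, MeasurableSet (S n) := fun n => (measurableSet_le hgm measurable_const).diff hZ
  have hS1 : ∀ᵐ p, ∀ᶠ n in atTop, p ∈ S n := by
    have : ∀ᵐ p, p ∉ Z := by rw [ae_iff]; simpa using hZ0
    filter_upwards [this] with p hp
    obtain ⟨N, hN⟩ := exists_nat_ge (g p)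
    filter_upwards [eventually_ge_atTop N] with n hn
    exact ⟨hN.trans (by exact_mod_cast hn), hp⟩
  have ht := tendsto_reduced_indicator hk h T hS hS1
    (((tendsto_integral_indicator h.integrable hS hS1).const_mul c3).const_sub ρ)
  obtain ⟨N, hN⟩ := eventually_atTop.1 (ht.eventually (gt_mem_nhds he))
  refine ⟨N, fun n hn => ⟨_, _, h.indicator (hS n), ?_, fun p => ?_, hN n hn⟩⟩
  · refine le_trans ?_ hm
    exact mul_le_mul_of_nonneg_left (integral_mono (h.integrable.indicator (hS n)) h.integrable
      fun p => Set.indicator_le_self' (fun p _ => h.nonneg p) p) c3_pos.le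
  · by_cases hp : p ∈ S n
    · have h1 : γ p = g p := by
        by_contra hne
        exact hp.2 (hZsub hne)
      simp only [hp, Set.indicator_of_mem, h1]
      exact hp.1
    · simp [hp]

/-- A pair may be set to zero on a null set. -/
theorem exists_adm_of_ae_le {v γ α b : Space3 → ℝ} {T ρ : ℝ} (h : Adm γ α)
    (hb0 : ∀ p, 0 ≤ b p) (hb : ∀ᵐ p, γ p ≤ b p) :
    ∃ γ' α', Adm γ' α' ∧ (∀ p, γ' p ≤ b p) ∧ ∫ p, γ' p = ∫ p, γ p ∧
      energyAt v T ρ γ' α' = energyAt v T ρ γ α := by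
  obtain ⟨Z, hZsub, hZ, hZ0⟩ := exists_measurable_superset_of_null
    (show volume {p | ¬γ p ≤ b p} = 0 from hb)
  have hZae : ∀ᵐ p, p ∈ Zᶜ := by rw [ae_iff]; simpa using hZ0
  have e : ∀ f : Space3 → ℝ, Zᶜ.indicator f =ᵐ[volume] f := fun f => by
    filter_upwards [hZae] with p hp using Set.indicator_of_mem hp f
  have hconv : ∀ f p, conv v (Zᶜ.indicator f) p = conv v f p := fun f p => by
    refine integral_congr_ae ?_
    filter_upwards [e f] with q hq
    rw [hq]
  have hquad : ∀ f, quadForm v (Zᶜ.indicator f) (Zᶜ.indicator f) = quadForm v f f := fun f => by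
    refine integral_congr_ae ?_
    have h1 : ∀ᵐ z : Space3 × Space3, Zᶜ.indicator f z.1 = f z.1 :=
      Measure.quasiMeasurePreserving_fst.ae (e f)
    have h2 : ∀ᵐ z : Space3 × Space3, Zᶜ.indicator f z.2 = f z.2 :=
      Measure.quasiMeasurePreserving_snd.ae (e f)
    filter_upwards [h1, h2] with z hz1 hz2
    rw [hz1, hz2]
  refine ⟨_, _, h.indicator hZ.compl, fun p => ?_, integral_congr_ae (e γ), ?_⟩
  · by_cases hp : p ∈ Zᶜ
    · rw [Set.indicator_of_mem hp]
      by_contra hne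
      exact hp (hZsub hne)
    · rw [Set.indicator_of_notMem hp]
      exact hb0 p
  · unfold energyAt reduced
    rw [integral_congr_ae (e γ), hconv, hconv, hquad, hquad, freeDensity_indicator,
      integral_congr_ae (e _)]

/-- The uniform bounds for s = 1/(n + 1) are glued into a single b, which makes the truncated
minimizers a sequence with a common bound. Their energies decrease to a limit that the limiting pair
does not exceed, and a competitor of smaller energy would have a truncation that beats some
truncated minimizer. -/
theorem exists_energyAt_min {v : Space3 → ℝ} (hk : IsKernel v) {T ρ : ℝ} (hT : 0 < T)
    (hρ : 0 ≤ ρ) : ∃ γ α, Adm γ α ∧ c3 * ∫ p, γ p ≤ ρ ∧ ∀ γ' α', Adm γ' α' →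
      c3 * ∫ p, γ' p ≤ ρ → energyAt v T ρ γ α ≤ energyAt v T ρ γ' α' := by
  have hbound : ∀ n : ℕ, ∃ M : ℝ, ∀ (k : ℝ) (γ α : Space3 → ℝ), IsTruncatedMin v T ρ k γ α →
      ∀ᵐ p, 1 / ((n : ℝ) + 1) ≤ ‖p‖ → γ p ≤ M := fun n =>
    exists_uniform_bound hk hT hρ (by positivity)
  choose M hM using hbound
  -- a bound that is locally bounded away from the origin
  set b : Space3 → ℝ := fun p => |M ⌈1 / ‖p‖⌉₊| with hb
  have hbm : Measurable b := by
    have h1 : Measurable fun n : ℕ => |M n| := measurable_from_top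
    exact h1.comp (Nat.measurable_ceil.comp (measurable_const.div measurable_norm))
  have hb0 : ∀ p, 0 ≤ b p := fun p => abs_nonneg _
  have hbS : ∀ s : ℝ, 0 < s → ∃ C, ∀ p, s ≤ ‖p‖ → b p ≤ C := fun s hs => by
    refine ⟨∑ i ∈ Finset.range (⌈1 / s⌉₊ + 1), |M i|, fun p hp => ?_⟩
    refine Finset.single_le_sum (f := fun i => |M i|) (fun i _ => abs_nonneg _) ?_
    rw [Finset.mem_range, Nat.lt_succ_iff]
    exact Nat.ceil_mono (one_div_le_one_div_of_le hs hp)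
  have hae : ∀ k γ α, IsTruncatedMin v T ρ k γ α → ∀ᵐ p, γ p ≤ b p := fun k γ α h => by
    have hne : ∀ᵐ p : Space3, p ≠ 0 := by simp [ae_iff]
    filter_upwards [ae_all_iff.2 fun n => hM n k γ α h, hne] with p hp hp0
    refine (hp ⌈1 / ‖p‖⌉₊ ?_).trans (le_abs_self _)
    have hp1 : 0 < ‖p‖ := norm_pos_iff.2 hp0
    rw [div_le_iff₀ (by positivity)]
    have := Nat.le_ceil (1 / ‖p‖)
    rw [div_le_iff₀ hp1] at this
    nlinarith
  choose γn αn hmin using fun n : ℕ =>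
    exists_isTruncatedMin hk (k := (n : ℝ)) hT hρ (Nat.cast_nonneg n)
  choose γ' α' hadm hle hint hen using fun n : ℕ =>
    exists_adm_of_ae_le (v := v) (T := T) (ρ := ρ) (hmin n).adm hb0 (hae _ _ _ (hmin n))
  set u : ℕ → ℝ := fun n => energyAt v T ρ (γn n) (αn n) with hu
  -- The classes γ ≤ n grow with n, so the minimal energies decrease.
  have hanti : Antitone u := antitone_nat_of_succ_le fun n =>
    (hmin (n + 1)).min _ _ (hmin n).adm (hmin n).mass fun p => ((hmin n).le p).trans (by simp)
  have hbdd : BddBelow (Set.range u) := ⟨_, by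
    rintro _ ⟨n, rfl⟩
    exact energyAt_ge hk hT (hmin n).adm (hmin n).mass⟩
  have hlim : Tendsto u atTop (𝓝 (⨅ n, u n)) := tendsto_atTop_ciInf hanti hbdd
  have hmass : ∀ n, c3 * ∫ p, γ' n p ≤ ρ := fun n => by rw [hint]; exact (hmin n).mass
  obtain ⟨γ, α, h1, -, h3, h4⟩ := exists_state_le_of_bounded hk hT hbm hb0 hbS hadm hle
    (fun n => sub_nonneg.2 (hmass n)) (fun n => sub_add_cancel _ _) (fun n => (hen n).le) hlim
  refine ⟨γ, α, h1, h3, fun γ₁ α₁ g1 g2 => ?_⟩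
  refine h4.trans (le_of_forall_gt fun e he => ?_)
  obtain ⟨N, hN⟩ := exists_truncated_energy_lt hk g1 g2 he
  obtain ⟨γ₂, α₂, k1, k2, k3, k4⟩ := hN N le_rfl
  exact (ciInf_le hbdd N).trans_lt (((hmin N).min _ _ k1 k2 k3).trans_lt k4)

/-! ### Return to the canonical functional of V. -/

theorem mem_canonicalDomain_iff {ρ : ℝ} {x : State} : x ∈ canonicalDomain ρ ↔
    Adm x.γ x.α ∧ 0 ≤ x.ρ₀ ∧ x.ρ₀ = ρ - c3 * ∫ p, x.γ p := by
  constructor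
  · rintro ⟨⟨h1, h2, h3, h4, h5⟩, h6⟩
    exact ⟨⟨h1, h2, h3, h4⟩, h5, h6⟩
  · rintro ⟨⟨h1, h2, h3, h4⟩, h5, h6⟩
    exact ⟨⟨h1, h2, h3, h4, h5⟩, h6⟩

theorem canonicalEnergy_eq_energyAt {V : Space3 → ℝ} (hk : IsKernel (vHat V)) {T ρ : ℝ}
    {x : State} (hx : x ∈ canonicalDomain ρ) :
    canonicalEnergy V T x = energyAt (vHat V) T ρ x.γ x.α + 1 / 2 * vHat V 0 * ρ ^ 2 := by
  obtain ⟨h1, -, h3⟩ := mem_canonicalDomain_iff.1 hx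
  rw [canonicalEnergy_eq h1 hk, energyAt, rhoGamma, h3]
  ring

end BogoliubovGas
end

theorem theorem2p3 (V : BogoliubovGas.Space3 → ℝ) (hV : BogoliubovGas.IsInteraction V)
    (T : ℝ) (hT : 0 < T) (ρ : ℝ) (hρ : 0 ≤ ρ) :
    (∀ x ∈ BogoliubovGas.canonicalDomain ρ, BogoliubovGas.IsFiniteAt V x) ∧
    ∃ x ∈ BogoliubovGas.canonicalDomain ρ,
      IsMinOn (BogoliubovGas.canonicalEnergy V T) (BogoliubovGas.canonicalDomain ρ) x := by
  have hk := hV.isKernel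
  refine ⟨fun x hx => (BogoliubovGas.mem_canonicalDomain_iff.1 hx).1.isFiniteAt hk, ?_⟩
  obtain ⟨γ, α, h1, h2, h3⟩ := BogoliubovGas.exists_energyAt_min hk hT hρ
  have hx : (⟨γ, α, ρ - BogoliubovGas.c3 * ∫ p, γ p⟩ : BogoliubovGas.State) ∈
      BogoliubovGas.canonicalDomain ρ :=
    BogoliubovGas.mem_canonicalDomain_iff.2 ⟨h1, sub_nonneg.2 h2, rfl⟩
  refine ⟨_, hx, fun y hy => ?_⟩
  obtain ⟨g1, g2, g3⟩ := BogoliubovGas.mem_canonicalDomain_iff.1 hy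
  simp only [Set.mem_ofPred_eq]
  rw [BogoliubovGas.canonicalEnergy_eq_energyAt hk hx,
    BogoliubovGas.canonicalEnergy_eq_energyAt hk hy]
  exact add_le_add_left (h3 _ _ g1 (by linarith)) _
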